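/- Let $X=|K|$ be a connected polyhedron, where $K$ is a finite simplicial complex of dimension $d$, let $K'$ be a finite subdivision of $K$, let $p:\tilde X\to X$ be the universal covering and let $\pi\cong\pi_1(X)$ be its group of covering transformations. Let $D_n(X)$ be the space of $n$-element subsets of $X$ (the quotient of the space $F_n(X)\subset X^n$ of $n$-tuples of distinct points by reordering), and let $F_n(\tilde X,\pi)=\{(\tilde x_1,\dots,\tilde x_n)\in\tilde X^n : p(\tilde x_i)\ne p(\tilde x_j)\text{ for } i\neq j\}$, with the covering $p^n:F_n(\tilde X,\pi)\to D_n(X)$, $(\tilde x_1,\dots,\tilde x_n)\mapsto\{p(\tilde x_1),\dots,p(\tilde x_n)\}$, and the action $(\alpha_1,\dots,\alpha_n;\sigma)\cdot(\tilde x_1,\dots,\tilde x_n)=(\alpha_1\tilde x_{\sigma^{-1}(1)},\dots,\alpha_n\tilde x_{\sigma^{-1}(n)})$ of the semidirect product $\pi^n\rtimes\Sigma_n$. A continuous map $f:|K'|\to D_n(|K|)$ is called an $n$-valued simplicial map if on each closed simplex $s$ of $K'$ it has the form $f=\{\varphi_1,\dots,\varphi_n\}$ with each $\varphi_i$ mapping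 $s$ affinely onto a simplex of $K$. A lifting of $f$ is a map $\tilde f=(\tilde f_1,\dots,\tilde f_n):\tilde X\to F_n(\tilde X,\pi)$ with $p^n\circ\tilde f=f\circ p$. It determines a homomorphism $\tilde f_\#=(\phi_1,\dots,\phi_n;\sigma):\pi\to\pi^n\rtimes\Sigma_n$ by $\tilde f\circ\gamma=\tilde f_\#(\gamma)\circ\tilde f$. Let $\mathcal R(\tilde f_\#)$ be the set of equivalence classes of $\pi\times\{1,\dots,n\}$ under: $(\alpha,k)\sim(\beta,j)$ iff there is $\gamma\in\pi$ with $\sigma_\gamma(k)=j$ and $\alpha=\phi_j(\gamma)^{-1}\beta\gamma$. Let $\rho:\mathbb Z(\pi\times\{1,\dots,n\})\to\mathbb Z\mathcal R(\tilde f_\#)$ be the quotient homomorphism, and for $s=\sum c_ia_i\in\mathbb Z\pi$ write $s\times\{k\}=\sum c_i(a_i,k)$. Let $\tilde K,\tilde K'$ be the lifted triangulations of $\tilde X$, and let $C_q$ denote oriented simplicial chains. Let $\epsilon^q:C_q(\tilde K)\to C_q(\tilde K')$ send an oriented $q$-simplex to the sum of the $q$-simplices of $\tilde K'$ contained in it,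 with the same orientation, and let $\tilde f_k^q:C_q(\tilde K')\to C_q(\tilde K)$ be induced by the simplicial map $\tilde f_k$. Choose for every $q$-simplex of $K$ an oriented lift to $\tilde K$; these form a $\mathbb Z\pi$-basis of $C_q(\tilde K)$. For an additive endomorphism $h$ of $C_q(\tilde K)$ let $\operatorname{tr}h\in\mathbb Z\pi$ be the sum of the diagonal coefficients of the images under $h$ of these basis elements. **Statement.** Let $f,g:|K'|\to D_n(|K|)$ be $n$-valued simplicial maps, homotopic by a homotopy $H$ of maps to $D_n(|K|)$. Let $\tilde f$ be a lifting of $f$, and let $\tilde g$ be the lifting of $g$ at the end of the lifting of $H$ that starts at $\tilde f$. Then $\tilde g_\#=\tilde f_\#$, and for every choice of the oriented lifts of simplices (the same for $f$ and $g$) \[ \sum_{q=0}^d\sum_{k=1}^n(-1)^q\rho\big(\operatorname{tr}(\tilde f_k^q\circ\epsilon^q)\times\{k\}\big)=\sum_{q=0}^d\sum_{k=1}^n(-1)^q\rho\big(\operatorname{tr}(\tilde g_k^q\circ\epsilon^q)\times\{k\}\big)\in\mathbb Z\mathcal R(\tilde f_\#). \] -/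

import Mathlib

noncomputable section

namespace NValued

/-! ### Configuration spaces and `n`-valued maps -/

/-- The ordered configuration space `F_n(Y)`, a subspace of `Y ^ n`. -/
abbrev OrdConf (n : ℕ) (Y : Type*) : Type _ := {y : Fin n → Y // Function.Injective y}

/-- Two ordered configurations are identified when they differ by a reordering. -/
def confSetoid (n : ℕ) (Y : Type*) : Setoid (OrdConf n Y) where
  r y z := ∃ σ : Equiv.Perm (Fin n), z.1 = y.1 ∘ σ
  iseqv :=
    { refl := fun _ => ⟨1, rfl⟩
      symm := by
        rintro y z ⟨σ, h⟩
        exact ⟨σ⁻¹, by ext i; simp [h]⟩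
      trans := by
        rintro x y z ⟨σ, h⟩ ⟨τ, h'⟩
        exact ⟨σ * τ, by ext i; simp [h, h']⟩ }

/-- The unordered configuration space `D_n(Y)`. -/
def UConf (n : ℕ) (Y : Type*) : Type _ := Quotient (confSetoid n Y)

/-- `D_n(Y)` carries the quotient topology from `F_n(Y)`. -/
instance (n : ℕ) (Y : Type*) [TopologicalSpace Y] : TopologicalSpace (UConf n Y) :=
  inferInstanceAs (TopologicalSpace (Quotient (confSetoid n Y)))

/-- The `n`-element set `{y_1, …, y_n}` underlying a point of `D_n(Y)`. -/
def UConf.points {n : ℕ} {Y : Type*} : UConf n Y → Set Y :=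
  Quotient.lift (fun y : OrdConf n Y => Set.range y.1) (by
    rintro y z ⟨σ, h⟩
    rw [h, σ.surjective.range_comp])

/-! ### Universal coverings, covering transformations and liftings -/

/-- A universal covering: a covering map whose total space is simply connected. -/
structure IsUniversalCover {Xt X : Type*} [TopologicalSpace Xt] [TopologicalSpace X]
    (p : Xt → X) : Prop where
  isCoveringMap : IsCoveringMap p
  simplyConnected : SimplyConnectedSpace Xt

/-- The group `π` of covering transformations of `p`; for the universal covering of a connected
polyhedron it is the fundamental group. -/
def Deck {Xt X : Type*} [TopologicalSpace Xt] (p : Xt → X) : Subgroup (Xt ≃ₜ Xt) where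
  carrier := {γ | ∀ x, p (γ x) = p x}
  mul_mem' {a b} ha hb x := by
    change p (a (b x)) = p x
    rw [ha, hb]
  one_mem' _ := rfl
  inv_mem' {a} ha x := by
    change p (a.symm x) = p x
    rw [← ha (a.symm x), a.apply_symm_apply]

/-- `π` acts on the covering space by evaluation. -/
instance {Xt X : Type*} [TopologicalSpace Xt] (p : Xt → X) : MulAction (Deck p) Xt where
  smul γ x := γ.1 x
  one_smul _ := rfl
  mul_smul _ _ _ := rfl

theorem Deck.map_smul {Xt X : Type*} [TopologicalSpace Xt] {p : Xt → X} (γ : Deck p) (x : Xt) :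
    p (γ • x) = p x := γ.2 x

theorem Deck.continuous_smul {Xt X : Type*} [TopologicalSpace Xt] {p : Xt → X} (γ : Deck p) :
    Continuous (fun x : Xt => γ • x) := γ.1.continuous

/-- The orbit configuration space `F_n(X̃, π)`, a subspace of `X̃ ^ n`. -/
abbrev OrbConf {Xt X : Type*} (p : Xt → X) (n : ℕ) : Type _ :=
  {x : Fin n → Xt // Function.Injective (p ∘ x)}

/-- The covering `p^n : F_n(X̃, π) → D_n(X)`, applying `p` to each coordinate. -/
def OrbConf.proj {Xt X : Type*} {p : Xt → X} {n : ℕ} (x : OrbConf p n) : UConf n X :=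
  Quotient.mk (confSetoid n X) ⟨p ∘ x.1, x.2⟩

/-- The semidirect product `π ^ n ⋊ Σ_n`, with product
`(α; σ) (β; ρ) = (k ↦ α_k β_{σ⁻¹ k}; σ ρ)`. -/
abbrev Wreath (π : Type*) [Group π] (n : ℕ) : Type _ :=
  (Fin n → π) ⋊[mulAutArrow] Equiv.Perm (Fin n)

/-- The action `(α; σ) • (x_1, …, x_n) = (k ↦ α_k x_{σ⁻¹ k})` on the orbit configuration space. -/
instance {Xt X : Type*} [TopologicalSpace Xt] (p : Xt → X) (n : ℕ) :
    MulAction (Wreath (Deck p) n) (OrbConf p n) where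
  smul a x := ⟨fun k => a.left k • x.1 (a.right⁻¹ k), by
    intro i j h
    have h' : (p ∘ x.1) (a.right⁻¹ i) = (p ∘ x.1) (a.right⁻¹ j) := by
      simpa [Deck.map_smul] using h
    exact a.right⁻¹.injective (x.2 h')⟩
  one_smul x := by
    apply Subtype.ext
    funext k
    change (1 : Deck p) • x.1 ((1 : Equiv.Perm (Fin n))⁻¹ k) = x.1 k
    simp
  mul_smul a b x := by
    apply Subtype.ext
    funext k
    change (a.left k * b.left (a.right⁻¹ k)) • x.1 ((a.right * b.right)⁻¹ k)
      = a.left k • (b.left (a.right⁻¹ k) • x.1 (b.right⁻¹ (a.right⁻¹ k)))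
    rw [mul_smul, mul_inv_rev]
    rfl

theorem OrbConf.smul_apply {Xt X : Type*} [TopologicalSpace Xt] {p : Xt → X} {n : ℕ}
    (a : Wreath (Deck p) n) (x : OrbConf p n) (k : Fin n) :
    (a • x).1 k = a.left k • x.1 (a.right⁻¹ k) := rfl

/-- A lifting `f̃ : X̃ → F_n(X̃, π)` of an `n`-valued map `f : X → D_n(X)`. -/
structure Lifting {Xt X : Type*} [TopologicalSpace Xt] [TopologicalSpace X] (p : Xt → X) {n : ℕ}
    (f : C(X, UConf n X)) where
  toMap : C(Xt, OrbConf p n)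
  proj_eq : ∀ x, (toMap x).proj = f (p x)

/-- The coordinate `f̃_k : X̃ → X̃` of a lifting. -/
def Lifting.coord {Xt X : Type*} [TopologicalSpace Xt] [TopologicalSpace X] {p : Xt → X} {n : ℕ}
    {f : C(X, UConf n X)} (F : Lifting p f) (k : Fin n) (x : Xt) : Xt := (F.toMap x).1 k

theorem Lifting.continuous_coord {Xt X : Type*} [TopologicalSpace Xt] [TopologicalSpace X]
    {p : Xt → X} {n : ℕ} {f : C(X, UConf n X)} (F : Lifting p f) (k : Fin n) :
    Continuous (F.coord k) :=
  (continuous_apply k).comp (continuous_subtype_val.comp F.toMap.continuous)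

theorem Lifting.points_eq {Xt X : Type*} [TopologicalSpace Xt] [TopologicalSpace X]
    {p : Xt → X} {n : ℕ} {f : C(X, UConf n X)} (F : Lifting p f) (x : Xt) :
    (f (p x)).points = Set.range (fun k => p (F.coord k x)) := by
  rw [← F.proj_eq]
  rfl

/-! ### The induced homomorphism `f̃_#` -/

theorem Deck.eq_of_smul_eq {Xt X : Type*} [TopologicalSpace Xt] [TopologicalSpace X] {p : Xt → X}
    (hp : IsUniversalCover p) {α β : Deck p} {x : Xt} (h : α • x = β • x) : α = β := by
  have := hp.simplyConnected
  apply Subtype.ext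
  apply Homeomorph.ext
  intro y
  exact congrFun (hp.isCoveringMap.eq_of_comp_eq α.1.continuous β.1.continuous
    (by funext z; exact (α.2 z).trans (β.2 z).symm) x h) y

theorem OrbConf.eq_of_smul_eq {Xt X : Type*} [TopologicalSpace Xt] [TopologicalSpace X]
    {p : Xt → X} (hp : IsUniversalCover p) {n : ℕ} {a b : Wreath (Deck p) n} {x : OrbConf p n}
    (h : a • x = b • x) : a = b := by
  have hk : ∀ k, a.left k • x.1 (a.right⁻¹ k) = b.left k • x.1 (b.right⁻¹ k) := fun k => by
    rw [← OrbConf.smul_apply, ← OrbConf.smul_apply, h]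
  have hr : a.right = b.right := by
    apply inv_injective
    ext k
    congr 1
    apply x.2
    have := congrArg p (hk k)
    rwa [Deck.map_smul (p := p), Deck.map_smul (p := p)] at this
  refine SemidirectProduct.ext ?_ hr
  funext k
  have := hk k
  rw [hr] at this
  exact Deck.eq_of_smul_eq hp this

theorem select {A Z : Type*} [TopologicalSpace A] [PreconnectedSpace A] [Nonempty A]
    [TopologicalSpace Z] [T2Space Z] {n : ℕ} {u : A → Z} {w : Fin n → A → Z} (hu : Continuous u)
    (hw : ∀ i, Continuous (w i)) (h : ∀ a, ∃ i, u a = w i a)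
    (hd : ∀ a, Function.Injective (fun i => w i a)) : ∃ i, ∀ a, u a = w i a := by
  obtain ⟨a₀⟩ := ‹Nonempty A›
  obtain ⟨i, hi⟩ := h a₀
  have hcl : ∀ j, IsClosed {a | u a = w j a} := fun j => isClosed_eq hu (hw j)
  have hco : {a | u a = w i a}ᶜ = ⋃ j ∈ {j : Fin n | j ≠ i}, {a | u a = w j a} := by
    ext a
    simp only [Set.mem_compl_iff, Set.mem_ofPred_eq, Set.mem_iUnion, exists_prop]
    constructor
    · intro ha
      obtain ⟨j, hj⟩ := h a
      exact ⟨j, fun e => ha (e ▸ hj), hj⟩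
    · rintro ⟨j, hj, ha⟩ ha'
      exact hj (hd a (ha.symm.trans ha'))
  have hop : IsOpen {a | u a = w i a} := by
    rw [← isClosed_compl_iff, hco]
    exact (Set.toFinite _).isClosed_biUnion fun j _ => hcl j
  have huniv := IsClopen.eq_univ ⟨hcl i, hop⟩ ⟨a₀, hi⟩
  exact ⟨i, fun a => by
    have : a ∈ {a | u a = w i a} := huniv ▸ Set.mem_univ a
    exact this⟩

theorem locallyPathConnectedSpace_of_isLocalHomeomorph {A B : Type*} [TopologicalSpace A]
    [TopologicalSpace B] [LocallyPathConnectedSpace B] {f : A → B} (hf : IsLocalHomeomorph f) :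
    LocallyPathConnectedSpace A := by
  rw [locallyPathConnectedSpace_iff_pathComponentIn_mem_nhds]
  intro x u hu hxu
  obtain ⟨U, hU, hUf⟩ := isLocalHomeomorph_iff_isOpenEmbedding_restrict.mp hf x
  have := hUf.locallyPathConnectedSpace
  have hx : x ∈ U := mem_of_mem_nhds hU
  have h1 : (Subtype.val ⁻¹' u : Set U) ∈ nhds (⟨x, hx⟩ : U) :=
    continuous_subtype_val.continuousAt.preimage_mem_nhds (hu.mem_nhds hxu)
  obtain ⟨s, ⟨hs, hsp⟩, hsu⟩ := (path_connected_basis (⟨x, hx⟩ : U)).mem_iff.mp h1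
  have h2 : Subtype.val '' s ∈ nhds x := by
    rw [← map_nhds_subtype_coe_eq_nhds hx hU]
    exact Filter.image_mem_map hs
  refine Filter.mem_of_superset h2 ?_
  refine (hsp.image continuous_subtype_val).subset_pathComponentIn
    ⟨⟨x, hx⟩, mem_of_mem_nhds hs, rfl⟩ ?_
  rintro _ ⟨y, hy, rfl⟩
  exact hsu hy

theorem Deck.exists_smul_eq {Xt X : Type*} [TopologicalSpace Xt] [TopologicalSpace X]
    [LocallyPathConnectedSpace X] {p : Xt → X} (hp : IsUniversalCover p) {x y : Xt}
    (h : p x = p y) : ∃ γ : Deck p, γ • x = y := by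
  have := hp.simplyConnected
  have := locallyPathConnectedSpace_of_isLocalHomeomorph hp.isCoveringMap.isLocalHomeomorph
  have key : ∀ a b : Xt, p a = p b → ∃ F : C(Xt, Xt), F a = b ∧ ∀ z, p (F z) = p z := by
    intro a b hab
    obtain ⟨F, ⟨h1, h2⟩, -⟩ := hp.isCoveringMap.existsUnique_continuousMap_lifts
      ⟨p, hp.isCoveringMap.continuous⟩ a b hab.symm
    exact ⟨F, h1, fun z => congrFun h2 z⟩
  obtain ⟨F, hF, hFp⟩ := key x y h
  obtain ⟨G, hG, hGp⟩ := key y x h.symm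
  have hGF : ∀ z, G (F z) = z := congrFun (hp.isCoveringMap.eq_of_comp_eq
    (G.continuous.comp F.continuous) continuous_id
    (by funext z; simp [hFp, hGp]) x (by simp [hF, hG]))
  have hFG : ∀ z, F (G z) = z := congrFun (hp.isCoveringMap.eq_of_comp_eq
    (F.continuous.comp G.continuous) continuous_id
    (by funext z; simp [hFp, hGp]) y (by simp [hF, hG]))
  exact ⟨⟨⟨⟨F, G, hGF, hFG⟩, F.continuous, G.continuous⟩, hFp⟩, hF⟩

theorem Lifting.exists_induced {Xt X : Type*} [TopologicalSpace Xt] [TopologicalSpace X]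
    [LocallyPathConnectedSpace X] [T2Space X] {p : Xt → X} (hp : IsUniversalCover p) {n : ℕ}
    {f : C(X, UConf n X)} (F : Lifting p f) (γ : Deck p) :
    ∃ a : Wreath (Deck p) n, ∀ x, F.toMap (γ • x) = a • F.toMap x := by
  have := hp.simplyConnected
  obtain ⟨x₀⟩ : Nonempty Xt := inferInstance
  have hc := hp.isCoveringMap.continuous
  have h1 : ∀ k, ∃ j, ∀ x, p (F.coord k (γ • x)) = p (F.coord j x) := by
    intro k
    refine select (hc.comp ((F.continuous_coord k).comp (Deck.continuous_smul γ)))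
      (fun j => hc.comp (F.continuous_coord j)) ?_ (fun x => (F.toMap x).2)
    intro x
    have : p (F.coord k (γ • x)) ∈ (f (p (γ • x))).points := by
      rw [F.points_eq]
      exact ⟨k, rfl⟩
    rw [Deck.map_smul (p := p), F.points_eq] at this
    obtain ⟨j, hj⟩ := this
    exact ⟨j, hj.symm⟩
  choose s hs using h1
  have hsinj : Function.Injective s := by
    intro k l hkl
    apply (F.toMap (γ • x₀)).2
    change p (F.coord k (γ • x₀)) = p (F.coord l (γ • x₀))
    rw [hs, hs, hkl]
  have h2 : ∀ k, ∃ α : Deck p, α • F.coord (s k) x₀ = F.coord k (γ • x₀) := fun k =>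
    Deck.exists_smul_eq hp (hs k x₀).symm
  choose α hα using h2
  let σ : Equiv.Perm (Fin n) := Equiv.ofBijective s (Finite.injective_iff_bijective.mp hsinj)
  refine ⟨⟨α, σ⁻¹⟩, fun x => ?_⟩
  apply Subtype.ext
  funext k
  rw [OrbConf.smul_apply, inv_inv]
  change F.coord k (γ • x) = α k • F.coord (s k) x
  refine congrFun (hp.isCoveringMap.eq_of_comp_eq
    ((F.continuous_coord k).comp (Deck.continuous_smul γ))
    ((Deck.continuous_smul (α k)).comp (F.continuous_coord (s k))) ?_ x₀ (hα k).symm) x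
  funext y
  simp [hs, Deck.map_smul]

/-- The homomorphism `f̃_# : π → π ^ n ⋊ Σ_n` determined by `f̃ ∘ γ = f̃_#(γ) ∘ f̃`. -/
def Lifting.induced {Xt X : Type*} [TopologicalSpace Xt] [TopologicalSpace X]
    [LocallyPathConnectedSpace X] [T2Space X] {p : Xt → X} (hp : IsUniversalCover p) {n : ℕ}
    {f : C(X, UConf n X)} (F : Lifting p f) : Deck p →* Wreath (Deck p) n where
  toFun γ := (F.exists_induced hp γ).choose
  map_one' := by
    have := hp.simplyConnected
    obtain ⟨x₀⟩ : Nonempty Xt := inferInstance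
    refine OrbConf.eq_of_smul_eq hp (x := F.toMap x₀) ?_
    rw [← (F.exists_induced hp 1).choose_spec, one_smul, one_smul]
  map_mul' γ δ := by
    have := hp.simplyConnected
    obtain ⟨x₀⟩ : Nonempty Xt := inferInstance
    refine OrbConf.eq_of_smul_eq hp (x := F.toMap x₀) ?_
    rw [← (F.exists_induced hp (γ * δ)).choose_spec, mul_smul, mul_smul,
      ← (F.exists_induced hp δ).choose_spec, ← (F.exists_induced hp γ).choose_spec]

theorem Lifting.induced_spec {Xt X : Type*} [TopologicalSpace Xt] [TopologicalSpace X]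
    [LocallyPathConnectedSpace X] [T2Space X] {p : Xt → X} (hp : IsUniversalCover p) {n : ℕ}
    {f : C(X, UConf n X)} (F : Lifting p f) (γ : Deck p) (x : Xt) :
    F.toMap (γ • x) = F.induced hp γ • F.toMap x :=
  (F.exists_induced hp γ).choose_spec x

/-! ### Reidemeister classes -/

/-- Reidemeister equivalence on `π × {1, …, n}` for `Φ = (φ_1, …, φ_n; σ)`:
`(α, k) ∼ (β, j)` iff some `γ` has `σ_γ(k) = j` and `α = φ_j(γ)⁻¹ β γ`. -/
def reidemeisterSetoid {π : Type*} [Group π] {n : ℕ} (Φ : π →* Wreath π n) :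
    Setoid (π × Fin n) where
  r a b := ∃ γ : π, (Φ γ).right a.2 = b.2 ∧ a.1 = ((Φ γ).left b.2)⁻¹ * b.1 * γ
  iseqv :=
    { refl := fun a => ⟨1, by simp⟩
      symm := by
        rintro ⟨α, k⟩ ⟨β, j⟩ ⟨γ, h1, h2⟩
        dsimp only at h1 h2
        have hl : (Φ γ).left j * (Φ γ⁻¹).left k = 1 := by
          have h := congrArg (fun a : Wreath π n => a.left j) (map_mul Φ γ γ⁻¹)
          rw [mul_inv_cancel, map_one] at h
          have h' : (1 : π) = (Φ γ).left j * (Φ γ⁻¹).left ((Φ γ).right⁻¹ j) := h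
          rw [← h1, Equiv.Perm.coe_inv, Equiv.symm_apply_apply, h1] at h'
          exact h'.symm
        refine ⟨γ⁻¹, ?_, ?_⟩
        · dsimp only
          rw [map_inv, SemidirectProduct.inv_right, ← h1, Equiv.Perm.coe_inv, Equiv.symm_apply_apply]
        · dsimp only
          rw [h2, inv_eq_of_mul_eq_one_left hl]
          group
      trans := by
        rintro ⟨α, k⟩ ⟨β, j⟩ ⟨δ, i⟩ ⟨γ, h1, h2⟩ ⟨γ', h3, h4⟩
        dsimp only at h1 h2 h3 h4
        have hl : (Φ (γ' * γ)).left i = (Φ γ').left i * (Φ γ).left j := by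
          have h : (Φ (γ' * γ)).left i
              = (Φ γ').left i * (Φ γ).left ((Φ γ').right⁻¹ i) := by
            rw [map_mul]
            rfl
          rw [h, ← h3, Equiv.Perm.coe_inv, Equiv.symm_apply_apply]
        refine ⟨γ' * γ, ?_, ?_⟩
        · dsimp only
          rw [map_mul, SemidirectProduct.mul_right, Equiv.Perm.mul_apply, h1, h3]
        · dsimp only
          rw [hl, h2, h4]
          group }

/-- The set `R(Φ)` of Reidemeister classes. -/
abbrev ReidemeisterSet {π : Type*} [Group π] {n : ℕ} (Φ : π →* Wreath π n) : Type _ :=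
  Quotient (reidemeisterSetoid Φ)

/-- The element `s × {k} = ∑ c_i (a_i, k)` of `ℤ(π × {1, …, n})` for `s = ∑ c_i a_i ∈ ℤπ`. -/
def timesLabel {π : Type*} {n : ℕ} (s : MonoidAlgebra ℤ π) (k : Fin n) : π × Fin n →₀ ℤ :=
  Finsupp.mapDomain (fun a => (a, k)) s.coeff

/-- The quotient homomorphism `ρ : ℤ(π × {1, …, n}) → ℤ R(Φ)`. -/
def rho {π : Type*} [Group π] {n : ℕ} (Φ : π →* Wreath π n) :
    (π × Fin n →₀ ℤ) →+ (ReidemeisterSet Φ →₀ ℤ) :=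
  Finsupp.mapDomain.addMonoidHom (Quotient.mk (reidemeisterSetoid Φ))

/-! ### Polyhedra, subdivisions and simplicial `n`-valued maps -/

/-- The dimension of a complex. -/
def HasDim {E : Type*} [AddCommGroup E] [Module ℝ E] (K : Geometry.SimplicialComplex ℝ E)
    (d : ℕ) : Prop :=
  IsGreatest {m : ℕ | ∃ s ∈ K.faces, s.card = m + 1} d

/-- `K'` is a subdivision of `K`: both have the same underlying space and every simplex of `K'`
lies in a simplex of `K`. (Finiteness of `K'` is a separate assumption.) -/
structure IsSubdivision {E : Type*} [AddCommGroup E] [Module ℝ E]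
    (K' K : Geometry.SimplicialComplex ℝ E) : Prop where
  space_eq : K'.space = K.space
  subset : ∀ s ∈ K'.faces, ∃ t ∈ K.faces, (s : Set E) ⊆ convexHull ℝ (t : Set E)

/-- The `n`-valued map `f : |K'| → D_n(|K|)` is simplicial: on each closed simplex `s` of `K'` it
splits as `f = {φ_1, …, φ_n}`, where each `φ_i` maps `s` affinely onto a simplex of `K`.
(Here `|K'| = |K|` as subspaces of `E`.) -/
def IsNValuedSimplicial {E : Type*} [NormedAddCommGroup E] [NormedSpace ℝ E]
    (K' K : Geometry.SimplicialComplex ℝ E) {n : ℕ} (f : C(K.space, UConf n K.space)) : Prop :=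
  ∀ s ∈ K'.faces, ∃ φ : Fin n → (E →ᴬ[ℝ] E),
    (∀ i, ∃ t ∈ K.faces, (t : Set E) = φ i '' (s : Set E)) ∧
    ∀ x : K.space, (x : E) ∈ convexHull ℝ (s : Set E) →
      Subtype.val '' (f x).points = Set.range (fun i => φ i (x : E))

/-- A finite polyhedron is locally path connected. -/
instance {E : Type*} [NormedAddCommGroup E] [NormedSpace ℝ E]
    (K : Geometry.SimplicialComplex ℝ E) [Finite K.faces] :
    LocallyPathConnectedSpace K.space := by
  rw [locallyPathConnectedSpace_iff_pathComponentIn_mem_nhds]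
  intro x u hu hxu
  obtain ⟨v, hv, rfl⟩ := isOpen_induced_iff.mp hu
  let B : Set E := ⋃ s ∈ {s ∈ K.faces | (x : E) ∉ convexHull ℝ (s : Set E)},
    convexHull ℝ (s : Set E)
  have hB : IsClosed B := by
    refine Set.Finite.isClosed_biUnion ((Set.toFinite K.faces).subset (Set.sep_subset _ _)) ?_
    intro s _
    exact (s.finite_toSet.isCompact_convexHull ℝ).isClosed
  have hxB : (x : E) ∉ B := by
    simp only [B, Set.mem_iUnion, not_exists]
    intro s hs
    exact hs.2
  have hw : v ∩ Bᶜ ∈ nhds (x : E) :=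
    Filter.inter_mem (hv.mem_nhds hxu) (hB.isOpen_compl.mem_nhds hxB)
  obtain ⟨ε, hε, hball⟩ := Metric.mem_nhds_iff.mp hw
  have hmem : (Subtype.val ⁻¹' Metric.ball (x : E) ε : Set K.space) ∈ nhds x :=
    continuous_subtype_val.continuousAt.preimage_mem_nhds (Metric.ball_mem_nhds _ hε)
  refine Filter.mem_of_superset hmem ?_
  intro y hy
  have hyB := (hball hy).2
  obtain ⟨s, hs, hys⟩ := Geometry.SimplicialComplex.mem_space_iff.mp y.2
  have hxs : (x : E) ∈ convexHull ℝ (s : Set E) := by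
    by_contra hxs
    exact hyB (Set.mem_biUnion (x := s) ⟨hs, hxs⟩ hys)
  have hseg : segment ℝ (x : E) y ⊆ convexHull ℝ (s : Set E) :=
    (convex_convexHull ℝ _).segment_subset hxs hys
  have hseg' : segment ℝ (x : E) y ⊆ v := fun z hz =>
    (hball ((convex_ball _ _).segment_subset (Metric.mem_ball_self hε) hy hz)).1
  have hmemseg : ∀ t, (Path.segment (x : E) (y : E)) t ∈ segment ℝ (x : E) y := fun t => by
    rw [← Path.range_segment]
    exact ⟨t, rfl⟩
  refine ⟨⟨⟨fun t => ⟨Path.segment (x : E) (y : E) t, ?_⟩, ?_⟩, ?_, ?_⟩, ?_⟩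
  · exact Geometry.SimplicialComplex.convexHull_subset_space hs (hseg (hmemseg t))
  · exact (Path.segment (x : E) (y : E)).continuous.subtype_mk _
  · exact Subtype.ext (Path.segment (x : E) (y : E)).source
  · exact Subtype.ext (Path.segment (x : E) (y : E)).target
  · intro t
    exact hseg' (hmemseg t)

/-! ### The lifted triangulation -/

/-- `τ` lifts the inclusion of `A` through `P`. -/
structure IsLiftOn {Xt E : Type*} [TopologicalSpace Xt] [TopologicalSpace E] (P : Xt → E)
    (A : Set E) (τ : E → Xt) : Prop where
  continuousOn : ContinuousOn τ A
  apply_eq : ∀ x ∈ A, P (τ x) = x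

/-- The triangulation `K̃` of `X̃` obtained by lifting the simplices of `K`. A face is the set of
vertices `τ(s)` of a lift `τ` to `X̃` of a closed simplex `s` of `K`. -/
def liftedComplex {Xt E : Type*} [TopologicalSpace Xt] [NormedAddCommGroup E] [NormedSpace ℝ E]
    (K : Geometry.SimplicialComplex ℝ E) (P : Xt → E) : PreAbstractSimplicialComplex Xt where
  faces := {T | ∃ s ∈ K.faces, ∃ τ : E → Xt,
    IsLiftOn P (convexHull ℝ (s : Set E)) τ ∧ (T : Set Xt) = τ '' (s : Set E)}
  isRelLowerSet_faces := by
    classical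
    rintro T ⟨s, hs, τ, hτ, hT⟩
    constructor
    · rw [← Finset.coe_nonempty, hT]
      exact (Finset.coe_nonempty.mpr (K.nonempty_of_mem_faces hs)).image τ
    · intro U hUT hU
      have hsub : s.filter (fun x => τ x ∈ U) ⊆ s := Finset.filter_subset _ _
      have himg : (U : Set Xt) = τ '' (s.filter (fun x => τ x ∈ U) : Finset E) := by
        ext y
        constructor
        · intro hy
          have : y ∈ (T : Set Xt) := hUT hy
          rw [hT] at this
          obtain ⟨x, hx, rfl⟩ := this
          exact ⟨x, by simpa using ⟨hx, hy⟩, rfl⟩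
        · rintro ⟨x, hx, rfl⟩
          exact (Finset.mem_filter.mp hx).2
      refine ⟨s.filter (fun x => τ x ∈ U), K.down_closed hs hsub ?_, τ, ?_, himg⟩
      · rw [← Finset.coe_nonempty] at hU ⊢
        rw [himg] at hU
        exact Set.image_nonempty.mp hU
      · have := convexHull_mono (𝕜 := ℝ) (Finset.coe_subset.mpr hsub)
        exact ⟨hτ.continuousOn.mono this, fun x hx => hτ.apply_eq x (this hx)⟩

/-- A map of vertices that carries simplices onto simplices. -/
def IsSimplicialMap {V W : Type*} (L : PreAbstractSimplicialComplex V)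
    (M : PreAbstractSimplicialComplex W) (f : V → W) : Prop :=
  ∀ T ∈ L.faces, ∃ U ∈ M.faces, (U : Set W) = f '' (T : Set V)

/-- The covering projection, read as a map into the ambient vector space of the polyhedron. -/
def toAmbient {Xt E : Type*} {A : Set E} (p : Xt → A) (x : Xt) : E := (p x : E)

/-- The coordinates of a lifting of a simplicial `n`-valued map are simplicial maps
`K̃' → K̃`. -/
theorem Lifting.isSimplicialMap_coord {E : Type*} [NormedAddCommGroup E] [NormedSpace ℝ E]
    {K K' : Geometry.SimplicialComplex ℝ E} (hK' : IsSubdivision K' K)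
    {Xt : Type*} [TopologicalSpace Xt] {p : Xt → K.space} (hp : IsUniversalCover p) {n : ℕ}
    {f : C(K.space, UConf n K.space)} (hf : IsNValuedSimplicial K' K f) (F : Lifting p f)
    (k : Fin n) :
    IsSimplicialMap (liftedComplex K' (toAmbient p)) (liftedComplex K (toAmbient p))
      (F.coord k) := by
  classical
  have hpc := hp.isCoveringMap.continuous
  rintro T ⟨s, hs, τ, hτ, hT⟩
  obtain ⟨φ, hφ, hφf⟩ := hf s hs
  obtain ⟨v₀, hv₀⟩ := K'.nonempty_of_mem_faces hs
  set C : Set E := convexHull ℝ (s : Set E) with hC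
  have hsC : (s : Set E) ⊆ C := subset_convexHull ℝ _
  have hCs : C ⊆ K.space := hK'.space_eq ▸ K'.convexHull_subset_space hs
  have : Nonempty C := ⟨⟨v₀, hsC hv₀⟩⟩
  have : PreconnectedSpace C :=
    isPreconnected_iff_preconnectedSpace.mp (convex_convexHull ℝ _).isPreconnected
  have : CompactSpace C := isCompact_iff_compactSpace.mp (s.finite_toSet.isCompact_convexHull ℝ)
  have hτC : Continuous (fun x : C => τ x) := continuousOn_iff_continuous_domRestrict.mp hτ.continuousOn
  have hcont : Continuous (fun x : C => F.coord k (τ x)) := (F.continuous_coord k).comp hτC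
  have hpτ : ∀ x : C, p (τ x) = ⟨x, hCs x.2⟩ := fun x => Subtype.ext (hτ.apply_eq x x.2)
  have hpts : ∀ x : C, Set.range (fun j => (p (F.coord j (τ x)) : E))
      = Set.range (fun i => φ i (x : E)) := by
    intro x
    have h := hφf ⟨x, hCs x.2⟩ x.2
    have e : (p (τ x) : E) = x := congrArg Subtype.val (hpτ x)
    rw [← hpτ x, F.points_eq, ← Set.range_comp, e] at h
    exact h
  -- on the simplex, the coordinate covers exactly one of the affine branches
  obtain ⟨i, hi⟩ : ∃ i, ∀ x : C, (p (F.coord k (τ x)) : E) = φ i (x : E) := by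
    refine select (continuous_subtype_val.comp (hpc.comp hcont))
      (fun i => (φ i).continuous.comp continuous_subtype_val) ?_ ?_
    · intro x
      have h : (p (F.coord k (τ x)) : E) ∈ Set.range (fun i => φ i (x : E)) := by
        rw [← hpts x]
        exact ⟨k, rfl⟩
      obtain ⟨i, hi⟩ := h
      exact ⟨i, hi.symm⟩
    · intro x
      have hinj : Function.Injective (fun j => (p (F.coord j (τ x)) : E)) :=
        Subtype.val_injective.comp (F.toMap (τ x)).2
      have hcard := congrArg Set.ncard (hpts x)
      rw [← Set.image_univ, ← Set.image_univ, Set.ncard_image_of_injective _ hinj,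
        Set.ncard_univ, Nat.card_fin] at hcard
      have := Set.injOn_of_ncard_image_eq (s := Set.univ) (f := fun i => φ i (x : E))
        (by rw [← hcard, Set.ncard_univ, Nat.card_fin])
      exact Set.injOn_univ.mp this
  obtain ⟨t, ht, htφ⟩ := hφ i
  have himage : φ i '' C = convexHull ℝ (t : Set E) := by
    rw [htφ, hC]
    exact (φ i).toAffineMap.image_convexHull _
  -- the coordinate is constant on the fibres of the affine branch
  have hconst : ∀ x y : C, φ i (x : E) = φ i (y : E) → F.coord k (τ x) = F.coord k (τ y) := by
    intro x y hxy
    have hseg : segment ℝ (x : E) y ⊆ C := (convex_convexHull ℝ _).segment_subset x.2 y.2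
    refine hp.isCoveringMap.constOn_of_comp (s := segment ℝ (x : E) y)
      (g := fun z => F.coord k (τ z)) (convex_segment _ _).isPreconnected
      ((F.continuous_coord k).comp_continuousOn (hτ.continuousOn.mono hseg)) ?_
      (left_mem_segment ℝ _ _) (right_mem_segment ℝ _ _)
    have hval : ∀ z ∈ segment ℝ (x : E) y, φ i z = φ i (x : E) := by
      intro z hz
      have : φ i z ∈ (φ i).toAffineMap '' segment ℝ (x : E) y := ⟨z, hz, rfl⟩
      rw [image_segment] at this
      change φ i z ∈ segment ℝ (φ i (x : E)) (φ i (y : E)) at this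
      rw [← hxy, segment_same] at this
      exact this
    intro a ha b hb
    apply Subtype.ext
    rw [hi ⟨a, hseg ha⟩, hi ⟨b, hseg hb⟩, hval a ha, hval b hb]
  let r : C → convexHull ℝ (t : Set E) := fun x => ⟨φ i x, himage ▸ ⟨x, x.2, rfl⟩⟩
  have hrc : Continuous r := ((φ i).continuous.comp continuous_subtype_val).subtype_mk _
  have hrs : Function.Surjective r := by
    rintro ⟨y, hy⟩
    rw [← himage] at hy
    obtain ⟨x, hx, rfl⟩ := hy
    exact ⟨⟨x, hx⟩, rfl⟩
  have hrq : Topology.IsQuotientMap r := hrc.isClosedMap.isQuotientMap hrc hrs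
  let ρ : convexHull ℝ (t : Set E) → Xt := fun y => F.coord k (τ (hrs y).choose)
  have hρr : ∀ x : C, ρ (r x) = F.coord k (τ x) := fun x =>
    hconst _ _ (congrArg Subtype.val (hrs (r x)).choose_spec)
  have hρc : Continuous ρ := hrq.continuous_iff.mpr (by
    convert hcont using 1
    funext x
    exact hρr x)
  let τ' : E → Xt := fun y => if h : y ∈ convexHull ℝ (t : Set E) then ρ ⟨y, h⟩ else τ v₀
  have hτ' : ∀ x : C, τ' (φ i (x : E)) = F.coord k (τ x) := fun x => by
    have h : φ i (x : E) ∈ convexHull ℝ (t : Set E) := (r x).2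
    simp only [τ', dif_pos h]
    exact hρr x
  have hfin : (F.coord k '' (T : Set Xt)).Finite := T.finite_toSet.image _
  refine ⟨hfin.toFinset, ⟨t, ht, τ', ⟨?_, ?_⟩, ?_⟩, hfin.coe_toFinset⟩
  · rw [continuousOn_iff_continuous_domRestrict]
    convert hρc using 1
    funext y
    simp [τ']
  · intro y hy
    obtain ⟨x, hx⟩ := hrs ⟨y, hy⟩
    have hx' : φ i (x : E) = y := congrArg Subtype.val hx
    rw [← hx', hτ', toAmbient, hi]
  · rw [hfin.coe_toFinset, hT, htφ, Set.image_image, Set.image_image]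
    exact Set.image_congr fun x hx => (hτ' ⟨x, hsC hx⟩).symm

/-! ### Oriented simplicial chains -/

/-- An ordered `q`-simplex of `L`: a `(q+1)`-tuple of vertices, possibly with repetitions, whose
set of entries is a face. -/
abbrev OrderedSimplex {V : Type*} (L : PreAbstractSimplicialComplex V) (q : ℕ) : Type _ :=
  {v : Fin (q + 1) → V // ∃ T ∈ L.faces, (T : Set V) = Set.range v}

/-- Reorder the vertices of an ordered simplex. -/
def OrderedSimplex.perm {V : Type*} {L : PreAbstractSimplicialComplex V} {q : ℕ}
    (v : OrderedSimplex L q) (σ : Equiv.Perm (Fin (q + 1))) : OrderedSimplex L q :=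
  ⟨v.1 ∘ σ, by
    obtain ⟨T, hT, h⟩ := v.2
    exact ⟨T, hT, by rw [h, σ.surjective.range_comp]⟩⟩

/-- The relations of the oriented chain group: simplices with a repeated vertex vanish, and a
reordering multiplies by its sign. -/
def chainRel {V : Type*} (L : PreAbstractSimplicialComplex V) (q : ℕ) :
    Submodule ℤ (OrderedSimplex L q →₀ ℤ) :=
  Submodule.span ℤ
    ({x | ∃ v : OrderedSimplex L q, ¬ Function.Injective v.1 ∧ x = Finsupp.single v 1} ∪
      {x | ∃ (v : OrderedSimplex L q) (σ : Equiv.Perm (Fin (q + 1))),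
        x = Finsupp.single (v.perm σ) 1 - (Equiv.Perm.sign σ : ℤ) • Finsupp.single v 1})

/-- The oriented simplicial chain group `C_q(L)`. -/
abbrev Chain {V : Type*} (L : PreAbstractSimplicialComplex V) (q : ℕ) : Type _ :=
  (OrderedSimplex L q →₀ ℤ) ⧸ chainRel L q

/-- The oriented simplex `[v_0, …, v_q]`. -/
def Chain.of {V : Type*} {L : PreAbstractSimplicialComplex V} {q : ℕ} (v : OrderedSimplex L q) :
    Chain L q :=
  Submodule.Quotient.mk (Finsupp.single v 1)

theorem Chain.of_eq_zero {V : Type*} {L : PreAbstractSimplicialComplex V} {q : ℕ}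
    {v : OrderedSimplex L q} (hv : ¬ Function.Injective v.1) : Chain.of v = 0 :=
  (Submodule.Quotient.mk_eq_zero _).mpr (Submodule.subset_span (Or.inl ⟨v, hv, rfl⟩))

theorem Chain.of_perm {V : Type*} {L : PreAbstractSimplicialComplex V} {q : ℕ}
    (v : OrderedSimplex L q) (σ : Equiv.Perm (Fin (q + 1))) :
    Chain.of (v.perm σ) = (Equiv.Perm.sign σ : ℤ) • Chain.of v :=
  (Submodule.Quotient.eq _).mpr (Submodule.subset_span (Or.inr ⟨v, σ, rfl⟩))

/-- The homomorphism out of `C_q(L)` with prescribed values on the oriented simplices. -/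
def Chain.lift {V : Type*} {L : PreAbstractSimplicialComplex V} {q : ℕ} {M : Type*}
    [AddCommGroup M] (φ : OrderedSimplex L q → M)
    (h₀ : ∀ v : OrderedSimplex L q, ¬ Function.Injective v.1 → φ v = 0)
    (h₁ : ∀ (v : OrderedSimplex L q) (σ : Equiv.Perm (Fin (q + 1))),
      φ (v.perm σ) = (Equiv.Perm.sign σ : ℤ) • φ v) :
    Chain L q →ₗ[ℤ] M :=
  Submodule.liftQ _ (Finsupp.linearCombination ℤ φ) (by
    rw [chainRel, Submodule.span_le]
    rintro x (⟨v, hv, rfl⟩ | ⟨v, σ, rfl⟩)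
    · simp [h₀ v hv]
    · simp [h₁ v σ])

theorem Chain.lift_of {V : Type*} {L : PreAbstractSimplicialComplex V} {q : ℕ} {M : Type*}
    [AddCommGroup M] (φ : OrderedSimplex L q → M)
    (h₀ : ∀ v : OrderedSimplex L q, ¬ Function.Injective v.1 → φ v = 0)
    (h₁ : ∀ (v : OrderedSimplex L q) (σ : Equiv.Perm (Fin (q + 1))),
      φ (v.perm σ) = (Equiv.Perm.sign σ : ℤ) • φ v) (v : OrderedSimplex L q) :
    Chain.lift φ h₀ h₁ (Chain.of v) = φ v := by
  change Finsupp.linearCombination ℤ φ (Finsupp.single v 1) = φ v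
  simp

/-- The image of an ordered simplex under a simplicial map. -/
def OrderedSimplex.map {V W : Type*} {L : PreAbstractSimplicialComplex V}
    {M : PreAbstractSimplicialComplex W} {f : V → W} (hf : IsSimplicialMap L M f) {q : ℕ}
    (v : OrderedSimplex L q) : OrderedSimplex M q :=
  ⟨f ∘ v.1, by
    obtain ⟨T, hT, h⟩ := v.2
    obtain ⟨U, hU, h'⟩ := hf T hT
    exact ⟨U, hU, by rw [h', h, Set.range_comp]⟩⟩

/-- The homomorphism `C_q(L) → C_q(M)` induced by a simplicial map,
`[v_0, …, v_q] ↦ [f v_0, …, f v_q]`. -/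
def chainMap {V W : Type*} {L : PreAbstractSimplicialComplex V}
    {M : PreAbstractSimplicialComplex W} {f : V → W} (hf : IsSimplicialMap L M f) (q : ℕ) :
    Chain L q →ₗ[ℤ] Chain M q :=
  Chain.lift (fun v => Chain.of (v.map hf))
    (fun _ hv => Chain.of_eq_zero fun h => hv (Function.Injective.of_comp h))
    (fun v σ => Chain.of_perm (v.map hf) σ)

open scoped Classical in
/-- The coefficient in a chain of the oriented simplex `[w]`, for `w` with distinct vertices. -/
def Chain.coeff {V : Type*} {L : PreAbstractSimplicialComplex V} {q : ℕ}
    (w : OrderedSimplex L q) (hw : Function.Injective w.1) : Chain L q →ₗ[ℤ] ℤ :=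
  Chain.lift
    (fun v => ∑ σ : Equiv.Perm (Fin (q + 1)),
      if v.1 = w.1 ∘ σ then (Equiv.Perm.sign σ : ℤ) else 0)
    (fun v hv => Finset.sum_eq_zero fun σ _ => if_neg fun h => hv (by
      rw [h]
      exact hw.comp σ.injective))
    (fun v τ => by
      rw [← Equiv.sum_comp (Equiv.mulRight τ), smul_eq_mul, Finset.mul_sum]
      refine Finset.sum_congr rfl fun σ _ => ?_
      have h : (v.perm τ).1 = w.1 ∘ (σ * τ : Equiv.Perm (Fin (q + 1))) ↔ v.1 = w.1 ∘ σ := by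
        change v.1 ∘ τ = (w.1 ∘ σ) ∘ τ ↔ _
        exact τ.surjective.injective_comp_right.eq_iff
      simp only [Equiv.coe_mulRight, h]
      split_ifs
      · simp [mul_comm]
      · simp)

/-! ### `C_q(K̃)` as a `ℤπ`-module and the trace -/

/-- Covering transformations act on the ordered simplices of the lifted triangulation. -/
def deckSmul {E : Type*} [NormedAddCommGroup E] [NormedSpace ℝ E]
    {K : Geometry.SimplicialComplex ℝ E} {A : Set E} {Xt : Type*} [TopologicalSpace Xt]
    {p : Xt → A} {q : ℕ} (γ : Deck p) (v : OrderedSimplex (liftedComplex K (toAmbient p)) q) :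
    OrderedSimplex (liftedComplex K (toAmbient p)) q :=
  v.map (f := fun x => γ • x) (by
    classical
    rintro T ⟨s, hs, τ, hτ, hT⟩
    refine ⟨T.image (fun x => γ • x), ⟨s, hs, fun x => γ • τ x, ⟨?_, ?_⟩, ?_⟩, ?_⟩
    · exact (Deck.continuous_smul γ).comp_continuousOn hτ.continuousOn
    · intro x hx
      rw [toAmbient, Deck.map_smul γ]
      exact hτ.apply_eq x hx
    · rw [Finset.coe_image, hT, Set.image_image]
    · rw [Finset.coe_image])

theorem deckSmul_injective {E : Type*} [NormedAddCommGroup E] [NormedSpace ℝ E]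
    {K : Geometry.SimplicialComplex ℝ E} {A : Set E} {Xt : Type*} [TopologicalSpace Xt]
    {p : Xt → A} {q : ℕ} (γ : Deck p) {v : OrderedSimplex (liftedComplex K (toAmbient p)) q}
    (hv : Function.Injective v.1) : Function.Injective (deckSmul γ v).1 :=
  (MulAction.injective γ).comp hv

/-- The `q`-simplices of a complex. -/
abbrev SimplexOf {E : Type*} [AddCommGroup E] [Module ℝ E]
    (K : Geometry.SimplicialComplex ℝ E) (q : ℕ) : Type _ :=
  {s : Finset E // s ∈ K.faces ∧ s.card = q + 1}

instance {E : Type*} [AddCommGroup E] [Module ℝ E] (K : Geometry.SimplicialComplex ℝ E)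
    [h : Finite K.faces] (q : ℕ) : Fintype (SimplexOf K q) :=
  have : Finite (SimplexOf K q) :=
    Set.Finite.subset (s := K.faces) h fun _ hs => hs.1
  Fintype.ofFinite _

/-- A choice, for each `q`-simplex `s` of `K`, of an oriented simplex `s̃` of `K̃` over `s`. -/
structure SimplexLifts {E : Type*} [NormedAddCommGroup E] [NormedSpace ℝ E]
    (K : Geometry.SimplicialComplex ℝ E) {A : Set E} {Xt : Type*} [TopologicalSpace Xt]
    (p : Xt → A) (q : ℕ) where
  simplex : SimplexOf K q → OrderedSimplex (liftedComplex K (toAmbient p)) q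
  image_eq : ∀ s, toAmbient p '' Set.range (simplex s).1 = (s.1 : Set E)

theorem SimplexLifts.injective {E : Type*} [NormedAddCommGroup E] [NormedSpace ℝ E]
    {K : Geometry.SimplicialComplex ℝ E} {A : Set E} {Xt : Type*} [TopologicalSpace Xt]
    {p : Xt → A} {q : ℕ} (b : SimplexLifts K p q) (s : SimplexOf K q) :
    Function.Injective (b.simplex s).1 := by
  have h : Set.ncard (Set.range (toAmbient p ∘ (b.simplex s).1)) = q + 1 := by
    rw [Set.range_comp, b.image_eq, Set.ncard_coe_finset, s.2.2]
  rw [← Set.image_univ] at h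
  have h' := Set.injOn_of_ncard_image_eq (s := (Set.univ : Set (Fin (q + 1))))
    (f := toAmbient p ∘ (b.simplex s).1)
    (by rw [h, Set.ncard_univ, Nat.card_fin])
  exact Function.Injective.of_comp (Set.injOn_univ.mp h')

theorem finite_coeff_deckSmul {E : Type*} [NormedAddCommGroup E] [NormedSpace ℝ E]
    {K : Geometry.SimplicialComplex ℝ E} {X : Set E} {Xt : Type*} [TopologicalSpace Xt]
    {p : Xt → X} (hp : IsUniversalCover p) {q : ℕ}
    (w : OrderedSimplex (liftedComplex K (toAmbient p)) q) (hw : Function.Injective w.1)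
    (c : Chain (liftedComplex K (toAmbient p)) q) :
    (Function.support fun γ : Deck p =>
      Chain.coeff (deckSmul γ w) (deckSmul_injective γ hw) c).Finite := by
  classical
  obtain ⟨x, rfl⟩ := Submodule.Quotient.mk_surjective _ c
  induction x using Finsupp.induction_linear with
  | zero => simp
  | add x y hx hy =>
    refine (hx.union hy).subset ?_
    intro γ hγ
    by_contra hcon
    rw [Set.mem_union, not_or, Function.notMem_support, Function.notMem_support] at hcon
    apply hγ
    simp only [Submodule.Quotient.mk_add, map_add]
    rw [hcon.1, hcon.2, add_zero]
  | single v a =>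
    have hfin : (⋃ σ : Equiv.Perm (Fin (q + 1)),
        {γ : Deck p | v.1 0 = γ • w.1 (σ 0)}).Finite := by
      refine Set.finite_iUnion fun σ => Set.Subsingleton.finite ?_
      intro γ hγ δ hδ
      exact Deck.eq_of_smul_eq hp ((show v.1 0 = _ from hγ).symm.trans hδ)
    refine hfin.subset fun γ hγ => ?_
    by_contra hcon
    apply hγ
    have hs : (Submodule.Quotient.mk (Finsupp.single v a) :
        Chain (liftedComplex K (toAmbient p)) q) = a • Chain.of v := by
      rw [Chain.of, ← Submodule.Quotient.mk_smul]
      simp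
    change Chain.coeff _ _ _ = 0
    rw [hs, map_smul, Chain.coeff, Chain.lift_of, Finset.sum_eq_zero, smul_zero]
    intro σ _
    refine if_neg fun h => hcon (Set.mem_iUnion.mpr ⟨σ, ?_⟩)
    exact congrFun h 0

/-- The `ℤπ`-coordinate `∑_γ c_γ γ` of a chain along the orbit of the oriented simplex `[w]`,
where `c_γ` is the coefficient of `γ[w]`. -/
def groupRingCoeff {E : Type*} [NormedAddCommGroup E] [NormedSpace ℝ E]
    {K : Geometry.SimplicialComplex ℝ E} {A : Set E} {Xt : Type*} [TopologicalSpace Xt]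
    {p : Xt → A} (hp : IsUniversalCover p) {q : ℕ}
    (w : OrderedSimplex (liftedComplex K (toAmbient p)) q) (hw : Function.Injective w.1)
    (c : Chain (liftedComplex K (toAmbient p)) q) : MonoidAlgebra ℤ (Deck p) :=
  MonoidAlgebra.ofCoeff (Finsupp.ofSupportFinite _ (finite_coeff_deckSmul hp w hw c))

/-- The trace in `ℤπ` of an endomorphism of the abelian group `C_q(K̃)`: the sum of the diagonal
entries of its matrix over `ℤπ` with respect to the chosen lifts `s̃`. -/
def trace {E : Type*} [NormedAddCommGroup E] [NormedSpace ℝ E]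
    {K : Geometry.SimplicialComplex ℝ E} [Finite K.faces] {A : Set E} {Xt : Type*}
    [TopologicalSpace Xt] {p : Xt → A} (hp : IsUniversalCover p) {q : ℕ} (b : SimplexLifts K p q)
    (h : Chain (liftedComplex K (toAmbient p)) q →ₗ[ℤ]
      Chain (liftedComplex K (toAmbient p)) q) : MonoidAlgebra ℤ (Deck p) :=
  ∑ s : SimplexOf K q,
    groupRingCoeff hp (b.simplex s) (b.injective s) (h (Chain.of (b.simplex s)))

/-! ### The subdivision homomorphism `ε^q` -/

open scoped Classical in
/-- The affine coordinates of `x` with respect to the points `b_0, …, b_q` (and `0` when there are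
none); they are unique when the `b_i` are affinely independent. -/
def affineCoord {E : Type*} [AddCommGroup E] [Module ℝ E] {q : ℕ} (b : Fin (q + 1) → E) (x : E) :
    Fin (q + 1) → ℝ :=
  if h : ∃ c : Fin (q + 1) → ℝ, ∑ i, c i = 1 ∧ ∑ i, c i • b i = x then h.choose else 0

theorem affineCoord_perm {E : Type*} [AddCommGroup E] [Module ℝ E] {q : ℕ}
    {b : Fin (q + 1) → E} (hb : AffineIndependent ℝ b) (σ : Equiv.Perm (Fin (q + 1))) (x : E) :
    affineCoord (b ∘ σ) x = affineCoord b x ∘ σ := by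
  have huniq : ∀ c d : Fin (q + 1) → ℝ, ∑ i, c i = 1 → ∑ i, d i = 1 →
      ∑ i, c i • b i = ∑ i, d i • b i → c = d := by
    intro c d hc hd hcd
    refine (affineIndependent_iff_eq_of_fintype_affineCombination_eq ℝ b).mp hb c d hc hd ?_
    rw [Finset.affineCombination_eq_linear_combination _ _ _ hc,
      Finset.affineCombination_eq_linear_combination _ _ _ hd, hcd]
  by_cases h : ∃ c : Fin (q + 1) → ℝ, ∑ i, c i = 1 ∧ ∑ i, c i • b i = x
  · have h' : ∃ c : Fin (q + 1) → ℝ, ∑ i, c i = 1 ∧ ∑ i, c i • (b ∘ σ) i = x := by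
      obtain ⟨c, hc, hcx⟩ := h
      refine ⟨c ∘ σ, ?_, ?_⟩
      · rw [← hc]
        exact Equiv.sum_comp σ c
      · rw [← hcx]
        exact Equiv.sum_comp σ (fun i => c i • b i)
    rw [affineCoord, dif_pos h', affineCoord, dif_pos h]
    obtain ⟨h1, h2⟩ := h.choose_spec
    obtain ⟨h3, h4⟩ := h'.choose_spec
    have := huniq (h'.choose ∘ σ.symm) h.choose
      ((Equiv.sum_comp σ.symm _).trans h3) h1
      (by
        refine Eq.trans ?_ (h4.trans h2.symm)
        rw [← Equiv.sum_comp σ]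
        simp)
    rw [← this]
    funext i
    simp
  · have h' : ¬ ∃ c : Fin (q + 1) → ℝ, ∑ i, c i = 1 ∧ ∑ i, c i • (b ∘ σ) i = x := by
      rintro ⟨c, hc, hcx⟩
      refine h ⟨c ∘ σ.symm, ?_, ?_⟩
      · rw [← hc]
        exact Equiv.sum_comp σ.symm c
      · rw [← hcx, ← Equiv.sum_comp σ]
        simp
    rw [affineCoord, dif_neg h', affineCoord, dif_neg h]
    rfl

/-- For ordered `q`-simplices `b` and `w` in the same `q`-plane: `1` if they have the same
orientation, `-1` if they have opposite orientations. -/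
def orientSign {E : Type*} [AddCommGroup E] [Module ℝ E] {q : ℕ} (b w : Fin (q + 1) → E) : ℤ :=
  (SignType.sign (Matrix.det (Matrix.of fun i j => affineCoord b (w j) i)) : ℤ)

theorem orientSign_perm {E : Type*} [AddCommGroup E] [Module ℝ E] {q : ℕ}
    {b : Fin (q + 1) → E} (hb : AffineIndependent ℝ b) (σ : Equiv.Perm (Fin (q + 1)))
    (w : Fin (q + 1) → E) :
    orientSign (b ∘ σ) w = (Equiv.Perm.sign σ : ℤ) * orientSign b w := by
  have h : (Matrix.of fun i j => affineCoord (b ∘ σ) (w j) i)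
      = (Matrix.of fun i j => affineCoord b (w j) i).submatrix σ id := by
    ext i j
    simp [affineCoord_perm hb]
  rw [orientSign, orientSign, h, Matrix.det_permute, sign_mul]
  rcases Int.units_eq_one_or (Equiv.Perm.sign σ) with h | h <;> simp [h]

/-- An enumeration of the vertices of a `q`-simplex. -/
def SimplexOf.order {E : Type*} [AddCommGroup E] [Module ℝ E]
    {K : Geometry.SimplicialComplex ℝ E} {q : ℕ} (s : SimplexOf K q) (i : Fin (q + 1)) : E :=
  (s.1.equivFinOfCardEq s.2.2).symm i

theorem SimplexOf.range_order {E : Type*} [AddCommGroup E] [Module ℝ E]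
    {K : Geometry.SimplicialComplex ℝ E} {q : ℕ} (s : SimplexOf K q) :
    Set.range s.order = (s.1 : Set E) := by
  ext x
  constructor
  · rintro ⟨i, rfl⟩
    exact ((s.1.equivFinOfCardEq s.2.2).symm i).2
  · intro hx
    exact ⟨s.1.equivFinOfCardEq s.2.2 ⟨x, hx⟩, by simp [SimplexOf.order]⟩

/-- The lift to `X̃` of the closed simplex spanned by `P '' R` whose set of vertices is `R`. -/
def simplexLift {Xt E : Type*} [Nonempty Xt] [TopologicalSpace Xt] [NormedAddCommGroup E]
    [NormedSpace ℝ E] (P : Xt → E) (R : Set Xt) : E → Xt :=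
  Classical.epsilon fun τ => IsLiftOn P (convexHull ℝ (P '' R)) τ ∧ τ '' (P '' R) = R

theorem simplexLift_spec {Xt E : Type*} [Nonempty Xt] [TopologicalSpace Xt]
    [NormedAddCommGroup E] [NormedSpace ℝ E] {K : Geometry.SimplicialComplex ℝ E} {P : Xt → E}
    {q : ℕ} (v : OrderedSimplex (liftedComplex K P) q) :
    (∃ s ∈ K.faces, (s : Set E) = P '' Set.range v.1) ∧
    IsLiftOn P (convexHull ℝ (P '' Set.range v.1)) (simplexLift P (Set.range v.1)) ∧
      simplexLift P (Set.range v.1) '' (P '' Set.range v.1) = Set.range v.1 := by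
  obtain ⟨T, ⟨s, hs, τ, hτ, hT⟩, hv⟩ := v.2
  have hPs : P '' Set.range v.1 = s := by
    rw [← hv, hT, Set.image_image]
    exact (Set.image_congr fun x hx => hτ.apply_eq x (subset_convexHull ℝ _ hx)).trans
      (Set.image_id' _)
  refine ⟨⟨s, hs, hPs.symm⟩, ?_⟩
  refine Classical.epsilon_spec
    (p := fun τ : E → Xt => IsLiftOn P (convexHull ℝ (P '' Set.range v.1)) τ ∧
      τ '' (P '' Set.range v.1) = Set.range v.1) ⟨τ, ?_, ?_⟩
  · rwa [hPs]
  · rw [hPs, ← hT, hv]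

/-- The simplex of `K̃'` over `s` inside the simplex of `K̃` spanned by `v`. -/
def liftInside {Xt E : Type*} [Nonempty Xt] [TopologicalSpace Xt] [NormedAddCommGroup E]
    [NormedSpace ℝ E] {K K' : Geometry.SimplicialComplex ℝ E} {P : Xt → E} {q : ℕ}
    (v : OrderedSimplex (liftedComplex K P) q) (s : SimplexOf K' q)
    (h : (s.1 : Set E) ⊆ convexHull ℝ (P '' Set.range v.1)) :
    OrderedSimplex (liftedComplex K' P) q :=
  ⟨simplexLift P (Set.range v.1) ∘ s.order, by
    classical
    obtain ⟨-, hτ, -⟩ := simplexLift_spec v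
    have hsub : convexHull ℝ (s.1 : Set E) ⊆ convexHull ℝ (P '' Set.range v.1) :=
      convexHull_min h (convex_convexHull ℝ _)
    refine ⟨s.1.image (simplexLift P (Set.range v.1)), ⟨s.1, s.2.1, _,
      ⟨hτ.continuousOn.mono hsub, fun x hx => hτ.apply_eq x (hsub hx)⟩, Finset.coe_image⟩, ?_⟩
    rw [Finset.coe_image, Set.range_comp, s.range_order]⟩

open scoped Classical in
/-- The subdivision homomorphism `ε^q : C_q(K̃) → C_q(K̃')`: an oriented `q`-simplex of `K̃` goes to
the sum of the `q`-simplices of `K̃'` contained in it, each with the same orientation. -/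
def subdivisionMap {Xt E : Type*} [Nonempty Xt] [TopologicalSpace Xt] [NormedAddCommGroup E]
    [NormedSpace ℝ E] (K K' : Geometry.SimplicialComplex ℝ E) [Finite K'.faces] (P : Xt → E)
    (q : ℕ) : Chain (liftedComplex K P) q →ₗ[ℤ] Chain (liftedComplex K' P) q :=
  Chain.lift
    (fun v => if Function.Injective v.1 then
      ∑ s : SimplexOf K' q,
        if h : (s.1 : Set E) ⊆ convexHull ℝ (P '' Set.range v.1) then
          orientSign (P ∘ v.1) s.order • Chain.of (liftInside v s h)
        else 0
      else 0)
    (fun v hv => if_neg hv)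
    (fun v σ => by
      have hrange : Set.range (v.perm σ).1 = Set.range v.1 := σ.surjective.range_comp v.1
      have hinj : Function.Injective (v.perm σ).1 ↔ Function.Injective v.1 :=
        σ.injective_comp v.1
      by_cases hv : Function.Injective v.1
      · rw [if_pos hv, if_pos (hinj.mpr hv), Finset.smul_sum]
        refine Finset.sum_congr rfl fun s _ => ?_
        obtain ⟨⟨t, ht, htv⟩, hτ, hτr⟩ := simplexLift_spec v
        have hPinj : Function.Injective (P ∘ v.1) := by
          have hmem : ∀ i, simplexLift P (Set.range v.1) (P (v.1 i)) = v.1 i := by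
            intro i
            have hi : v.1 i ∈ simplexLift P (Set.range v.1) '' (P '' Set.range v.1) := by
              rw [hτr]
              exact ⟨i, rfl⟩
            obtain ⟨x, hx, hxi⟩ := hi
            rw [← hxi, hτ.apply_eq x (subset_convexHull ℝ _ hx)]
          intro i j hij
          apply hv
          rw [← hmem i, ← hmem j]
          exact congrArg _ hij
        have hind : AffineIndependent ℝ (P ∘ v.1) := by
          have h := (K.indep ht).comp_embedding
            (⟨fun i => ⟨P (v.1 i), by
              rw [← Finset.mem_coe, htv]
              exact ⟨_, ⟨i, rfl⟩, rfl⟩⟩, fun i j h => hPinj (congrArg Subtype.val h)⟩ :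
              Fin (q + 1) ↪ t)
          exact h
        by_cases h : (s.1 : Set E) ⊆ convexHull ℝ (P '' Set.range v.1)
        · have h' : (s.1 : Set E) ⊆ convexHull ℝ (P '' Set.range (v.perm σ).1) := by
            rwa [hrange]
          rw [dif_pos h, dif_pos h']
          have hl : liftInside (v.perm σ) s h' = liftInside v s h := by
            apply Subtype.ext
            simp only [liftInside, hrange]
          have ho : orientSign (P ∘ (v.perm σ).1) s.order
              = (Equiv.Perm.sign σ : ℤ) * orientSign (P ∘ v.1) s.order :=
            orientSign_perm hind σ _
          rw [hl, ho, mul_smul]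
        · have h' : ¬ (s.1 : Set E) ⊆ convexHull ℝ (P '' Set.range (v.perm σ).1) := by
            rwa [hrange]
          rw [dif_neg h, dif_neg h', smul_zero]
      · rw [if_neg hv, if_neg fun h => hv (hinj.mp h), smul_zero])

/-! ### The trace of `f̃_k^q ∘ ε^q` -/

/-- The trace `tr(f̃_k^q ∘ ε^q) ∈ ℤπ` of the endomorphism `f̃_k^q ∘ ε^q` of `C_q(K̃)`, where
`ε^q : C_q(K̃) → C_q(K̃')` and `f̃_k^q : C_q(K̃') → C_q(K̃)`. -/
def Lifting.trace {E : Type*} [NormedAddCommGroup E] [NormedSpace ℝ E]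
    {K K' : Geometry.SimplicialComplex ℝ E} [Finite K.faces] [Finite K'.faces]
    (hK' : IsSubdivision K' K) {Xt : Type*} [TopologicalSpace Xt] {p : Xt → K.space}
    (hp : IsUniversalCover p) {n : ℕ} {f : C(K.space, UConf n K.space)}
    (hf : IsNValuedSimplicial K' K f) (F : Lifting p f) {q : ℕ} (b : SimplexLifts K p q)
    (k : Fin n) : MonoidAlgebra ℤ (Deck p) :=
  have := hp.simplyConnected
  NValued.trace hp b
    (chainMap (F.isSimplicialMap_coord hK' hp hf k) q ∘ₗ
      subdivisionMap K K' (toAmbient p) q)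

end NValued

end

/-!
A lifting `Ht` of the homotopy from `F` to `G` commutes with covering transformations through
`Φ = F.induced hp` at all times (`homotopyLift_smul`): a covering transformation permutes the
projections of the coordinates in a way that cannot jump. At the end of the homotopy this says that
`G` induces `Φ` as well.

For the traces, simplicial approximation is carried out on chains. For small `ε`, every point `y` of
`|K|` is given a vertex whose open star contains the `ε`-ball at `y` (`StarChoice`), and
`nearVertex` lifts this to an equivariant map from `X̃` to the vertices of `K̃`. For a time `t`, the
approximation `A_t` of the coordinate `Ht(t, ·)_k` takes a simplex of `K̃`, replaces it by the sum
of the simplices of `K̃'` in it, subdivides these barycentrically `m` times and moves the vertices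
by `nearVertex ∘ Ht(t, ·)_k` (`approx`). The maps `Ht(·, ·)_k` are uniformly continuous on lifted
simplices (`exists_uniform`), so for `m` large one gets chains of `K̃`, and for nearby times
`t`, `t'` the vertices involved for both times span simplices (`contiguous_nearVertex`). The prism
operator is then a chain homotopy from `A_t` to `A_t'`, equivariant with the twist `Φ`
(`approx_homotopy_zero`, `approx_homotopy_succ`, `approxHomotopy_deckMap`).

Chain homotopic families have the same alternating sum of Reidemeister traces
(`sum_rho_trace_eq_of_homotopy`). This rests on the trace property `tr (∂ D) = tr (D ∂)`, which
holds in `ℤ R(Φ)` for families `D` that are equivariant with the twist `Φ`, because it only moves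
terms within Reidemeister classes (`FreeOn.tr_comp`). Hence the trace sum of `A_t` is locally
constant in `t`, so constant.

At the two ends the approximation is exact: for a simplicial coordinate `F_k`, `A_0` is equal to
`F_k ∘ ε` as a homomorphism of chains (`approx_coord`), since a point of a lifted simplex of `K̃'`
is sent to a value of `F_k` at one of the vertices of that simplex.

Two facts about subdivision are needed. The homomorphism `ε` commutes with boundaries
(`bd_subdivList`): an interior simplex of codimension one has exactly one neighbour on each side,
and their contributions cancel. Barycentric subdivision commutes with boundaries (`bd_sd`), shrinks
simplices (`sd_mem_small`) and does not see the order of vertices, up to sign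
(`sd_eq_zero_of_mem_alt`). The last point matters because the prism operator does depend on the
order of vertices; it is the reason for working with chains of lists.
-/

noncomputable section

namespace NValued

/-! ### Chains of lists -/

/-- The free abelian group on finite lists in `V`: ordered chains, possibly degenerate, of the full
simplex on `V`. A `q`-simplex is a list of length `q + 1`, and the empty list spans the
augmentation. -/
abbrev ListChain (V : Type*) : Type _ := List V →₀ ℤ

namespace ListChain

variable {V W : Type*}

/-- A list, as a chain. -/
abbrev of (l : List V) : ListChain V := Finsupp.single l 1

/-- Extend a function on lists linearly to chains. -/
abbrev extend {M : Type*} [AddCommGroup M] (φ : List V → M) : ListChain V →ₗ[ℤ] M :=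
  Finsupp.linearCombination ℤ φ

theorem extend_of {M : Type*} [AddCommGroup M] (φ : List V → M) (l : List V) :
    extend φ (of l) = φ l := by
  simp [extend, of]

theorem hom_ext {M : Type*} [AddCommGroup M] {f g : ListChain V →ₗ[ℤ] M}
    (h : ∀ l, f (of l) = g (of l)) : f = g :=
  Finsupp.lhom_ext' fun l => LinearMap.ext_ring (h l)

/-- The join with a vertex, put in front. -/
def cons (a : V) : ListChain V →ₗ[ℤ] ListChain V := extend fun l => of (a :: l)

@[simp] theorem cons_of (a : V) (l : List V) : cons a (of l) = of (a :: l) := extend_of _ _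

/-- The boundary of a list, `∂(a · l) = l - a · ∂l`. -/
def bdList : List V → ListChain V
  | [] => 0
  | a :: l => of l - cons a (bdList l)

/-- The (augmented) boundary operator. -/
def bd : ListChain V →ₗ[ℤ] ListChain V := extend bdList

@[simp] theorem bd_of (l : List V) : bd (of l) = bdList l := extend_of _ _

theorem bd_cons (a : V) (x : ListChain V) : bd (cons a x) = x - cons a (bd x) := by
  suffices bd ∘ₗ cons a = LinearMap.id - cons a ∘ₗ bd from LinearMap.congr_fun this x
  refine hom_ext fun l => ?_
  simp [bdList]

theorem bd_bd (x : ListChain V) : bd (bd x) = 0 := by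
  suffices bd ∘ₗ bd = (0 : ListChain V →ₗ[ℤ] ListChain V) from LinearMap.congr_fun this x
  refine hom_ext fun l => ?_
  induction l with
  | nil => simp [bdList]
  | cons a l ih =>
    simp only [LinearMap.comp_apply, LinearMap.zero_apply, bd_of] at ih ⊢
    rw [bdList, map_sub, bd_cons, ih, bd_of]
    simp

/-- The chain map induced by a map of vertices. -/
def map (h : V → W) : ListChain V →ₗ[ℤ] ListChain W := extend fun l => of (l.map h)

@[simp] theorem map_of (h : V → W) (l : List V) : map h (of l) = of (l.map h) := extend_of _ _

theorem map_cons (h : V → W) (a : V) (x : ListChain V) :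
    map h (cons a x) = cons (h a) (map h x) := by
  suffices map h ∘ₗ cons a = cons (h a) ∘ₗ map h from LinearMap.congr_fun this x
  refine hom_ext fun l => ?_
  simp

theorem bd_map (h : V → W) (x : ListChain V) : bd (map h x) = map h (bd x) := by
  suffices bd ∘ₗ map h = map h ∘ₗ bd from LinearMap.congr_fun this x
  refine hom_ext fun l => ?_
  induction l with
  | nil => simp [bdList]
  | cons a l ih =>
    simp only [LinearMap.comp_apply, bd_of, map_of, List.map_cons] at ih ⊢
    rw [bdList, bdList, map_sub, map_cons, ih, map_of]

/-- The prism over a list, built one vertex at a time. -/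
def prismList (h h' : V → W) : List V → ListChain W
  | [] => 0
  | a :: l => of (h a :: h' a :: l.map h') - cons (h a) (prismList h h' l)

/-- The prism operator, a chain homotopy from `map h` to `map h'`. -/
def prism (h h' : V → W) : ListChain V →ₗ[ℤ] ListChain W := extend (prismList h h')

@[simp] theorem prism_of (h h' : V → W) (l : List V) : prism h h' (of l) = prismList h h' l :=
  extend_of _ _

theorem prism_cons (h h' : V → W) (a : V) (x : ListChain V) :
    prism h h' (cons a x) = cons (h a) (cons (h' a) (map h' x)) - cons (h a) (prism h h' x) := by
  suffices prism h h' ∘ₗ cons a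
      = cons (h a) ∘ₗ cons (h' a) ∘ₗ map h' - cons (h a) ∘ₗ prism h h' from
    LinearMap.congr_fun this x
  refine hom_ext fun l => ?_
  simp [prismList]

theorem bd_prism (h h' : V → W) (x : ListChain V) :
    bd (prism h h' x) + prism h h' (bd x) = map h' x - map h x := by
  suffices bd ∘ₗ prism h h' + prism h h' ∘ₗ bd = map h' - map h from LinearMap.congr_fun this x
  refine hom_ext fun l => ?_
  induction l with
  | nil => simp [bdList, prismList]
  | cons a l ih =>
    simp only [LinearMap.comp_apply, LinearMap.add_apply, LinearMap.sub_apply] at ih ⊢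
    rw [← cons_of, prism_cons, bd_cons, map_sub, map_sub, bd_cons, bd_cons, bd_cons, prism_cons,
      map_cons, map_cons, bd_map]
    have e := congrArg (cons (h a)) ih
    simp only [map_add, map_sub] at e ⊢
    rw [← sub_eq_zero] at e ⊢
    rw [← e]
    abel

theorem map_prism {V' : Type*} (g : W → V') (h h' : V → W) (x : ListChain V) :
    map g (prism h h' x) = prism (g ∘ h) (g ∘ h') x := by
  suffices map g ∘ₗ prism h h' = prism (g ∘ h) (g ∘ h') from LinearMap.congr_fun this x
  refine hom_ext fun l => ?_
  rw [LinearMap.comp_apply, prism_of, prism_of]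
  induction l with
  | nil => simp [prismList]
  | cons a l ih =>
    rw [prismList, prismList, map_sub, map_cons, ih, map_of]
    simp

/-! ### Adjacent transpositions -/

/-- Two lists differ by exchanging two adjacent entries. -/
inductive Swap : List V → List V → Prop
  | head (a b : V) (l : List V) : Swap (a :: b :: l) (b :: a :: l)
  | cons (a : V) {l l' : List V} : Swap l l' → Swap (a :: l) (a :: l')

/-- The relations making a chain of lists alternating: a transposition of neighbours changes the
sign. -/
def alt (V : Type*) : Submodule ℤ (ListChain V) :=
  Submodule.span ℤ {x | ∃ l l' : List V, Swap l l' ∧ x = of l + of l'}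

theorem add_mem_alt {l l' : List V} (h : Swap l l') : of l + of l' ∈ alt V :=
  Submodule.subset_span ⟨l, l', h, rfl⟩

theorem alt_le_ker {M : Type*} [AddCommGroup M] (f : ListChain V →ₗ[ℤ] M)
    (h : ∀ l l', Swap l l' → f (of l) + f (of l') = 0) {x : ListChain V} (hx : x ∈ alt V) :
    f x = 0 := by
  suffices alt V ≤ LinearMap.ker f from LinearMap.mem_ker.mp (this hx)
  refine Submodule.span_le.mpr ?_
  rintro _ ⟨l, l', hl, rfl⟩
  exact LinearMap.mem_ker.mpr (by rw [map_add, h l l' hl])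

theorem alt_le_comap (f : ListChain V →ₗ[ℤ] ListChain W)
    (h : ∀ l l', Swap l l' → f (of l) + f (of l') ∈ alt W) {x : ListChain V} (hx : x ∈ alt V) :
    f x ∈ alt W := by
  suffices alt V ≤ (alt W).comap f from this hx
  refine Submodule.span_le.mpr ?_
  rintro _ ⟨l, l', hl, rfl⟩
  change f (of l + of l') ∈ alt W
  rw [map_add]
  exact h l l' hl

theorem cons_mem_alt (a : V) {x : ListChain V} (hx : x ∈ alt V) : cons a x ∈ alt V :=
  alt_le_comap _ (fun l l' h => by simpa using add_mem_alt (h.cons a)) hx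

theorem cons_cons_mem_alt (a b : V) (x : ListChain V) :
    cons a (cons b x) + cons b (cons a x) ∈ alt V := by
  induction x using Finsupp.induction_linear with
  | zero => simp
  | add x y hx hy =>
    simp only [map_add]
    convert (alt V).add_mem hx hy using 1
    abel
  | single l c =>
    have : (Finsupp.single l c : ListChain V) = c • of l := by simp
    rw [this]
    simp only [map_smul, cons_of]
    rw [← smul_add]
    exact (alt V).smul_mem _ (add_mem_alt (.head a b l))

theorem bdList_add_mem_alt {l l' : List V} (h : Swap l l') : bdList l + bdList l' ∈ alt V := by
  induction h with
  | head a b l =>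
    simp only [bdList, map_sub, cons_of]
    convert cons_cons_mem_alt a b (bdList l) using 1
    abel
  | cons a h ih =>
    simp only [bdList]
    convert (alt V).sub_mem (add_mem_alt h) (cons_mem_alt a ih) using 1
    simp only [map_add]
    abel

theorem bd_mem_alt {x : ListChain V} (hx : x ∈ alt V) : bd x ∈ alt V :=
  alt_le_comap _ (fun l l' h => by simpa using bdList_add_mem_alt h) hx

theorem Swap.perm {l l' : List V} (h : Swap l l') : l.Perm l' := by
  induction h with
  | head a b l => exact .swap _ _ _
  | cons a _ ih => exact ih.cons a

/-! ### Lists and tuples -/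

theorem swap_ofFn {n : ℕ} (v : Fin (n + 1) → V) (i : Fin n) :
    Swap (List.ofFn v) (List.ofFn (v ∘ Equiv.swap i.castSucc i.succ)) := by
  induction n with
  | zero => exact i.elim0
  | succ n ih =>
    refine Fin.cases ?_ (fun j => ?_) i
    · rw [List.ofFn_succ, List.ofFn_succ, List.ofFn_succ (n := n + 1), List.ofFn_succ (n := n)]
      have h0 : (v ∘ Equiv.swap (Fin.castSucc 0) (Fin.succ (0 : Fin (n + 1)))) 0
          = v (Fin.succ 0) := by simp
      have h1 : (v ∘ Equiv.swap (Fin.castSucc 0) (Fin.succ (0 : Fin (n + 1)))) (Fin.succ 0)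
          = v 0 := by simp
      have h2 : (fun i : Fin n => (v ∘ Equiv.swap (Fin.castSucc 0) (Fin.succ (0 : Fin (n + 1))))
          i.succ.succ) = fun i => v i.succ.succ := by
        funext i
        simp only [Function.comp]
        rw [Equiv.swap_apply_of_ne_of_ne]
        · simp [Fin.ext_iff]
        · simp [Fin.ext_iff]
      rw [h0, h1, h2]
      exact .head _ _ _
    · rw [List.ofFn_succ, List.ofFn_succ (n := n + 1)]
      have h0 : (v ∘ Equiv.swap j.succ.castSucc j.succ.succ) 0 = v 0 := by
        simp only [Function.comp]
        rw [Equiv.swap_apply_of_ne_of_ne]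
        · simp [Fin.ext_iff]
        · simp [Fin.ext_iff]
      have h1 : (fun i : Fin (n + 1) => (v ∘ Equiv.swap j.succ.castSucc j.succ.succ) i.succ)
          = (fun i : Fin (n + 1) => v i.succ) ∘ Equiv.swap j.castSucc j.succ := by
        funext i
        simp only [Function.comp]
        rw [← Fin.succ_castSucc, ← (Fin.succ_injective (n + 1)).map_swap]
      rw [h0, h1]
      exact (ih _ j).cons _

/-- Adjacent transpositions generate the symmetric group, so modulo `alt` a reordering multiplies a
list by its sign. -/
theorem ofFn_perm_sub_mem_alt {n : ℕ} (v : Fin (n + 1) → V) (σ : Equiv.Perm (Fin (n + 1))) :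
    of (List.ofFn (v ∘ σ)) - (Equiv.Perm.sign σ : ℤ) • of (List.ofFn v) ∈ alt V := by
  have hσ : σ ∈ Submonoid.closure (Set.range fun i : Fin n => Equiv.swap i.castSucc i.succ) := by
    rw [Equiv.Perm.mclosure_swap_castSucc_succ]
    trivial
  induction hσ using Submonoid.closure_induction_right with
  | one => simp
  | mul_right τ _ s hs ih =>
    obtain ⟨i, rfl⟩ := hs
    have h := add_mem_alt (swap_ofFn (v ∘ τ) i)
    have e : v ∘ (τ * Equiv.swap i.castSucc i.succ : Equiv.Perm _)
        = (v ∘ τ) ∘ Equiv.swap i.castSucc i.succ := rfl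
    have hne : i.castSucc ≠ i.succ := Fin.castSucc_lt_succ.ne
    dsimp only
    rw [e, Equiv.Perm.sign_mul, Equiv.Perm.sign_swap hne]
    convert (alt V).sub_mem h ih using 1
    simp only [mul_neg, mul_one, Units.val_neg, neg_smul]
    abel

theorem Swap.eq_ofFn {n : ℕ} {l l' : List V} (h : Swap l l') (v : Fin (n + 1) → V)
    (hv : l = List.ofFn v) :
    ∃ σ : Equiv.Perm (Fin (n + 1)), Equiv.Perm.sign σ = -1 ∧ l' = List.ofFn (v ∘ σ) := by
  induction h generalizing n with
  | head a b l =>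
    cases n with
    | zero => simp at hv
    | succ n =>
      refine ⟨Equiv.swap (Fin.castSucc 0) (Fin.succ 0), Equiv.Perm.sign_swap (by simp), ?_⟩
      have h2 := swap_ofFn v 0
      rw [← hv] at h2
      rw [List.ofFn_succ, List.ofFn_succ] at hv
      injection hv with ha hv
      injection hv with hb hv
      rw [List.ofFn_succ, List.ofFn_succ]
      have h2 : (fun i : Fin n => (v ∘ Equiv.swap (Fin.castSucc 0) (Fin.succ (0 : Fin (n + 1))))
          i.succ.succ) = fun i => v i.succ.succ := by
        funext i
        simp only [Function.comp]
        rw [Equiv.swap_apply_of_ne_of_ne]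
        · simp [Fin.ext_iff]
        · simp [Fin.ext_iff]
      rw [h2, ← hv, ha, hb]
      simp
  | cons a h ih =>
    cases n with
    | zero =>
      exfalso
      rw [List.ofFn_succ, List.ofFn_zero] at hv
      injection hv with ha hv
      subst hv
      cases h
    | succ n =>
      rw [List.ofFn_succ] at hv
      injection hv with ha hv
      obtain ⟨σ, hσ, hl⟩ := ih _ hv
      refine ⟨Equiv.Perm.decomposeFin.symm (0, σ), ?_, ?_⟩
      · simp [hσ]
      · rw [List.ofFn_succ, hl, ha]
        congr 1

theorem bdList_ofFn {n : ℕ} (v : Fin (n + 1) → V) :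
    bdList (List.ofFn v)
      = ∑ i : Fin (n + 1), (-1 : ℤ) ^ (i : ℕ) • of (List.ofFn (v ∘ i.succAbove)) := by
  induction n with
  | zero => simp [bdList]
  | succ n ih =>
    rw [List.ofFn_succ, bdList, ih, map_sum]
    conv_rhs => rw [Fin.sum_univ_succ]
    simp only [Fin.val_zero, pow_zero, one_smul, map_smul, cons_of, Fin.val_succ, pow_succ,
      mul_neg, mul_one, neg_smul, Finset.sum_neg_distrib, sub_eq_add_neg]
    congr 1
    refine congrArg Neg.neg (Finset.sum_congr rfl fun i _ => ?_)
    congr 2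
    rw [List.ofFn_succ (f := v ∘ _)]
    congr 1
    congr 1
    funext j
    simp

/-! ### Barycentric subdivision -/

section Subdivision

variable {E : Type*} [NormedAddCommGroup E] [NormedSpace ℝ E]

/-- The barycentre of a list of points. -/
def bary (l : List E) : E := (l.length : ℝ)⁻¹ • l.sum

open scoped Classical in
/-- Barycentric subdivision of chains of lists of length `n`, `Sd l = b_l · Sd ∂l`. In degree `0`
this is the projection to the span of the empty list. -/
def sd : ℕ → ListChain E →ₗ[ℤ] ListChain E
  | 0 => extend fun l => if l = [] then of [] else 0
  | n + 1 => extend fun l => cons (bary l) (sd n (bdList l))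

open scoped Classical in
theorem sd_zero_of (l : List E) : sd 0 (of l) = if l = [] then of [] else 0 := by
  rw [sd, extend_of]

theorem sd_succ_of (n : ℕ) (l : List E) :
    sd (n + 1) (of l) = cons (bary l) (sd n (bdList l)) := extend_of _ _

/-- The chains supported on lists of length `n` with property `P`. -/
abbrev on (P : List V → Prop) : Submodule ℤ (ListChain V) := Finsupp.supported ℤ ℤ {l | P l}

theorem of_mem_on {P : List V → Prop} {l : List V} (h : P l) : of l ∈ on P :=
  Finsupp.single_mem_supported ℤ _ h

theorem map_mem_of_mem_on {M : Type*} [AddCommGroup M] {P : List V → Prop} (N : Submodule ℤ M)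
    (f : ListChain V →ₗ[ℤ] M) (h : ∀ l, P l → f (of l) ∈ N) {x : ListChain V} (hx : x ∈ on P) :
    f x ∈ N := by
  suffices on P ≤ N.comap f from this hx
  rw [on, Finsupp.supported_eq_span_single, Submodule.span_le]
  rintro _ ⟨l, hl, rfl⟩
  exact h l hl

theorem eq_of_mem_on {M : Type*} [AddCommGroup M] {P : List V → Prop}
    {f g : ListChain V →ₗ[ℤ] M} (h : ∀ l, P l → f (of l) = g (of l)) {x : ListChain V}
    (hx : x ∈ on P) : f x = g x := by
  have := map_mem_of_mem_on ⊥ (f - g) (fun l hl => by simp [h l hl]) hx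
  exact sub_eq_zero.mp (by simpa using this)

theorem cons_mem_on {P Q : List V → Prop} (a : V) (h : ∀ l, P l → Q (a :: l)) {x : ListChain V}
    (hx : x ∈ on P) : cons a x ∈ on Q :=
  map_mem_of_mem_on _ _ (fun l hl => by
    rw [cons_of]
    exact of_mem_on (h l hl)) hx

theorem on_mono {P Q : List V → Prop} (h : ∀ l, P l → Q l) {x : ListChain V} (hx : x ∈ on P) :
    x ∈ on Q := Finsupp.supported_mono (s := {l | P l}) (t := {l | Q l}) h hx

theorem bdList_mem_on (l : List V) :
    bdList l ∈ on fun m => m.length + 1 = l.length ∧ m.Sublist l := by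
  induction l with
  | nil => exact Submodule.zero_mem _
  | cons a l ih =>
    rw [bdList]
    refine Submodule.sub_mem _ (of_mem_on ⟨rfl, List.sublist_cons_self a l⟩)
      (cons_mem_on a ?_ ih)
    rintro m ⟨h1, h2⟩
    exact ⟨by simp [← h1], h2.cons_cons a⟩

theorem prismList_mem_on (h h' : V → W) (l : List V) :
    prismList h h' l ∈ on fun m =>
      m.length = l.length + 1 ∧ ∀ y ∈ m, ∃ x ∈ l, y = h x ∨ y = h' x := by
  induction l with
  | nil => exact Submodule.zero_mem _
  | cons a l ih =>
    rw [prismList]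
    refine Submodule.sub_mem _ (of_mem_on ⟨by simp, ?_⟩) (cons_mem_on _ ?_ ih)
    · intro y hy
      rcases List.mem_cons.mp hy with rfl | hy
      · exact ⟨a, by simp, Or.inl rfl⟩
      · rcases List.mem_cons.mp hy with rfl | hy
        · exact ⟨a, by simp, Or.inr rfl⟩
        · obtain ⟨x, hx, rfl⟩ := List.mem_map.mp hy
          exact ⟨x, by simp [hx], Or.inr rfl⟩
    · rintro m ⟨h1, h2⟩
      refine ⟨by simp [h1], fun y hy => ?_⟩
      rcases List.mem_cons.mp hy with rfl | hy
      · exact ⟨a, by simp, Or.inl rfl⟩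
      · obtain ⟨x, hx, h3⟩ := h2 y hy
        exact ⟨x, by simp [hx], h3⟩

theorem prism_congr {g g' h h' : V → W} {x : ListChain V}
    (hx : x ∈ on fun l => ∀ a ∈ l, g a = h a ∧ g' a = h' a) : prism g g' x = prism h h' x := by
  refine eq_of_mem_on (fun l hl => ?_) hx
  rw [prism_of, prism_of]
  induction l with
  | nil => rfl
  | cons a l ih =>
    rw [prismList, prismList, ih fun b hb => hl b (by simp [hb]), (hl a (by simp)).1,
      (hl a (by simp)).2,
      List.map_congr_left fun b hb => (hl b (List.mem_cons_of_mem _ hb)).2]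

theorem sd_zero {x : ListChain E} (hx : x ∈ on fun l : List E => l.length = 0) : sd 0 x = x :=
  eq_of_mem_on (g := LinearMap.id) (fun l hl => by
    rw [sd_zero_of, if_pos (List.length_eq_zero_iff.mp hl), List.length_eq_zero_iff.mp hl,
      LinearMap.id_apply]) hx

theorem bd_sd (n : ℕ) {x : ListChain E} (hx : x ∈ on fun l : List E => l.length = n + 1) :
    bd (sd (n + 1) x) = sd n (bd x) := by
  suffices ∀ l : List E, l.length = n + 1 →
      (bd ∘ₗ sd (n + 1)) (of l) = (sd n ∘ₗ bd) (of l) from eq_of_mem_on this hx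
  intro l hl
  rw [LinearMap.comp_apply, LinearMap.comp_apply, sd_succ_of, bd_cons, bd_of]
  have hb : bd (sd n (bdList l)) = 0 := by
    cases n with
    | zero =>
      rw [sd_zero (on_mono (fun m hm => by have := hm.1; omega) (bdList_mem_on l)), ← bd_of, bd_bd]
    | succ n =>
      rw [bd_sd n (on_mono (fun m hm => by have := hm.1; omega) (bdList_mem_on l)), ← bd_of,
        bd_bd, map_zero]
  rw [hb, map_zero, sub_zero]

theorem sd_mem_length (n : ℕ) {x : ListChain E} (hx : x ∈ on fun l : List E => l.length = n) :
    sd n x ∈ on fun l : List E => l.length = n := by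
  induction n generalizing x with
  | zero => rwa [sd_zero hx]
  | succ n ih =>
    refine map_mem_of_mem_on _ _ (fun l hl => ?_) hx
    rw [sd_succ_of]
    refine cons_mem_on _ (fun m hm => ?_)
      (ih (on_mono (fun m hm => ?_) (bdList_mem_on l)))
    · simp only [List.length_cons, hm]
    · have := hm.1; omega

theorem iterate_sd_mem_length (n m : ℕ) {x : ListChain E}
    (hx : x ∈ on fun l : List E => l.length = n) :
    (sd n)^[m] x ∈ on fun l : List E => l.length = n := by
  induction m with
  | zero => exact hx
  | succ m ih =>
    rw [Function.iterate_succ_apply']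
    exact sd_mem_length n ih

theorem bd_iterate_sd (n m : ℕ) {x : ListChain E}
    (hx : x ∈ on fun l : List E => l.length = n + 1) :
    bd ((sd (n + 1))^[m] x) = (sd n)^[m] (bd x) := by
  induction m with
  | zero => rfl
  | succ m ih =>
    rw [Function.iterate_succ_apply', Function.iterate_succ_apply',
      bd_sd n (iterate_sd_mem_length _ m hx), ih]

/-- Barycentric subdivision kills the alternating relations: the barycentre does not see the
order, and the boundaries of the two lists of a relation again differ by relations. -/
theorem sd_eq_zero_of_mem_alt (n : ℕ) {x : ListChain E} (hx : x ∈ alt E) : sd n x = 0 := by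
  induction n generalizing x with
  | zero =>
    refine alt_le_ker _ (fun l l' h => ?_) hx
    have h1 : l ≠ [] := by rintro rfl; cases h
    have h2 : l' ≠ [] := by rintro rfl; cases h
    rw [sd_zero_of, sd_zero_of, if_neg h1, if_neg h2, add_zero]
  | succ n ih =>
    refine alt_le_ker _ (fun l l' h => ?_) hx
    have hb : bary l' = bary l := by
      rw [bary, bary, h.perm.length_eq, h.perm.sum_eq]
    rw [sd_succ_of, sd_succ_of, hb, ← map_add, ← map_add, ih (bdList_add_mem_alt h), map_zero]

theorem bary_mem_convexHull {l : List E} (hl : l ≠ []) {A : Set E} (hA : Convex ℝ A)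
    (h : ∀ x ∈ l, x ∈ A) : bary l ∈ A := by
  have hs : bary l = ∑ i : Fin l.length, (l.length : ℝ)⁻¹ • l[i] := by
    rw [bary, ← Finset.smul_sum]
    congr 1
    exact (Fin.sum_univ_getElem l).symm
  have hpos : (0 : ℝ) < l.length := by exact_mod_cast List.length_pos_of_ne_nil hl
  rw [hs]
  refine hA.sum_mem (fun _ _ => by positivity) ?_ (fun i _ => h _ (List.getElem_mem _))
  simp [hpos.ne']

/-- The distance from a barycentre to a vertex, for lists of length at most `n + 1` and
diameter at most `r`. -/
theorem dist_bary_le {l : List E} (n : ℕ) (hn : l.length ≤ n + 1) {r : ℝ} (hr : 0 ≤ r)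
    (h : ∀ x ∈ l, ∀ y ∈ l, dist x y ≤ r) {y : E} (hy : y ∈ l) :
    dist (bary l) y ≤ (n / (n + 1) : ℝ) * r := by
  classical
  have hlen : 0 < l.length := List.length_pos_of_mem hy
  have hpos : (0 : ℝ) < l.length := by exact_mod_cast hlen
  obtain ⟨j, hj, rfl⟩ := List.getElem_of_mem hy
  have hs : bary l - l[j] = (l.length : ℝ)⁻¹ • ∑ i : Fin l.length, (l[i] - l[j]) := by
    rw [Finset.sum_sub_distrib, smul_sub, bary, Finset.sum_const, Finset.card_univ,
      Fintype.card_fin, ← Nat.cast_smul_eq_nsmul ℝ, smul_smul, inv_mul_cancel₀ hpos.ne', one_smul]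
    congr 2
    exact (Fin.sum_univ_getElem l).symm
  have hsum : ‖∑ i : Fin l.length, (l[i] - l[j])‖ ≤ (l.length - 1 : ℝ) * r := by
    rw [← Finset.add_sum_erase _ _ (Finset.mem_univ (⟨j, hj⟩ : Fin l.length))]
    simp only [Fin.getElem_fin, sub_self, zero_add]
    refine (norm_sum_le_of_le _ (f := fun i : Fin l.length => l[i] - l[j])
      (n := fun _ => r) fun i _ => ?_).trans ?_
    · rw [← dist_eq_norm]
      exact h _ (List.getElem_mem _) _ (List.getElem_mem _)
    · rw [Finset.sum_const, Finset.card_erase_of_mem (Finset.mem_univ _), Finset.card_univ,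
        Fintype.card_fin, nsmul_eq_mul, Nat.cast_sub hlen]
      simp
  rw [dist_eq_norm, hs, norm_smul, norm_inv, Real.norm_of_nonneg hpos.le]
  calc (l.length : ℝ)⁻¹ * _ ≤ (l.length : ℝ)⁻¹ * ((l.length - 1 : ℝ) * r) := by gcongr
    _ = (1 - (l.length : ℝ)⁻¹) * r := by field_simp
    _ ≤ (1 - ((n : ℝ) + 1)⁻¹) * r := by
        have : (l.length : ℝ) ≤ n + 1 := by exact_mod_cast hn
        gcongr
    _ = _ := by field_simp; ring

/-- A list lies in `A` and has diameter at most `r`. -/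
def Small (A : Set E) (r : ℝ) (l : List E) : Prop :=
  (∀ x ∈ l, x ∈ A) ∧ ∀ x ∈ l, ∀ y ∈ l, dist x y ≤ r

/-- Subdivision shrinks diameters by the factor `D / (D + 1)`, where `D` bounds the dimension. -/
theorem sd_mem_small (n D : ℕ) (hn : n ≤ D + 1) {l : List E} (hl : l.length = n) {r : ℝ}
    (hr : 0 ≤ r) (h : ∀ x ∈ l, ∀ y ∈ l, dist x y ≤ r) :
    sd n (of l) ∈ on (Small (convexHull ℝ {x | x ∈ l}) ((D / (D + 1) : ℝ) * r)) := by
  induction n generalizing l with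
  | zero =>
    have : l = [] := List.length_eq_zero_iff.mp hl
    subst this
    rw [sd_zero (of_mem_on rfl)]
    exact of_mem_on ⟨by simp, by simp⟩
  | succ n ih =>
    rw [sd_succ_of]
    have hl0 : l ≠ [] := by rintro rfl; simp at hl
    have hmem : sd n (bdList l)
        ∈ on (Small (convexHull ℝ {x | x ∈ l}) ((D / (D + 1) : ℝ) * r)) := by
      refine map_mem_of_mem_on _ _ (fun m hm => ?_) (bdList_mem_on l)
      have hsub : ∀ x ∈ m, x ∈ l := hm.2.subset
      refine on_mono ?_ (ih (by omega) (by have := hm.1; omega)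
        fun x hx y hy => h x (hsub x hx) y (hsub y hy))
      rintro k ⟨h1, h2⟩
      exact ⟨fun x hx => convexHull_mono hsub (h1 x hx), h2⟩
    refine cons_mem_on _ ?_ hmem
    rintro m ⟨h1, h2⟩
    have hb : bary l ∈ convexHull ℝ {x | x ∈ l} :=
      bary_mem_convexHull hl0 (convex_convexHull ℝ _) fun x hx => subset_convexHull ℝ _ hx
    -- the vertices of `l`, hence their convex hull, lie in a ball around the barycentre
    have hball : convexHull ℝ {x | x ∈ l} ⊆ Metric.closedBall (bary l) ((D / (D + 1) : ℝ) * r) :=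
      convexHull_min (fun y hy => by
        rw [Metric.mem_closedBall, dist_comm]
        exact dist_bary_le D (by omega) hr h hy) (convex_closedBall _ _)
    refine ⟨?_, ?_⟩
    · intro x hx
      rcases List.mem_cons.mp hx with rfl | hx
      · exact hb
      · exact h1 x hx
    · intro x hx y hy
      rcases List.mem_cons.mp hx with rfl | hx <;> rcases List.mem_cons.mp hy with rfl | hy
      · rw [dist_self]
        positivity
      · rw [dist_comm]
        exact hball (h1 y hy)
      · exact hball (h1 x hx)
      · exact h2 x hx y hy

theorem iterate_sd_mem_small (n D m : ℕ) (hn : n ≤ D + 1) {l : List E} (hl : l.length = n) {r : ℝ}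
    (hr : 0 ≤ r) {A : Set E} (hA : Convex ℝ A) (h : Small A r l) :
    (sd n)^[m] (of l) ∈ on fun k => k.length = n ∧ Small A ((D / (D + 1) : ℝ) ^ m * r) k := by
  induction m with
  | zero => exact of_mem_on ⟨hl, by simpa using h⟩
  | succ m ih =>
    rw [Function.iterate_succ_apply']
    refine map_mem_of_mem_on _ _ (fun k hk => ?_) ih
    have h1 := sd_mem_small n D hn hk.1 (r := (D / (D + 1) : ℝ) ^ m * r) (by positivity) hk.2.2
    have h2 := sd_mem_length n (of_mem_on (P := fun l : List E => l.length = n) hk.1)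
    have h3 : sd n (of k) ∈ on fun k' : List E => k'.length = n ∧
        Small (convexHull ℝ {x | x ∈ k}) ((D / (D + 1) : ℝ) * ((D / (D + 1) : ℝ) ^ m * r)) k' := by
      rw [Finsupp.mem_supported] at h1 h2 ⊢
      exact fun x hx => ⟨h2 hx, h1 hx⟩
    refine on_mono ?_ h3
    rintro k' ⟨h4, h5, h6⟩
    refine ⟨h4, fun x hx => convexHull_min hk.2.1 hA (h5 x hx), fun x hx y hy => ?_⟩
    rw [pow_succ, mul_comm (_ ^ m), mul_assoc]
    exact h6 x hx y hy

end Subdivision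

end ListChain

/-! ### From chains of lists to oriented chains -/

section ToChain

variable {V W : Type*} {L : PreAbstractSimplicialComplex V} {M : PreAbstractSimplicialComplex W}

open ListChain

/-- A list enumerates the vertices of a `q`-simplex of `L`, possibly with repetitions. -/
def IsSimplexList (L : PreAbstractSimplicialComplex V) (q : ℕ) (l : List V) : Prop :=
  ∃ v : OrderedSimplex L q, List.ofFn v.1 = l

theorem isSimplexList_of_subset {q : ℕ} {l : List V} (hl : l.length = q + 1) {U : Finset V}
    (hU : U ∈ L.faces) (h : ∀ x ∈ l, x ∈ U) : IsSimplexList L q l := by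
  classical
  refine ⟨⟨fun i => l.get (i.cast hl.symm), l.toFinset, ?_, ?_⟩, ?_⟩
  · refine (L.isRelLowerSet_faces hU).2 (fun x hx => h x (List.mem_toFinset.mp hx)) ?_
    rw [List.toFinset_nonempty_iff]
    rintro rfl
    simp at hl
  · ext x
    simp only [List.coe_toFinset, Set.mem_ofPred_eq, Set.mem_range]
    constructor
    · intro hx
      obtain ⟨i, hi⟩ := List.get_of_mem hx
      exact ⟨i.cast hl, by simpa using hi⟩
    · rintro ⟨i, rfl⟩
      exact List.get_mem _ _
  · apply List.ext_getElem
    · simp [hl]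
    · intro i h1 h2
      rw [List.getElem_ofFn]
      rfl

open scoped Classical in
/-- The oriented chain of a chain of lists; lists which do not enumerate a `q`-simplex of `L` go
to `0`. -/
def toChain (L : PreAbstractSimplicialComplex V) (q : ℕ) : ListChain V →ₗ[ℤ] Chain L q :=
  extend fun l => if h : IsSimplexList L q l then Chain.of h.choose else 0

theorem toChain_ofFn {q : ℕ} (v : OrderedSimplex L q) :
    toChain L q (of (List.ofFn v.1)) = Chain.of v := by
  have h : IsSimplexList L q (List.ofFn v.1) := ⟨v, rfl⟩
  rw [toChain, extend_of, dif_pos h]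
  congr 1
  exact Subtype.ext (List.ofFn_injective h.choose_spec)

theorem toChain_of_not {q : ℕ} {l : List V} (h : ¬ IsSimplexList L q l) :
    toChain L q (of l) = 0 := by
  rw [toChain, extend_of, dif_neg h]

theorem ListChain.Swap.symm {l l' : List V} (h : Swap l l') : Swap l' l := by
  induction h with
  | head a b l => exact .head b a l
  | cons a _ ih => exact ih.cons a

theorem toChain_eq_zero_of_mem_alt {q : ℕ} {x : ListChain V} (hx : x ∈ alt V) :
    toChain L q x = 0 := by
  have key : ∀ l l' : List V, Swap l l' → IsSimplexList L q l →
      IsSimplexList L q l' ∧ toChain L q (of l) + toChain L q (of l') = 0 := by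
    rintro l l' h ⟨v, hv⟩
    obtain ⟨σ, hσ, hl'⟩ := h.eq_ofFn v.1 hv.symm
    have e : l' = List.ofFn (v.perm σ).1 := hl'
    refine ⟨⟨_, e.symm⟩, ?_⟩
    rw [e, ← hv, toChain_ofFn, toChain_ofFn, Chain.of_perm, hσ]
    simp
  refine alt_le_ker _ (fun l l' h => ?_) hx
  by_cases hl : IsSimplexList L q l
  · exact (key l l' h hl).2
  · have hl' : ¬ IsSimplexList L q l' := fun hl' => hl (key l' l h.symm hl').1
    rw [toChain_of_not hl, toChain_of_not hl', add_zero]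

theorem toChain_eq_zero_of_not_nodup {q : ℕ} {l : List V} (h : ¬ l.Nodup) :
    toChain L q (of l) = 0 := by
  by_cases hl : IsSimplexList L q l
  · obtain ⟨v, rfl⟩ := hl
    rw [toChain_ofFn, Chain.of_eq_zero]
    rwa [List.nodup_ofFn] at h
  · exact toChain_of_not hl

/-- The boundary of a degenerate simplex vanishes as an oriented chain: with the two equal vertices
in front, the two terms missing one of them cancel, and the others are degenerate. -/
theorem toChain_bd_eq_zero {q : ℕ} {v : Fin (q + 2) → V} (hv : ¬ Function.Injective v) :
    toChain L q (bdList (List.ofFn v)) = 0 := by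
  obtain ⟨i, j, hij, hne⟩ : ∃ i j, v i = v j ∧ i ≠ j := by
    simpa [Function.Injective, not_forall] using hv
  -- a reordering of `v` starting with two equal entries
  let k := Equiv.swap 0 i j
  let σ : Equiv.Perm (Fin (q + 2)) := Equiv.swap 0 i * Equiv.swap 1 k
  have hk0 : k ≠ 0 := fun h => hne (by
    have := congrArg (Equiv.swap 0 i) h
    rw [Equiv.swap_apply_self, Equiv.swap_apply_left] at this
    exact this.symm)
  have hσ0 : σ 0 = i := by
    have : Equiv.swap 1 k 0 = 0 := Equiv.swap_apply_of_ne_of_ne (by simp) hk0.symm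
    simp [σ, this]
  have hσ1 : σ 1 = j := by simp [σ, k]
  have h1 := toChain_eq_zero_of_mem_alt (L := L) (q := q) (bd_mem_alt (ofFn_perm_sub_mem_alt v σ))
  rw [map_sub, map_smul, bd_of, bd_of, map_sub, map_smul] at h1
  have h2 : toChain L q (bdList (List.ofFn (v ∘ σ))) = 0 := by
    have e : List.ofFn (v ∘ σ)
        = v i :: v i :: List.ofFn fun m : Fin q => (v ∘ σ) m.succ.succ := by
      rw [List.ofFn_succ, List.ofFn_succ]
      have h0 : (v ∘ σ) 0 = v i := by simp [hσ0]
      have h1 : (v ∘ σ) (Fin.succ 0) = v i := by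
        have : (Fin.succ 0 : Fin (q + 2)) = 1 := rfl
        rw [this]
        simp [hσ1, hij]
      rw [h0, h1]
    rw [e, bdList, bdList, map_sub (cons _), cons_of, sub_sub_cancel]
    refine Submodule.mem_bot ℤ |>.mp (map_mem_of_mem_on (P := fun m => ¬ m.Nodup) ⊥ _
      (fun m hm => by simp [toChain_eq_zero_of_not_nodup hm])
      (cons_mem_on (P := fun m => v i ∈ m) _ (fun m hm => by simp [hm])
        (cons_mem_on (P := fun _ => True) _ (fun m _ => by simp)
          (on_mono (fun _ _ => trivial) (bdList_mem_on _)))))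
  rw [h2, zero_sub, neg_eq_zero] at h1
  rcases Int.units_eq_one_or (Equiv.Perm.sign σ) with h | h <;> simpa [h] using h1

/-- The boundary operator of oriented chains. -/
def bdry (L : PreAbstractSimplicialComplex V) (q : ℕ) : Chain L (q + 1) →ₗ[ℤ] Chain L q :=
  Chain.lift (fun v => toChain L q (bdList (List.ofFn v.1)))
    (fun _ hv => toChain_bd_eq_zero hv)
    (fun v σ => by
      have h := toChain_eq_zero_of_mem_alt (L := L) (q := q)
        (bd_mem_alt (ofFn_perm_sub_mem_alt v.1 σ))
      rw [map_sub, map_smul, bd_of, bd_of, map_sub, map_smul] at h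
      exact sub_eq_zero.mp h)

theorem bdry_of {q : ℕ} (v : OrderedSimplex L (q + 1)) :
    bdry L q (Chain.of v) = toChain L q (bdList (List.ofFn v.1)) := Chain.lift_of _ _ _ _

theorem bdry_toChain {q : ℕ} {x : ListChain V} (hx : x ∈ on (IsSimplexList L (q + 1))) :
    bdry L q (toChain L (q + 1) x) = toChain L q (bd x) := by
  suffices ∀ l : List V, IsSimplexList L (q + 1) l →
      (bdry L q ∘ₗ toChain L (q + 1)) (of l) = (toChain L q ∘ₗ bd) (of l) from
    eq_of_mem_on this hx
  rintro l ⟨v, rfl⟩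
  rw [LinearMap.comp_apply, LinearMap.comp_apply, toChain_ofFn, bdry_of, bd_of]

theorem Chain.hom_ext {q : ℕ} {A : Type*} [AddCommGroup A] {f g : Chain L q →ₗ[ℤ] A}
    (h : ∀ v, Function.Injective v.1 → f (Chain.of v) = g (Chain.of v)) : f = g := by
  refine Submodule.linearMap_qext _ (Finsupp.lhom_ext' fun v => LinearMap.ext_ring ?_)
  change f (Chain.of v) = g (Chain.of v)
  by_cases hv : Function.Injective v.1
  · exact h v hv
  · rw [Chain.of_eq_zero hv, map_zero, map_zero]

theorem chainMap_of {f : V → W} (hf : IsSimplicialMap L M f) {q : ℕ} (v : OrderedSimplex L q) :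
    chainMap hf q (Chain.of v) = Chain.of (v.map hf) := Chain.lift_of _ _ _ _

theorem chainMap_toChain {f : V → W} (hf : IsSimplicialMap L M f) {q : ℕ} {x : ListChain V}
    (hx : x ∈ on (IsSimplexList L q)) :
    chainMap hf q (toChain L q x) = toChain M q (map f x) := by
  suffices ∀ l : List V, IsSimplexList L q l →
      (chainMap hf q ∘ₗ toChain L q) (of l) = (toChain M q ∘ₗ map f) (of l) from
    eq_of_mem_on this hx
  rintro l ⟨v, rfl⟩
  rw [LinearMap.comp_apply, LinearMap.comp_apply, toChain_ofFn, chainMap_of, map_of, List.map_ofFn,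
    ← toChain_ofFn]
  rfl

theorem OrderedSimplex.face_mem {q : ℕ} (v : OrderedSimplex L (q + 1)) (i : Fin (q + 2)) :
    ∃ T ∈ L.faces, (T : Set V) = Set.range (v.1 ∘ i.succAbove) := by
  classical
  obtain ⟨T, hT, h⟩ := v.2
  refine ⟨Finset.univ.image (v.1 ∘ i.succAbove), (L.isRelLowerSet_faces hT).2 ?_ ?_,
    by rw [Finset.coe_image, Finset.coe_univ, Set.image_univ]⟩
  · rw [← Finset.coe_subset, h]
    simp only [Finset.coe_image, Finset.coe_univ, Set.image_univ]
    exact Set.range_comp_subset_range _ _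
  · simp

/-- The `i`-th face of an ordered simplex. -/
def OrderedSimplex.face {q : ℕ} (v : OrderedSimplex L (q + 1)) (i : Fin (q + 2)) :
    OrderedSimplex L q := ⟨v.1 ∘ i.succAbove, v.face_mem i⟩

theorem bdry_of_eq_sum {q : ℕ} (v : OrderedSimplex L (q + 1)) :
    bdry L q (Chain.of v) = ∑ i : Fin (q + 2), (-1 : ℤ) ^ (i : ℕ) • Chain.of (v.face i) := by
  rw [bdry_of, bdList_ofFn, map_sum]
  refine Finset.sum_congr rfl fun i _ => ?_
  rw [map_smul, ← toChain_ofFn]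
  rfl

theorem bdry_chainMap {f : V → W} (hf : IsSimplicialMap L M f) {q : ℕ} (c : Chain L (q + 1)) :
    bdry M q (chainMap hf (q + 1) c) = chainMap hf q (bdry L q c) := by
  suffices bdry M q ∘ₗ chainMap hf (q + 1) = chainMap hf q ∘ₗ bdry L q from
    LinearMap.congr_fun this c
  refine Chain.hom_ext fun v _ => ?_
  rw [LinearMap.comp_apply, LinearMap.comp_apply, chainMap_of, bdry_of_eq_sum, bdry_of_eq_sum,
    map_sum]
  refine Finset.sum_congr rfl fun i _ => ?_
  rw [map_smul, chainMap_of]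
  rfl

theorem Chain.coeff_self {q : ℕ} (w : OrderedSimplex L q) (hw : Function.Injective w.1) :
    Chain.coeff w hw (Chain.of w) = 1 := by
  classical
  rw [Chain.coeff, Chain.lift_of, Finset.sum_eq_single 1]
  · simp
  · intro σ _ hσ
    refine if_neg fun h => hσ ?_
    ext i
    have := hw (congrFun h i)
    simp [← this]
  · simp

end ToChain

/-! ### The Reidemeister trace of a boundary -/

section TraceAlgebra

variable {π : Type*} [Group π] {n : ℕ} (Φ : π →* Wreath π n) {S T : Type*}

/-- The free `ℤπ`-module on `S`, as an abelian group. -/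
abbrev FreeOn (π S : Type*) : Type _ := π × S →₀ ℤ

/-- The action of `π` on a free `ℤπ`-module. -/
def FreeOn.smul (γ : π) : FreeOn π S →ₗ[ℤ] FreeOn π S :=
  Finsupp.linearCombination ℤ fun a => Finsupp.single (γ * a.1, a.2) 1

theorem FreeOn.smul_single (γ : π) (a : π × S) :
    FreeOn.smul γ (Finsupp.single a 1 : FreeOn π S) = Finsupp.single (γ * a.1, a.2) 1 := by
  simp [FreeOn.smul]

open scoped Classical in
/-- The `ℤπ`-coordinate of an element of a free module at a basis element. -/
def FreeOn.coord (s : S) : FreeOn π S →ₗ[ℤ] (π →₀ ℤ) :=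
  Finsupp.linearCombination ℤ fun a => if a.2 = s then Finsupp.single a.1 1 else 0

/-- The sum of the classes `[γ δ, k]` over the terms `γ s` of an element of a free module. -/
def FreeOn.classes (s : S) (k : Fin n) (δ : π) : FreeOn π S →ₗ[ℤ] (ReidemeisterSet Φ →₀ ℤ) :=
  Finsupp.lmapDomain ℤ ℤ (fun γ => Quotient.mk (reidemeisterSetoid Φ) (γ * δ, k)) ∘ₗ
    FreeOn.coord s

open scoped Classical in
theorem FreeOn.classes_single (s : S) (k : Fin n) (δ : π) (a : π × S) :
    FreeOn.classes Φ s k δ (Finsupp.single a 1) = if a.2 = s then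
      Finsupp.single (Quotient.mk (reidemeisterSetoid Φ) (a.1 * δ, k)) 1 else 0 := by
  rw [FreeOn.classes, LinearMap.comp_apply, FreeOn.coord, Finsupp.linearCombination_single,
    one_smul]
  split_ifs
  · simp [Finsupp.mapDomain_single]
  · simp

theorem FreeOn.hom_ext {π S A : Type*} [AddCommGroup A] {f g : FreeOn π S →ₗ[ℤ] A}
    (h : ∀ a, f (Finsupp.single a 1) = g (Finsupp.single a 1)) : f = g :=
  Finsupp.lhom_ext' fun a => LinearMap.ext_ring (h a)

/-- The Reidemeister trace of a family of endomorphisms `A_1, …, A_n` of a free module. -/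
def FreeOn.tr [Fintype S] (A : Fin n → FreeOn π S →ₗ[ℤ] FreeOn π S) : ReidemeisterSet Φ →₀ ℤ :=
  ∑ k, ∑ s, FreeOn.classes Φ s k 1 (A k (Finsupp.single (1, s) 1))

/-- Reidemeister equivalence is what makes the classes of the terms at `s` insensitive to a twisted
translation. -/
theorem FreeOn.classes_smul (s : S) (j : Fin n) (δ : π) (x : FreeOn π S) :
    FreeOn.classes Φ s ((Φ δ).right j) 1 (FreeOn.smul ((Φ δ).left ((Φ δ).right j)) x)
      = FreeOn.classes Φ s j δ x := by
  classical
  suffices FreeOn.classes Φ s ((Φ δ).right j) 1 ∘ₗ FreeOn.smul ((Φ δ).left ((Φ δ).right j))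
      = FreeOn.classes Φ s j δ from LinearMap.congr_fun this x
  refine FreeOn.hom_ext fun a => ?_
  rw [LinearMap.comp_apply, FreeOn.smul_single, FreeOn.classes_single, FreeOn.classes_single]
  dsimp only
  split_ifs with h
  · congr 1
    refine (Quotient.sound (s := reidemeisterSetoid Φ) ⟨δ, rfl, ?_⟩).symm
    simp
  · rfl

/-- The trace property: composing an equivariant homomorphism `d` with a twisted equivariant
family `D` on either side gives the same Reidemeister trace. The term of `d t` at `δ s` pairs with
the term of `D_j s` at `γ t`; it contributes `[γ δ, j]` to the one trace and
`[φ_k(δ) γ, k]`, for `k = σ_δ j`, to the other, and these classes agree. -/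
theorem FreeOn.tr_comp [Fintype S] [Fintype T] (d : FreeOn π T →ₗ[ℤ] FreeOn π S)
    (hd : ∀ γ x, d (FreeOn.smul γ x) = FreeOn.smul γ (d x))
    (D : Fin n → FreeOn π S →ₗ[ℤ] FreeOn π T)
    (hD : ∀ γ k x, D k (FreeOn.smul γ x)
      = FreeOn.smul ((Φ γ).left k) (D ((Φ γ).right⁻¹ k) x)) :
    FreeOn.tr Φ (fun k => d ∘ₗ D k) = FreeOn.tr Φ (fun k => D k ∘ₗ d) := by
  classical
  have smul_classes : ∀ (s : S) (j : Fin n) (γ : π) (y : FreeOn π S),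
      FreeOn.classes Φ s j 1 (FreeOn.smul γ y) = Finsupp.linearCombination ℤ
        (fun a : π × S => if a.2 = s then
          Finsupp.single (Quotient.mk (reidemeisterSetoid Φ) (γ * a.1, j)) (1 : ℤ) else 0) y := by
    intro s j γ y
    suffices FreeOn.classes Φ s j 1 ∘ₗ FreeOn.smul γ = Finsupp.linearCombination ℤ
        (fun a : π × S => if a.2 = s then
          Finsupp.single (Quotient.mk (reidemeisterSetoid Φ) (γ * a.1, j)) (1 : ℤ) else 0) from
      LinearMap.congr_fun this y
    refine FreeOn.hom_ext fun a => ?_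
    rw [LinearMap.comp_apply, FreeOn.smul_single, FreeOn.classes_single]
    simp
  have left : ∀ (s : S) (j : Fin n) (x : FreeOn π T),
      FreeOn.classes Φ s j 1 (d x) = ∑ t, Finsupp.linearCombination ℤ
        (fun a : π × S => if a.2 = s then FreeOn.classes Φ t j a.1 x else 0)
          (d (Finsupp.single (1, t) 1)) := by
    intro s j x
    induction x using Finsupp.induction_linear with
    | zero => simp [Finsupp.linearCombination_apply]
    | add x y hx hy =>
      rw [map_add, map_add, hx, hy, ← Finset.sum_add_distrib]
      refine Finset.sum_congr rfl fun t _ => ?_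
      simp only [Finsupp.linearCombination_apply, ← Finsupp.sum_add]
      refine Finsupp.sum_congr fun a _ => ?_
      split_ifs
      · rw [map_add, smul_add]
      · simp
    | single a c =>
      have hc : (Finsupp.single a c : FreeOn π T) = c • Finsupp.single a 1 := by simp
      have ha : (Finsupp.single a 1 : FreeOn π T)
          = FreeOn.smul a.1 (Finsupp.single (1, a.2) 1) := by
        rw [FreeOn.smul_single, mul_one]
      rw [hc]
      simp only [map_smul]
      have hsm : ∀ t, (Finsupp.linearCombination ℤ fun b : π × S => if b.2 = s then
          c • FreeOn.classes Φ t j b.1 (Finsupp.single a 1) else 0) (d (Finsupp.single (1, t) 1))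
          = c • (Finsupp.linearCombination ℤ fun b : π × S => if b.2 = s then
          FreeOn.classes Φ t j b.1 (Finsupp.single a 1) else 0) (d (Finsupp.single (1, t) 1)) := by
        intro t
        simp only [Finsupp.linearCombination_apply, Finsupp.smul_sum]
        refine Finsupp.sum_congr fun b _ => ?_
        split_ifs
        · rw [smul_comm]
        · simp
      simp only [hsm, ← Finset.smul_sum]
      congr 1
      rw [Finset.sum_eq_single a.2]
      · rw [ha, hd, smul_classes]
        congr 2
        funext b
        rw [← ha, FreeOn.classes_single, if_pos rfl]
      · intro t _ ht
        rw [Finsupp.linearCombination_apply]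
        refine Finset.sum_eq_zero fun b _ => ?_
        dsimp only
        rw [FreeOn.classes_single, if_neg ht.symm]
        simp
      · simp
  have right : ∀ (t : T) (y : FreeOn π S), ∑ k, FreeOn.classes Φ t k 1 (D k y)
      = ∑ j, ∑ s, Finsupp.linearCombination ℤ (fun a : π × S => if a.2 = s then
          FreeOn.classes Φ t j a.1 (D j (Finsupp.single (1, s) 1)) else 0) y := by
    intro t y
    suffices ∑ k, FreeOn.classes Φ t k 1 ∘ₗ D k
        = ∑ j, ∑ s, Finsupp.linearCombination ℤ (fun a : π × S => if a.2 = s then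
          FreeOn.classes Φ t j a.1 (D j (Finsupp.single (1, s) 1)) else 0) by
      simpa [LinearMap.sum_apply] using LinearMap.congr_fun this y
    refine FreeOn.hom_ext fun a => ?_
    have ha : (Finsupp.single a 1 : FreeOn π S) = FreeOn.smul a.1 (Finsupp.single (1, a.2) 1) := by
      rw [FreeOn.smul_single, mul_one]
    simp only [LinearMap.sum_apply, LinearMap.comp_apply, Finsupp.linearCombination_single,
      one_smul, Finset.sum_ite_eq, Finset.mem_univ, if_true]
    rw [← Equiv.sum_comp (Φ a.1).right]
    refine Finset.sum_congr rfl fun j _ => ?_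
    rw [ha, hD, Equiv.Perm.coe_inv, Equiv.symm_apply_apply, FreeOn.classes_smul]
  have e1 : FreeOn.tr Φ (fun k => D k ∘ₗ d)
      = ∑ t, ∑ k, FreeOn.classes Φ t k 1 (D k (d (Finsupp.single (1, t) 1))) :=
    Finset.sum_comm
  rw [e1, FreeOn.tr]
  simp only [LinearMap.comp_apply, left, right]
  rw [Finset.sum_comm (s := Finset.univ (α := T))]
  exact Finset.sum_congr rfl fun j _ => Finset.sum_comm

end TraceAlgebra

/-! ### The action of covering transformations on chains -/

section DeckAction

variable {E : Type*} [NormedAddCommGroup E] [NormedSpace ℝ E] {Xt : Type*} [TopologicalSpace Xt]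

theorem IsLiftOn.eqOn {A : Set E} {p : Xt → A} (hp : IsUniversalCover p) {C : Set E}
    (hC : Convex ℝ C) {τ τ' : E → Xt} (hτ : IsLiftOn (toAmbient p) C τ)
    (hτ' : IsLiftOn (toAmbient p) C τ') {x : E} (hx : x ∈ C) (h : τ x = τ' x) : C.EqOn τ τ' :=
  hp.isCoveringMap.eqOn_of_comp_eqOn hC.isPreconnected hτ.continuousOn hτ'.continuousOn
    (fun y hy => Subtype.ext ((hτ.apply_eq y hy).trans (hτ'.apply_eq y hy).symm)) hx h

omit [NormedSpace ℝ E] in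
theorem IsLiftOn.smul {A : Set E} {p : Xt → A} {C : Set E} {τ : E → Xt}
    (hτ : IsLiftOn (toAmbient p) C τ) (γ : Deck p) :
    IsLiftOn (toAmbient p) C (fun x => γ • τ x) :=
  ⟨(Deck.continuous_smul γ).comp_continuousOn hτ.continuousOn, fun x hx => by
    rw [toAmbient, Deck.map_smul γ]
    exact hτ.apply_eq x hx⟩

theorem isSimplicialMap_smul {K : Geometry.SimplicialComplex ℝ E} {A : Set E} {p : Xt → A}
    (γ : Deck p) :
    IsSimplicialMap (liftedComplex K (toAmbient p)) (liftedComplex K (toAmbient p))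
      (fun x => γ • x) := by
  classical
  rintro T ⟨s, hs, τ, hτ, hT⟩
  refine ⟨T.image (fun x => γ • x), ⟨s, hs, _, hτ.smul γ, ?_⟩, Finset.coe_image⟩
  rw [Finset.coe_image, hT, Set.image_image]

/-- The action of a covering transformation on oriented chains. -/
def deckMap {K : Geometry.SimplicialComplex ℝ E} {A : Set E} {p : Xt → A} (γ : Deck p) (q : ℕ) :
    Chain (liftedComplex K (toAmbient p)) q →ₗ[ℤ] Chain (liftedComplex K (toAmbient p)) q :=
  chainMap (isSimplicialMap_smul γ) q

theorem deckMap_of {K : Geometry.SimplicialComplex ℝ E} {A : Set E} {p : Xt → A} (γ : Deck p)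
    {q : ℕ} (v : OrderedSimplex (liftedComplex K (toAmbient p)) q) :
    deckMap γ q (Chain.of v) = Chain.of (deckSmul γ v) := chainMap_of _ _

theorem deckSmul_mul {K : Geometry.SimplicialComplex ℝ E} {A : Set E} {p : Xt → A} (γ δ : Deck p)
    {q : ℕ} (v : OrderedSimplex (liftedComplex K (toAmbient p)) q) :
    deckSmul (γ * δ) v = deckSmul γ (deckSmul δ v) :=
  Subtype.ext (funext fun i => mul_smul γ δ (v.1 i))

variable {K : Geometry.SimplicialComplex ℝ E} {p : Xt → K.space}
  (hp : IsUniversalCover p) {q : ℕ} (b : SimplexLifts K p q)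

/-- The homomorphism from the free `ℤπ`-module on the simplices of `K` to `C_q(K̃)` given by the
chosen lifts. -/
def ofFree : FreeOn (Deck p) (SimplexOf K q) →ₗ[ℤ] Chain (liftedComplex K (toAmbient p)) q :=
  Finsupp.linearCombination ℤ fun a => Chain.of (deckSmul a.1 (b.simplex a.2))

theorem ofFree_single (a : Deck p × SimplexOf K q) :
    ofFree b (Finsupp.single a 1) = Chain.of (deckSmul a.1 (b.simplex a.2)) := by
  simp [ofFree]

theorem toAmbient_deckSmul (γ : Deck p)
    (v : OrderedSimplex (liftedComplex K (toAmbient p)) q) (i : Fin (q + 1)) :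
    toAmbient p ((deckSmul γ v).1 i) = toAmbient p (v.1 i) :=
  congrArg Subtype.val (Deck.map_smul γ (v.1 i))

theorem SimplexLifts.injective_toAmbient (s : SimplexOf K q) :
    Function.Injective (toAmbient p ∘ (b.simplex s).1) := by
  have h : Set.ncard (Set.range (toAmbient p ∘ (b.simplex s).1)) = q + 1 := by
    rw [Set.range_comp, b.image_eq, Set.ncard_coe_finset, s.2.2]
  rw [← Set.image_univ] at h
  exact Set.injOn_univ.mp (Set.injOn_of_ncard_image_eq (s := (Set.univ : Set (Fin (q + 1))))
    (by rw [h, Set.ncard_univ, Nat.card_fin]))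

include hp in
/-- The chosen lifts and their translates form a dual pair with the coefficient functionals. -/
theorem coeff_ofFree (γ : Deck p) (s : SimplexOf K q) (x : FreeOn (Deck p) (SimplexOf K q)) :
    Chain.coeff (deckSmul γ (b.simplex s)) (deckSmul_injective γ (b.injective s)) (ofFree b x)
      = x (γ, s) := by
  classical
  suffices Chain.coeff (deckSmul γ (b.simplex s)) (deckSmul_injective γ (b.injective s)) ∘ₗ
      ofFree b = Finsupp.lapply (γ, s) from LinearMap.congr_fun this x
  refine FreeOn.hom_ext fun a => ?_
  rw [LinearMap.comp_apply, ofFree_single, Finsupp.lapply_apply, Finsupp.single_apply]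
  split_ifs with ha
  · subst ha
    exact Chain.coeff_self _ _
  · rw [Chain.coeff, Chain.lift_of]
    refine Finset.sum_eq_zero fun σ _ => if_neg fun h => ha ?_
    have hP : ∀ i, toAmbient p ((b.simplex a.2).1 i) = toAmbient p ((b.simplex s).1 (σ i)) := by
      intro i
      rw [← toAmbient_deckSmul a.1, h]
      exact toAmbient_deckSmul γ _ _
    have hs : a.2 = s := by
      apply Subtype.ext
      apply Finset.coe_injective
      rw [← b.image_eq, ← b.image_eq, ← Set.range_comp, ← Set.range_comp]
      have : toAmbient p ∘ (b.simplex a.2).1 = (toAmbient p ∘ (b.simplex s).1) ∘ σ := funext hP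
      rw [this, σ.surjective.range_comp]
    have hσ : ∀ i, σ i = i := fun i => by
      have := hP i
      rw [hs] at this
      exact (b.injective_toAmbient s this).symm
    refine Prod.ext ?_ hs
    refine Deck.eq_of_smul_eq hp (x := (b.simplex s).1 0) ?_
    have := congrFun h 0
    rw [hs, Function.comp_apply, hσ] at this
    exact this

include hp in
theorem ofFree_injective : Function.Injective (ofFree b) := by
  intro x y h
  ext ⟨γ, s⟩
  rw [← coeff_ofFree hp b, h, coeff_ofFree hp b]

variable [Finite K.faces]

include hp in
/-- Every simplex of `K̃` is a translate of a chosen one, as the lifts of a simplex of `K` are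
permuted transitively. -/
theorem ofFree_surjective : Function.Surjective (ofFree b) := by
  rw [← LinearMap.range_eq_top, ← Submodule.ker_mkQ (LinearMap.range (ofFree b)),
    LinearMap.ker_eq_top]
  refine Chain.hom_ext fun v hv => ?_
  rw [LinearMap.zero_apply, Submodule.mkQ_apply, Submodule.Quotient.mk_eq_zero]
  obtain ⟨U, ⟨s, hs, τ, hτ, hU⟩, hUv⟩ := v.2
  have hτP : ∀ x ∈ s, toAmbient p (τ x) = x := fun x hx =>
    hτ.apply_eq x (subset_convexHull ℝ _ hx)
  have hcard : s.card = q + 1 := by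
    rw [← Set.ncard_coe_finset, ← Set.InjOn.ncard_image (f := τ), ← hU, hUv, ← Set.image_univ,
      Set.ncard_image_of_injective _ hv, Set.ncard_univ, Nat.card_fin]
    intro x hx y hy hxy
    rw [← hτP x hx, ← hτP y hy, hxy]
  let t : SimplexOf K q := ⟨s, hs, hcard⟩
  obtain ⟨U', ⟨s', hs', τ', hτ', hU'⟩, hUb⟩ := (b.simplex t).2
  have hss' : (s' : Set E) = s := by
    rw [← b.image_eq t, ← hUb, hU', Set.image_image]
    exact ((Set.image_congr fun x hx => hτ'.apply_eq x (subset_convexHull ℝ _ hx)).trans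
      (Set.image_id' _)).symm
  rw [hss'] at hτ' hU'
  obtain ⟨x₀, hx₀⟩ := K.nonempty_of_mem_faces hs
  have hx₀' := subset_convexHull ℝ (s : Set E) hx₀
  obtain ⟨γ, hγ⟩ := Deck.exists_smul_eq hp (x := τ' x₀) (y := τ x₀)
    (Subtype.ext ((hτ'.apply_eq x₀ hx₀').trans (hτ.apply_eq x₀ hx₀').symm))
  have heq := (hτ'.smul γ).eqOn hp (convex_convexHull ℝ _) hτ hx₀' hγ
  have hrange : Set.range v.1 = Set.range (deckSmul γ (b.simplex t)).1 := by
    rw [← hUv, hU]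
    change _ = Set.range ((fun x => γ • x) ∘ (b.simplex t).1)
    rw [Set.range_comp, ← hUb, hU', Set.image_image]
    exact (Set.image_congr fun x hx => heq (subset_convexHull ℝ _ hx)).symm
  have hw := deckSmul_injective γ (b.injective t)
  let σ : Equiv.Perm (Fin (q + 1)) := (Equiv.ofInjective _ hv).trans
    ((Equiv.setCongr hrange).trans (Equiv.ofInjective _ hw).symm)
  have hσ : v = (deckSmul γ (b.simplex t)).perm σ := by
    apply Subtype.ext
    funext i
    change v.1 i = (deckSmul γ (b.simplex t)).1 (σ i)
    have := Equiv.apply_ofInjective_symm hw (Equiv.setCongr hrange (Equiv.ofInjective _ hv i))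
    exact this.symm
  rw [hσ, Chain.of_perm]
  exact Submodule.smul_mem _ _ ⟨Finsupp.single (γ, t) 1, ofFree_single b _⟩

/-- The coordinates on `C_q(K̃)` given by the chosen lifts. -/
def freeEquiv : FreeOn (Deck p) (SimplexOf K q) ≃ₗ[ℤ] Chain (liftedComplex K (toAmbient p)) q :=
  LinearEquiv.ofBijective (ofFree b) ⟨ofFree_injective hp b, ofFree_surjective hp b⟩

theorem freeEquiv_single (a : Deck p × SimplexOf K q) :
    freeEquiv hp b (Finsupp.single a 1) = Chain.of (deckSmul a.1 (b.simplex a.2)) :=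
  ofFree_single b a

theorem freeEquiv_smul (γ : Deck p) (x : FreeOn (Deck p) (SimplexOf K q)) :
    freeEquiv hp b (FreeOn.smul γ x) = deckMap γ q (freeEquiv hp b x) := by
  suffices (freeEquiv hp b).toLinearMap ∘ₗ FreeOn.smul γ
      = deckMap γ q ∘ₗ (freeEquiv hp b).toLinearMap from LinearMap.congr_fun this x
  refine FreeOn.hom_ext fun a => ?_
  simp only [LinearMap.comp_apply, LinearEquiv.coe_coe]
  rw [FreeOn.smul_single, freeEquiv_single, freeEquiv_single, deckMap_of, deckSmul_mul]

theorem freeEquiv_symm_smul (γ : Deck p) (c : Chain (liftedComplex K (toAmbient p)) q) :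
    (freeEquiv hp b).symm (deckMap γ q c) = FreeOn.smul γ ((freeEquiv hp b).symm c) := by
  rw [LinearEquiv.symm_apply_eq, freeEquiv_smul, LinearEquiv.apply_symm_apply]

/-- An endomorphism of `C_q(K̃)` in coordinates. -/
def inCoords {r : ℕ} (b' : SimplexLifts K p r)
    (h : Chain (liftedComplex K (toAmbient p)) q →ₗ[ℤ] Chain (liftedComplex K (toAmbient p)) r) :
    FreeOn (Deck p) (SimplexOf K q) →ₗ[ℤ] FreeOn (Deck p) (SimplexOf K r) :=
  (freeEquiv hp b').symm.toLinearMap ∘ₗ h ∘ₗ (freeEquiv hp b).toLinearMap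

theorem coeff_groupRingCoeff (s : SimplexOf K q)
    (c : Chain (liftedComplex K (toAmbient p)) q) :
    (groupRingCoeff hp (b.simplex s) (b.injective s) c).coeff
      = FreeOn.coord s ((freeEquiv hp b).symm c) := by
  classical
  obtain ⟨x, rfl⟩ := (freeEquiv hp b).surjective c
  rw [LinearEquiv.symm_apply_apply]
  ext γ
  have h1 : (groupRingCoeff hp (b.simplex s) (b.injective s) (freeEquiv hp b x)).coeff γ
      = x (γ, s) := coeff_ofFree hp b γ s x
  rw [h1]
  suffices Finsupp.lapply (γ, s) = Finsupp.lapply γ ∘ₗ FreeOn.coord (π := Deck p) s from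
    LinearMap.congr_fun this x
  refine FreeOn.hom_ext fun a => ?_
  rw [LinearMap.comp_apply, FreeOn.coord, Finsupp.linearCombination_single, one_smul,
    Finsupp.lapply_apply, Finsupp.lapply_apply, Finsupp.single_apply]
  obtain ⟨δ, t⟩ := a
  by_cases ht : t = s
  · subst ht
    simp [Finsupp.single_apply]
  · simp [ht]

theorem sum_rho_trace {n : ℕ} (Φ : Deck p →* Wreath (Deck p) n)
    (A : Fin n → Chain (liftedComplex K (toAmbient p)) q →ₗ[ℤ]
      Chain (liftedComplex K (toAmbient p)) q) :
    ∑ k, rho Φ (timesLabel (NValued.trace hp b (A k)) k)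
      = FreeOn.tr Φ (fun k => inCoords hp b b (A k)) := by
  refine Finset.sum_congr rfl fun k _ => ?_
  rw [timesLabel, NValued.trace, MonoidAlgebra.coeff_sum, Finsupp.mapDomain_finsetSum, map_sum]
  refine Finset.sum_congr rfl fun s _ => ?_
  rw [coeff_groupRingCoeff]
  simp only [inCoords, LinearMap.comp_apply, LinearEquiv.coe_coe, freeEquiv_single]
  have h1 : deckSmul (1 : Deck p) (b.simplex s) = b.simplex s :=
    Subtype.ext (funext fun i => one_smul _ _)
  rw [h1, FreeOn.classes, LinearMap.comp_apply, Finsupp.lmapDomain_apply, rho]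
  change Finsupp.mapDomain _ (Finsupp.mapDomain _ _) = _
  rw [← Finsupp.mapDomain_comp]
  simp only [mul_one]
  rfl

theorem inCoords_smul {r : ℕ} (b' : SimplexLifts K p r) {γ δ : Deck p}
    {h h' : Chain (liftedComplex K (toAmbient p)) q →ₗ[ℤ] Chain (liftedComplex K (toAmbient p)) r}
    (hh : ∀ c, h (deckMap γ q c) = deckMap δ r (h' c)) (x : FreeOn (Deck p) (SimplexOf K q)) :
    inCoords hp b b' h (FreeOn.smul γ x) = FreeOn.smul δ (inCoords hp b b' h' x) := by
  simp only [inCoords, LinearMap.comp_apply, LinearEquiv.coe_coe]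
  rw [freeEquiv_smul, hh, freeEquiv_symm_smul]

theorem inCoords_comp {r t : ℕ} (b' : SimplexLifts K p r) (b'' : SimplexLifts K p t)
    (h : Chain (liftedComplex K (toAmbient p)) q →ₗ[ℤ] Chain (liftedComplex K (toAmbient p)) r)
    (h' : Chain (liftedComplex K (toAmbient p)) r →ₗ[ℤ] Chain (liftedComplex K (toAmbient p)) t) :
    inCoords hp b b'' (h' ∘ₗ h) = inCoords hp b' b'' h' ∘ₗ inCoords hp b b' h := by
  refine LinearMap.ext fun x => ?_
  simp [inCoords]

/-- Chain homotopic families have the same alternating sum of Reidemeister traces, if the homotopy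
is equivariant with the twist `Φ`. By the trace property, the traces of `∂ D` in degree `q` and of
`D ∂` in degree `q + 1` cancel; in degree `d + 1` there are no simplices. -/
theorem sum_rho_trace_eq_of_homotopy {n : ℕ} (Φ : Deck p →* Wreath (Deck p) n) {d : ℕ}
    (hd : HasDim K d) (b : ∀ q, SimplexLifts K p q)
    (A A' : ∀ q, Fin n → Chain (liftedComplex K (toAmbient p)) q →ₗ[ℤ]
      Chain (liftedComplex K (toAmbient p)) q)
    (D : ∀ q, Fin n → Chain (liftedComplex K (toAmbient p)) q →ₗ[ℤ]
      Chain (liftedComplex K (toAmbient p)) (q + 1))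
    (hD : ∀ q k γ c, D q k (deckMap γ q c)
      = deckMap ((Φ γ).left k) (q + 1) (D q ((Φ γ).right⁻¹ k) c))
    (h₀ : ∀ k, A' 0 k = A 0 k + bdry _ 0 ∘ₗ D 0 k)
    (h₁ : ∀ q k, A' (q + 1) k = A (q + 1) k + bdry _ (q + 1) ∘ₗ D (q + 1) k
      + D q k ∘ₗ bdry _ q) :
    ∑ q ∈ Finset.range (d + 1), ∑ k : Fin n,
        (-1 : ℤ) ^ q • rho Φ (timesLabel (NValued.trace hp (b q) (A q k)) k) =
      ∑ q ∈ Finset.range (d + 1), ∑ k : Fin n,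
        (-1 : ℤ) ^ q • rho Φ (timesLabel (NValued.trace hp (b q) (A' q k)) k) := by
  simp only [← Finset.smul_sum, sum_rho_trace hp]
  set u : ℕ → (ReidemeisterSet Φ →₀ ℤ) := fun q =>
    FreeOn.tr Φ (fun k => inCoords hp (b q) (b q) (bdry _ q ∘ₗ D q k)) with hu
  have hu' : ∀ q, u q
      = FreeOn.tr Φ (fun k => inCoords hp (b (q + 1)) (b (q + 1)) (D q k ∘ₗ bdry _ q)) := by
    intro q
    simp only [hu, inCoords_comp hp (b q) (b (q + 1)), inCoords_comp hp (b (q + 1)) (b q)]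
    refine FreeOn.tr_comp Φ _ (fun γ x => inCoords_smul hp _ _ (fun c => ?_) x) _
      (fun γ k x => inCoords_smul hp _ _ (hD q k γ) x)
    exact bdry_chainMap _ c
  have hadd : ∀ q (B B' : Fin n → Chain (liftedComplex K (toAmbient p)) q →ₗ[ℤ]
      Chain (liftedComplex K (toAmbient p)) q),
      FreeOn.tr Φ (fun k => inCoords hp (b q) (b q) (B k + B' k))
        = FreeOn.tr Φ (fun k => inCoords hp (b q) (b q) (B k))
          + FreeOn.tr Φ (fun k => inCoords hp (b q) (b q) (B' k)) := by
    intro q B B'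
    simp only [FreeOn.tr, inCoords, ← Finset.sum_add_distrib, ← map_add, LinearMap.comp_apply,
      LinearMap.add_apply]
  have hsum : ∀ m, ∑ q ∈ Finset.range (m + 1), (-1 : ℤ) ^ q •
      FreeOn.tr Φ (fun k => inCoords hp (b q) (b q) (A' q k))
      = ∑ q ∈ Finset.range (m + 1), (-1 : ℤ) ^ q •
        FreeOn.tr Φ (fun k => inCoords hp (b q) (b q) (A q k)) + (-1 : ℤ) ^ m • u m := by
    intro m
    induction m with
    | zero => simp only [zero_add, Finset.sum_range_one, h₀, hadd, hu, pow_zero, one_smul]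
    | succ m ih =>
      rw [Finset.sum_range_succ, ih, Finset.sum_range_succ _ (m + 1)]
      simp only [h₁, hadd]
      rw [← hu', pow_succ]
      simp only [mul_neg, mul_one, neg_smul, smul_add, hu]
      abel
  have hempty : IsEmpty (SimplexOf K (d + 1)) :=
    ⟨fun s => by have := hd.2 ⟨s.1, s.2.1, s.2.2⟩; omega⟩
  rw [hsum d, hu' d]
  simp [FreeOn.tr]

end DeckAction

/-! ### Carriers in simplicial complexes -/

section Carrier

open Geometry

variable {E : Type*} [AddCommGroup E] [Module ℝ E] {K K' : SimplicialComplex ℝ E}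

theorem weights_eq {s : Finset E} (hs : AffineIndependent ℝ ((↑) : s → E)) {w w' : E → ℝ}
    (hw : ∑ v ∈ s, w v = 1) (hw' : ∑ v ∈ s, w' v = 1)
    (h : ∑ v ∈ s, w v • v = ∑ v ∈ s, w' v • v) {v : E} (hv : v ∈ s) : w v = w' v := by
  have key := affineIndependent_iff.mp hs Finset.univ (fun v => w v - w' v)
    (by
      rw [Finset.univ_eq_attach, Finset.sum_attach s fun v => w v - w' v, Finset.sum_sub_distrib,
        hw, hw', sub_self])
    (by
      rw [Finset.univ_eq_attach, Finset.sum_attach s fun v => (w v - w' v) • v]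
      simp only [sub_smul, Finset.sum_sub_distrib, h, sub_self])
    ⟨v, hv⟩ (Finset.mem_univ _)
  exact sub_eq_zero.mp key

/-- A convex combination lying in a face of a simplex has no weight outside of the face. -/
theorem weight_eq_zero {s u : Finset E} (hs : AffineIndependent ℝ ((↑) : s → E)) (hu : u ⊆ s)
    {w : E → ℝ} (hw : ∑ v ∈ s, w v = 1) (h : ∑ v ∈ s, w v • v ∈ convexHull ℝ (u : Set E)) {v : E}
    (hv : v ∈ s) (hvu : v ∉ u) : w v = 0 := by
  classical
  obtain ⟨w', -, hw'1, hw'2⟩ := Finset.mem_convexHull'.mp h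
  have := weights_eq hs (w := w) (w' := fun v => if v ∈ u then w' v else 0) hw
    (by rw [Finset.sum_ite_mem, Finset.inter_eq_right.mpr hu, hw'1])
    (by
      simp only [ite_smul, zero_smul]
      rw [Finset.sum_ite_mem, Finset.inter_eq_right.mpr hu, hw'2])
    hv
  rw [this, if_neg hvu]

/-- A point in the relative interior of a face lies in no other faces than those containing it. -/
theorem subset_of_pos {s s' : Finset E} (hs : s ∈ K.faces) (hs' : s' ∈ K.faces) {w : E → ℝ}
    (hw : ∑ v ∈ s, w v = 1) (hpos : ∀ v ∈ s, 0 < w v)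
    (h : ∑ v ∈ s, w v • v ∈ convexHull ℝ (s' : Set E)) : s ⊆ s' := by
  classical
  have hmem : ∑ v ∈ s, w v • v ∈ convexHull ℝ (s : Set E) :=
    Finset.mem_convexHull'.mpr ⟨w, fun v hv => (hpos v hv).le, hw, rfl⟩
  have h1 := K.inter_subset_convexHull hs hs' ⟨hmem, h⟩
  rw [← Finset.coe_inter] at h1
  intro v hv
  by_contra hvs'
  exact (hpos v hv).ne' (weight_eq_zero (K.indep hs) Finset.inter_subset_left hw h1 hv
    fun hm => hvs' (Finset.mem_inter.mp hm).2)

/-- Every point of a polyhedron lies in a smallest face. -/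
theorem exists_carrier {x : E} (hx : x ∈ K.space) : ∃ s ∈ K.faces,
    x ∈ convexHull ℝ (s : Set E) ∧ ∀ s' ∈ K.faces, x ∈ convexHull ℝ (s' : Set E) → s ⊆ s' := by
  classical
  obtain ⟨s₀, hs₀, hx₀⟩ := SimplicialComplex.mem_space_iff.mp hx
  obtain ⟨s, ⟨hs, hxs⟩, hmin⟩ := (measure (Finset.card (α := E))).wf.has_min
    {s | s ∈ K.faces ∧ x ∈ convexHull ℝ (s : Set E)} ⟨s₀, hs₀, hx₀⟩
  refine ⟨s, hs, hxs, fun s' hs' hxs' => ?_⟩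
  have h1 := K.inter_subset_convexHull hs hs' ⟨hxs, hxs'⟩
  rw [← Finset.coe_inter] at h1
  have hne : (s ∩ s').Nonempty := by
    rw [← Finset.coe_nonempty, ← convexHull_nonempty_iff (𝕜 := ℝ)]
    exact ⟨x, h1⟩
  by_contra hsub
  refine hmin (s ∩ s') ⟨K.down_closed hs Finset.inter_subset_left hne, h1⟩
    (Finset.card_lt_card ⟨Finset.inter_subset_left, fun h => hsub fun v hv => ?_⟩)
  exact (Finset.mem_inter.mp (h hv)).2

/-- The smallest face of a subdivision containing a point of a simplex lies in that simplex. -/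
theorem carrier_subset (hK : IsSubdivision K' K) {z : E} {r s : Finset E} (hr : r ∈ K'.faces)
    (hzr : z ∈ convexHull ℝ (r : Set E))
    (hmin : ∀ r' ∈ K'.faces, z ∈ convexHull ℝ (r' : Set E) → r ⊆ r') (hs : s ∈ K.faces)
    (hz : z ∈ convexHull ℝ (s : Set E)) : (r : Set E) ⊆ convexHull ℝ (s : Set E) := by
  classical
  obtain ⟨w, hw0, hw1, hwz⟩ := Finset.mem_convexHull'.mp hzr
  have hpos : ∀ v ∈ r, 0 < w v := by
    intro v hv
    refine (hw0 v hv).lt_of_ne fun h0 => ?_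
    have hz' : z ∈ convexHull ℝ ((r.erase v : Finset E) : Set E) := by
      refine Finset.mem_convexHull'.mpr ⟨w, fun y hy => hw0 y (Finset.mem_of_mem_erase hy), ?_, ?_⟩
      · rw [Finset.sum_erase _ h0.symm, hw1]
      · rw [Finset.sum_erase _ (by rw [← h0, zero_smul]), hwz]
    have hne : (r.erase v).Nonempty := by
      rw [← Finset.coe_nonempty, ← convexHull_nonempty_iff (𝕜 := ℝ)]
      exact ⟨z, hz'⟩
    exact Finset.notMem_erase v r
      (hmin _ (K'.down_closed hr (Finset.erase_subset _ _) hne) hz' hv)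
  obtain ⟨σ, hσ, hrσ⟩ := hK.subset r hr
  have hzσ : z ∈ convexHull ℝ (σ : Set E) := convexHull_min hrσ (convex_convexHull ℝ _) hzr
  have hz1 := K.inter_subset_convexHull hσ hs ⟨hzσ, hz⟩
  rw [← Finset.coe_inter] at hz1
  choose! c hc0 hc1 hc2 using fun v (hv : v ∈ r) => Finset.mem_convexHull'.mp (hrσ hv)
  have hsum1 : ∑ u ∈ σ, ∑ v ∈ r, w v * c v u = 1 := by
    rw [Finset.sum_comm, ← hw1]
    refine Finset.sum_congr rfl fun v hv => ?_
    rw [← Finset.mul_sum, hc1 v hv, mul_one]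
  have hsum2 : ∑ u ∈ σ, (∑ v ∈ r, w v * c v u) • u = z := by
    simp only [Finset.sum_smul]
    rw [Finset.sum_comm, ← hwz]
    refine Finset.sum_congr rfl fun v hv => ?_
    simp only [mul_smul]
    rw [← Finset.smul_sum, hc2 v hv]
  rw [← hsum2] at hz1
  intro v hv
  have hzero : ∀ u ∈ σ, u ∉ σ ∩ s → c v u = 0 := by
    intro u hu hus
    have h0 := weight_eq_zero (K.indep hσ) Finset.inter_subset_left hsum1 hz1 hu hus
    have := (Finset.sum_eq_zero_iff_of_nonneg
      fun v hv => mul_nonneg (hw0 v hv) (hc0 v hv u hu)).mp h0 v hv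
    exact (mul_eq_zero.mp this).resolve_left (hpos v hv).ne'
  refine convexHull_mono (Finset.coe_subset.mpr (Finset.inter_subset_right (s₁ := σ)))
    (Finset.mem_convexHull'.mpr ⟨c v, fun u hu =>
      hc0 v hv u (Finset.mem_inter.mp hu).1, ?_, ?_⟩)
  · rw [Finset.sum_subset Finset.inter_subset_left hzero, hc1 v hv]
  · rw [Finset.sum_subset Finset.inter_subset_left
      fun u hu hus => by rw [hzero u hu hus, zero_smul], hc2 v hv]

end Carrier

/-! ### Affine coordinates -/

section AffineCoord

variable {E : Type*} [AddCommGroup E] [Module ℝ E] {q : ℕ} {b : Fin (q + 1) → E}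

theorem affineCoord_eq (hb : AffineIndependent ℝ b) {c : Fin (q + 1) → ℝ} (hc : ∑ i, c i = 1)
    {x : E} (hx : ∑ i, c i • b i = x) : affineCoord b x = c := by
  have h : ∃ c : Fin (q + 1) → ℝ, ∑ i, c i = 1 ∧ ∑ i, c i • b i = x := ⟨c, hc, hx⟩
  rw [affineCoord, dif_pos h]
  obtain ⟨h1, h2⟩ := h.choose_spec
  refine (affineIndependent_iff_eq_of_fintype_affineCombination_eq ℝ b).mp hb _ _ h1 hc ?_
  rw [Finset.affineCombination_eq_linear_combination _ _ _ h1,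
    Finset.affineCombination_eq_linear_combination _ _ _ hc, hx, h2]

theorem mem_convexHull_range {x : E} (hx : x ∈ convexHull ℝ (Set.range b)) :
    ∃ c : Fin (q + 1) → ℝ, (∀ i, 0 ≤ c i) ∧ ∑ i, c i = 1 ∧ ∑ i, c i • b i = x := by
  rw [convexHull_range_eq_exists_affineCombination] at hx
  obtain ⟨s, w, h0, h1, h2⟩ := hx
  classical
  refine ⟨fun i => if i ∈ s then w i else 0, fun i => ?_, ?_, ?_⟩
  · dsimp only
    split_ifs with h
    · exact h0 i h
    · exact le_rfl
  · rw [Finset.sum_ite_mem, Finset.univ_inter, h1]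
  · rw [Finset.affineCombination_eq_linear_combination _ _ _ h1] at h2
    simp only [ite_smul, zero_smul]
    rw [Finset.sum_ite_mem, Finset.univ_inter, h2]

variable (hb : AffineIndependent ℝ b)
include hb

theorem affineCoord_nonneg {x : E} (hx : x ∈ convexHull ℝ (Set.range b)) (i : Fin (q + 1)) :
    0 ≤ affineCoord b x i := by
  obtain ⟨c, h0, h1, h2⟩ := mem_convexHull_range hx
  rw [affineCoord_eq hb h1 h2]
  exact h0 i

theorem sum_affineCoord {x : E} (hx : x ∈ convexHull ℝ (Set.range b)) :
    ∑ i, affineCoord b x i = 1 := by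
  obtain ⟨c, h0, h1, h2⟩ := mem_convexHull_range hx
  rw [affineCoord_eq hb h1 h2, h1]

theorem sum_affineCoord_smul {x : E} (hx : x ∈ convexHull ℝ (Set.range b)) :
    ∑ i, affineCoord b x i • b i = x := by
  obtain ⟨c, h0, h1, h2⟩ := mem_convexHull_range hx
  rw [affineCoord_eq hb h1 h2, h2]

theorem affineCoord_self (i : Fin (q + 1)) : affineCoord b (b i) = Pi.single i 1 :=
  affineCoord_eq hb (by simp) (by simp [Pi.single_apply])

theorem affineCoord_sum {ι : Type*} (s : Finset ι) (w : ι → ℝ) (hw : ∑ j ∈ s, w j = 1) (y : ι → E)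
    (hy : ∀ j ∈ s, y j ∈ convexHull ℝ (Set.range b)) :
    affineCoord b (∑ j ∈ s, w j • y j) = ∑ j ∈ s, w j • affineCoord b (y j) := by
  refine affineCoord_eq hb ?_ ?_
  · simp only [Finset.sum_apply, Pi.smul_apply, smul_eq_mul]
    rw [Finset.sum_comm, ← hw]
    refine Finset.sum_congr rfl fun j hj => ?_
    rw [← Finset.mul_sum, sum_affineCoord hb (hy j hj), mul_one]
  · simp only [Finset.sum_apply, Pi.smul_apply, smul_eq_mul, Finset.sum_smul, mul_smul]
    rw [Finset.sum_comm]
    refine Finset.sum_congr rfl fun j hj => ?_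
    rw [← Finset.smul_sum, sum_affineCoord_smul hb (hy j hj)]

omit hb in
theorem orientSign_comp_perm (b w : Fin (q + 1) → E) (σ : Equiv.Perm (Fin (q + 1))) :
    orientSign b (w ∘ σ) = (Equiv.Perm.sign σ : ℤ) * orientSign b w := by
  have h : (Matrix.of fun i j => affineCoord b ((w ∘ σ) j) i)
      = (Matrix.of fun i j => affineCoord b (w j) i).submatrix id σ := by
    ext i j
    simp
  rw [orientSign, orientSign, h, Matrix.det_permute', sign_mul]
  rcases Int.units_eq_one_or (Equiv.Perm.sign σ) with h | h <;> simp [h]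

omit hb in
/-- A point of a simplex lies in the facet opposite to `b i` iff its `i`-th coordinate vanishes. -/
theorem mem_facet_iff {q : ℕ} {b : Fin (q + 2) → E} (hb : AffineIndependent ℝ b) {x : E}
    (hx : x ∈ convexHull ℝ (Set.range b)) (i : Fin (q + 2)) :
    x ∈ convexHull ℝ (Set.range (b ∘ i.succAbove)) ↔ affineCoord b x i = 0 := by
  constructor
  · intro h
    obtain ⟨c, h0, h1, h2⟩ := mem_convexHull_range h
    rw [affineCoord_eq hb (c := i.insertNth 0 c) (by rw [Fin.sum_univ_succAbove _ i]; simpa)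
      (by rw [Fin.sum_univ_succAbove _ i]; simpa using h2)]
    simp
  · intro h
    have h1 := sum_affineCoord hb hx
    have h2 := sum_affineCoord_smul hb hx
    rw [Fin.sum_univ_succAbove _ i, h, zero_add] at h1
    rw [Fin.sum_univ_succAbove _ i, h, zero_smul, zero_add] at h2
    rw [← h2]
    exact (convex_convexHull ℝ _).sum_mem (fun j _ => affineCoord_nonneg hb hx _) h1
      (fun j _ => subset_convexHull ℝ _ ⟨j, rfl⟩)

omit hb in
theorem affineCoord_facet {q : ℕ} {b : Fin (q + 2) → E} (hb : AffineIndependent ℝ b) {x : E}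
    (hx : x ∈ convexHull ℝ (Set.range b)) (i : Fin (q + 2)) (h : affineCoord b x i = 0) :
    affineCoord (b ∘ i.succAbove) x = affineCoord b x ∘ i.succAbove := by
  have h1 := sum_affineCoord hb hx
  have h2 := sum_affineCoord_smul hb hx
  rw [Fin.sum_univ_succAbove _ i, h, zero_add] at h1
  rw [Fin.sum_univ_succAbove _ i, h, zero_smul, zero_add] at h2
  exact affineCoord_eq (hb.comp_embedding i.succAboveEmb) h1 h2

end AffineCoord

/-! ### The two sides of a simplex of codimension one -/

section Side

variable {E : Type*} [NormedAddCommGroup E] [NormedSpace ℝ E] {q : ℕ}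

/-- The `j`-th coefficient of the linear form `side`: a signed maximal minor of the coordinates of
the points `T` with respect to `b`. -/
def sideCoef (b : Fin (q + 2) → E) (T : Fin (q + 1) → E) (j : Fin (q + 2)) : ℝ :=
  (-1) ^ (j : ℕ) * Matrix.det (Matrix.of fun i k => affineCoord b (T i) (j.succAbove k))

/-- The linear form in the coordinates with respect to `b` that vanishes on the points `T`; its sign
tells on which side of `T` a point lies. -/
def side (b : Fin (q + 2) → E) (T : Fin (q + 1) → E) (c : Fin (q + 2) → ℝ) : ℝ :=
  ∑ j, c j * sideCoef b T j

theorem side_eq_det (b : Fin (q + 2) → E) (T : Fin (q + 1) → E) (c : Fin (q + 2) → ℝ) :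
    side b T c = Matrix.det (Matrix.of
      (Fin.cons c fun i => affineCoord b (T i) : Fin (q + 2) → Fin (q + 2) → ℝ)) := by
  rw [Matrix.det_succ_row_zero, side]
  refine Finset.sum_congr rfl fun j _ => ?_
  rw [sideCoef]
  have : (Matrix.of (Fin.cons c fun i => affineCoord b (T i) :
      Fin (q + 2) → Fin (q + 2) → ℝ)).submatrix Fin.succ j.succAbove
      = Matrix.of fun i k => affineCoord b (T i) (j.succAbove k) := by
    ext i k
    simp
  rw [this]
  simp
  ring

theorem side_self (b : Fin (q + 2) → E) (T : Fin (q + 1) → E) (i : Fin (q + 1)) :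
    side b T (affineCoord b (T i)) = 0 := by
  rw [side_eq_det]
  refine Matrix.det_zero_of_row_eq (i := 0) (j := i.succ) (Fin.succ_ne_zero i).symm rfl

theorem side_single (b : Fin (q + 2) → E) (T : Fin (q + 1) → E) (j : Fin (q + 2)) :
    side b T (Pi.single j 1) = sideCoef b T j := by
  simp [side, Pi.single_apply]

theorem side_sum (b : Fin (q + 2) → E) (T : Fin (q + 1) → E) {ι : Type*} (s : Finset ι) (w : ι → ℝ)
    (c : ι → Fin (q + 2) → ℝ) : side b T (∑ i ∈ s, w i • c i) = ∑ i ∈ s, w i * side b T (c i) := by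
  simp only [side, Finset.sum_apply, Pi.smul_apply, smul_eq_mul, Finset.sum_mul, Finset.mul_sum]
  rw [Finset.sum_comm]
  simp only [mul_assoc]

/-- The orientation of a simplex with facet `T` is the side of `T` on which its first vertex `y`
lies. -/
theorem orientSign_cons (b : Fin (q + 2) → E) (T : Fin (q + 1) → E) (y : E) :
    orientSign b (Fin.cons y T : Fin (q + 2) → E)
      = (SignType.sign (side b T (affineCoord b y)) : ℤ) := by
  rw [orientSign, side_eq_det, ← Matrix.det_transpose]
  congr 3
  ext i j
  refine Fin.cases rfl (fun i => rfl) i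

/-- When `T` lies in the facet opposite to `b i`, the side of `T` containing `b i` is determined by
the orientation of `T` relative to that facet. -/
theorem sideCoef_facet {b : Fin (q + 2) → E} (hb : AffineIndependent ℝ b) {T : Fin (q + 1) → E}
    (hT : ∀ k, T k ∈ convexHull ℝ (Set.range b)) {i : Fin (q + 2)}
    (h : ∀ k, affineCoord b (T k) i = 0) :
    (-1) ^ (i : ℕ) * orientSign (b ∘ i.succAbove) T = (SignType.sign (sideCoef b T i) : ℤ) := by
  have e : (Matrix.of fun j k => affineCoord (b ∘ i.succAbove) (T k) j)
      = (Matrix.of fun k j => affineCoord b (T k) (i.succAbove j)).transpose := by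
    ext j k
    simp [affineCoord_facet hb (hT k) i (h k)]
  rw [sideCoef, orientSign, e, Matrix.det_transpose, sign_mul]
  rcases neg_one_pow_eq_or ℝ (i : ℕ) with hi | hi
  · have hi' : (-1 : ℤ) ^ (i : ℕ) = 1 := by exact_mod_cast hi
    rw [hi, hi']
    simp
  · have hi' : (-1 : ℤ) ^ (i : ℕ) = -1 := by exact_mod_cast hi
    rw [hi, hi']
    simp

theorem sideCoef_eq_zero {b : Fin (q + 2) → E} {T : Fin (q + 1) → E} {i j : Fin (q + 2)}
    (hij : j ≠ i) (h : ∀ k, affineCoord b (T k) i = 0) : sideCoef b T j = 0 := by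
  obtain ⟨k, hk⟩ := Fin.exists_succAbove_eq hij.symm
  rw [sideCoef, Matrix.det_eq_zero_of_column_eq_zero k, mul_zero]
  intro m
  rw [Matrix.of_apply, hk, h]

variable {K K' : Geometry.SimplicialComplex ℝ E} [Finite K'.faces] {s t : Finset E}
  {b : Fin (q + 2) → E} {T : Fin (q + 1) → E}

theorem mem_of_range {E : Type*} {T : Fin (q + 1) → E} {t : Finset E} (hT : Set.range T = t)
    (i : Fin (q + 1)) : T i ∈ t := by
  rw [← Finset.mem_coe, ← hT]
  exact ⟨i, rfl⟩

theorem sum_of_range {E : Type*} {T : Fin (q + 1) → E} {t : Finset E}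
    (hTi : Function.Injective T) (hT : Set.range T = t) {M : Type*} [AddCommMonoid M] (φ : E → M) :
    ∑ i, φ (T i) = ∑ v ∈ t, φ v := by
  classical
  have : t = Finset.univ.image T := by
    rw [← Finset.coe_inj, ← hT, Finset.coe_image, Finset.coe_univ, Set.image_univ]
  rw [this, Finset.sum_image hTi.injOn]

/-- If a vertex of a simplex lies on one side of a codimension-one simplex of the subdivision, then
so does a neighbouring simplex of the subdivision: move a little from the barycentre towards the
vertex. -/
theorem exists_vertex_on_side [DecidableEq E] (hK : IsSubdivision K' K) (hb : AffineIndependent ℝ b)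
    (hs : s ∈ K.faces) (hsb : (s : Set E) = Set.range b) (ht : t ∈ K'.faces)
    (hTi : Function.Injective T) (hT : Set.range T = t)
    (htb : (t : Set E) ⊆ convexHull ℝ (Set.range b)) {ε : ℝ} {j : Fin (q + 2)}
    (hj : 0 < ε * sideCoef b T j) : ∃ y, y ∉ t ∧ insert y t ∈ K'.faces ∧
      ((insert y t : Finset E) : Set E) ⊆ convexHull ℝ (Set.range b) ∧
        0 < ε * side b T (affineCoord b y) := by
  have hmemb : ∀ i, T i ∈ convexHull ℝ (Set.range b) := fun i => htb (mem_of_range hT i)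
  have hq : (0 : ℝ) < q + 1 := by positivity
  set x : E := ∑ i, ((q : ℝ) + 1)⁻¹ • T i with hx
  have hw : ∑ i : Fin (q + 1), ((q : ℝ) + 1)⁻¹ = 1 := by
    simp [hq.ne']
  have hxb : x ∈ convexHull ℝ (Set.range b) :=
    (convex_convexHull ℝ _).sum_mem (fun _ _ => by positivity) hw fun i _ => hmemb i
  have hxside : side b T (affineCoord b x) = 0 := by
    rw [hx, affineCoord_sum hb _ (fun _ => _) hw _ fun i _ => hmemb i,
      side_sum b T _ (fun _ => ((q : ℝ) + 1)⁻¹)]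
    simp [side_self]
  have hxt : ∀ r ∈ K'.faces, x ∈ convexHull ℝ (r : Set E) → t ⊆ r := by
    intro r hr hxr
    refine subset_of_pos (w := fun _ => ((q : ℝ) + 1)⁻¹) ht hr ?_ (fun _ _ => by positivity) ?_
    · rw [← sum_of_range hTi hT fun _ => ((q : ℝ) + 1)⁻¹, hw]
    · rwa [← sum_of_range hTi hT fun v => ((q : ℝ) + 1)⁻¹ • v]
  -- the closed simplices of the subdivision missing the barycentre stay away from it
  let B : Set E := ⋃ r ∈ {r ∈ K'.faces | x ∉ convexHull ℝ (r : Set E)}, convexHull ℝ (r : Set E)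
  have hB : IsClosed B := by
    refine Set.Finite.isClosed_biUnion ((Set.toFinite K'.faces).subset (Set.sep_subset _ _)) ?_
    intro r _
    exact (r.finite_toSet.isCompact_convexHull ℝ).isClosed
  have hxB : x ∉ B := by
    simp only [B, Set.mem_iUnion, not_exists]
    intro r hr
    exact hr.2
  let z : ℝ → E := fun δ => (1 - δ) • x + δ • b j
  have hz : Continuous z := by fun_prop
  have hnear : ∀ᶠ δ in nhds (0 : ℝ), z δ ∈ Bᶜ :=
    hz.continuousAt.eventually_mem (hB.isOpen_compl.mem_nhds (by simpa [z] using hxB))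
  obtain ⟨δ, hδB, hδ0, hδ1⟩ := ((hnear.filter_mono nhdsWithin_le_nhds).and
    (Ioo_mem_nhdsGT (zero_lt_one (α := ℝ)))).exists
  have hzb : z δ ∈ convexHull ℝ (Set.range b) :=
    (convex_convexHull ℝ _) hxb (subset_convexHull ℝ _ ⟨j, rfl⟩) (by linarith) hδ0.le (by ring)
  have hzside : side b T (affineCoord b (z δ)) = δ * sideCoef b T j := by
    have h2 := affineCoord_sum hb Finset.univ ![1 - δ, δ] (by simp) ![x, b j] (by
      intro i _
      fin_cases i
      · exact hxb
      · exact subset_convexHull ℝ _ ⟨j, rfl⟩)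
    simp only [Fin.sum_univ_two] at h2
    have h3 := side_sum b T Finset.univ ![1 - δ, δ] ![affineCoord b x, affineCoord b (b j)]
    simp only [Fin.sum_univ_two] at h3
    simp only [Matrix.cons_val_zero, Matrix.cons_val_one] at h2 h3
    change side b T (affineCoord b ((1 - δ) • x + δ • b j)) = _
    rw [h2, h3, hxside, affineCoord_self hb, side_single]
    ring
  have hzK : z δ ∈ K'.space := by
    rw [hK.space_eq]
    rw [← hsb] at hzb
    exact K.convexHull_subset_space hs hzb
  obtain ⟨r, hr, hzr, hmin⟩ := exists_carrier hzK
  have hrb : (r : Set E) ⊆ convexHull ℝ (Set.range b) := by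
    rw [← hsb]
    exact carrier_subset hK hr hzr hmin hs (hsb ▸ hzb)
  have hxr : x ∈ convexHull ℝ (r : Set E) := by
    by_contra hxr
    exact hδB (Set.mem_biUnion (x := r) ⟨hr, hxr⟩ hzr)
  have htr := hxt r hr hxr
  obtain ⟨w, hw0, hw1, hwz⟩ := Finset.mem_convexHull'.mp hzr
  obtain ⟨y, hyr, hy⟩ : ∃ y ∈ r, 0 < ε * side b T (affineCoord b y) := by
    by_contra! hcon
    have h1 : side b T (affineCoord b (z δ)) = ∑ v ∈ r, w v * side b T (affineCoord b v) := by
      rw [← hwz, affineCoord_sum hb r w hw1 (fun v => v) fun v hv => hrb hv, side_sum]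
    have h2 : ε * side b T (affineCoord b (z δ)) ≤ 0 := by
      rw [h1, Finset.mul_sum]
      refine Finset.sum_nonpos fun v hv => ?_
      rw [mul_left_comm]
      exact mul_nonpos_of_nonneg_of_nonpos (hw0 v hv) (hcon v hv)
    rw [hzside, mul_left_comm] at h2
    exact absurd (mul_pos hδ0 hj) (not_lt.mpr h2)
  have hins : insert y t ⊆ r := Finset.insert_subset hyr htr
  refine ⟨y, fun hyt => ?_, K'.down_closed hr hins (Finset.insert_nonempty _ _),
    (Finset.coe_subset.mpr hins).trans hrb, hy⟩
  rw [← Finset.mem_coe, ← hT] at hyt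
  obtain ⟨i, rfl⟩ := hyt
  rw [side_self, mul_zero] at hy
  exact lt_irrefl _ hy

omit [Finite K'.faces] in
/-- Two simplices of a complex which lie on the same side of a common codimension-one face
overlap, and so are equal. -/
theorem vertex_on_side_unique [DecidableEq E] (hb : AffineIndependent ℝ b)
    (hTi : Function.Injective T) (hT : Set.range T = t)
    (htb : (t : Set E) ⊆ convexHull ℝ (Set.range b)) {ε : ℝ} {y y' : E} (hyt : y ∉ t)
    (hy : insert y t ∈ K'.faces) (hy' : insert y' t ∈ K'.faces)
    (hyb : y ∈ convexHull ℝ (Set.range b)) (hy'b : y' ∈ convexHull ℝ (Set.range b))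
    (hpos : 0 < ε * side b T (affineCoord b y)) (hpos' : 0 < ε * side b T (affineCoord b y')) :
    y = y' := by
  have hmemb : ∀ i, T i ∈ convexHull ℝ (Set.range b) := fun i => htb (mem_of_range hT i)
  -- write `y'` as an affine combination of `y` and `T`
  let R : Fin (q + 2) → Fin (q + 2) → ℝ :=
    Fin.cons (affineCoord b y) fun i => affineCoord b (T i)
  let M : Matrix (Fin (q + 2)) (Fin (q + 2)) ℝ := Matrix.of R
  have hdet : M.det ≠ 0 := by
    rw [← side_eq_det]
    rintro h
    rw [h, mul_zero] at hpos
    exact lt_irrefl _ hpos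
  let c : Fin (q + 2) → ℝ := Matrix.vecMul (affineCoord b y') M⁻¹
  have hc : Matrix.vecMul c M = affineCoord b y' := by
    rw [Matrix.vecMul_vecMul, Matrix.nonsing_inv_mul _ hdet.isUnit, Matrix.vecMul_one]
  have hR0 : R 0 = affineCoord b y := rfl
  have hRs : ∀ i : Fin (q + 1), R i.succ = affineCoord b (T i) := fun i => rfl
  have hc' : affineCoord b y' = c 0 • affineCoord b y + ∑ i : Fin (q + 1), c i.succ •
      affineCoord b (T i) := by
    rw [← hc, Matrix.vecMul_eq_sum, Fin.sum_univ_succ]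
    rfl
  have hsum : c 0 + ∑ i : Fin (q + 1), c i.succ = 1 := by
    have h1 := sum_affineCoord hb hy'b
    rw [hc'] at h1
    simp only [Pi.add_apply, Finset.sum_apply, Pi.smul_apply, smul_eq_mul,
      Finset.sum_add_distrib] at h1
    rw [← Finset.mul_sum, sum_affineCoord hb hyb, Finset.sum_comm] at h1
    simp only [← Finset.mul_sum, sum_affineCoord hb (hmemb _), mul_one] at h1
    exact h1
  have hy'eq : y' = c 0 • y + ∑ i : Fin (q + 1), c i.succ • T i := by
    have h1 := sum_affineCoord_smul hb hy'b
    rw [hc'] at h1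
    simp only [Pi.add_apply, Finset.sum_apply, Pi.smul_apply, smul_eq_mul, add_smul,
      Finset.sum_add_distrib, Finset.sum_smul, mul_smul] at h1
    rw [← Finset.smul_sum, sum_affineCoord_smul hb hyb, Finset.sum_comm] at h1
    simp only [← Finset.smul_sum, sum_affineCoord_smul hb (hmemb _)] at h1
    exact h1.symm
  have hside : side b T (affineCoord b y') = c 0 * side b T (affineCoord b y) := by
    have e : affineCoord b y' = ∑ i, c i • R i := by
      rw [hc', Fin.sum_univ_succ (n := q + 1)]
      rfl
    rw [e, side_sum, Fin.sum_univ_succ (n := q + 1)]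
    simp only [hR0, hRs, side_self, mul_zero, Finset.sum_const_zero, add_zero]
  have hc0 : 0 < c 0 := by
    rw [hside, mul_left_comm] at hpos'
    exact pos_of_mul_pos_left hpos' hpos.le
  -- a point near the barycentre of `T`, on the way to `y'`
  have hq : (0 : ℝ) < q + 1 := by positivity
  obtain ⟨δ, hδpos, hδ0, hδ1⟩ : ∃ δ : ℝ,
      (∀ i : Fin (q + 1), 0 < (1 - δ) * ((q : ℝ) + 1)⁻¹ + δ * c i.succ) ∧ 0 < δ ∧ δ < 1 := by
    have hnear : ∀ᶠ δ in nhds (0 : ℝ),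
        ∀ i : Fin (q + 1), 0 < (1 - δ) * ((q : ℝ) + 1)⁻¹ + δ * c i.succ := by
      rw [Filter.eventually_all]
      intro i
      have hcont : Continuous fun δ : ℝ => (1 - δ) * ((q : ℝ) + 1)⁻¹ + δ * c i.succ := by fun_prop
      refine hcont.continuousAt.eventually_mem (Ioi_mem_nhds ?_)
      simp only [sub_zero, one_mul, zero_mul, add_zero]
      positivity
    exact ((hnear.filter_mono nhdsWithin_le_nhds).and
      (Ioo_mem_nhdsGT (zero_lt_one (α := ℝ)))).exists
  set z : E := (1 - δ) • (∑ i, ((q : ℝ) + 1)⁻¹ • T i) + δ • y' with hz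
  have hw : ∑ i : Fin (q + 1), ((q : ℝ) + 1)⁻¹ = 1 := by
    simp [hq.ne']
  have hzs' : z ∈ convexHull ℝ ((insert y' t : Finset E) : Set E) := by
    refine (convex_convexHull ℝ _) ((convex_convexHull ℝ _).sum_mem (fun _ _ => by positivity) hw
      fun i _ => subset_convexHull ℝ _ ?_) (subset_convexHull ℝ _ (by simp)) (by linarith) hδ0.le
      (by ring)
    exact Finset.mem_insert_of_mem (mem_of_range hT i)
  let w : Fin (q + 2) → ℝ :=
    Fin.cons (δ * c 0) fun i => (1 - δ) * ((q : ℝ) + 1)⁻¹ + δ * c i.succ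
  let v : Fin (q + 2) → E := Fin.cons y T
  have hwpos : ∀ i, 0 < w i := fun i => by
    refine Fin.cases ?_ (fun i => ?_) i
    · exact mul_pos hδ0 hc0
    · exact hδpos i
  have hv : Function.Injective v :=
    Fin.cons_injective_iff.mpr ⟨by rw [hT]; exact hyt, hTi⟩
  have hvr : Set.range v = (insert y t : Finset E) := by
    rw [Fin.range_cons, hT, Finset.coe_insert]
  have hwsum : ∑ i, w i = 1 := by
    rw [Fin.sum_univ_succ]
    simp only [w, Fin.cons_zero, Fin.cons_succ, Finset.sum_add_distrib]
    rw [← Finset.mul_sum, ← Finset.mul_sum, hw]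
    linear_combination δ * hsum
  have hwz : ∑ i, w i • v i = z := by
    rw [Fin.sum_univ_succ]
    simp only [w, v, hz, hy'eq, Fin.cons_zero, Fin.cons_succ, add_smul, Finset.sum_add_distrib,
      smul_add, Finset.smul_sum, smul_smul]
    abel
  let w' : E → ℝ := fun e => if h : ∃ i, v i = e then w h.choose else 0
  have hw' : ∀ i, w' (v i) = w i := by
    intro i
    have h : ∃ k, v k = v i := ⟨i, rfl⟩
    simp only [w', dif_pos h]
    rw [hv h.choose_spec]
  have hsub : insert y t ⊆ insert y' t := by
    refine subset_of_pos (w := w') hy hy' ?_ ?_ ?_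
    · rw [← sum_of_range hv hvr]
      simpa only [hw'] using hwsum
    · intro e he
      rw [← Finset.mem_coe, ← hvr] at he
      obtain ⟨i, rfl⟩ := he
      rw [hw']
      exact hwpos i
    · rw [← sum_of_range hv hvr fun e => w' e • e]
      simp only [hw', hwz]
      exact hzs'
  exact (Finset.mem_insert.mp (hsub (Finset.mem_insert_self y t))).resolve_right hyt

end Side

/-! ### The boundary of a subdivided simplex -/

section Subdivide

open ListChain

variable {E : Type*} [NormedAddCommGroup E] [NormedSpace ℝ E]
  {K K' : Geometry.SimplicialComplex ℝ E} [Finite K'.faces] {q : ℕ}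

theorem SimplexOf.order_injective {K : Geometry.SimplicialComplex ℝ E} (s : SimplexOf K q) :
    Function.Injective s.order :=
  Subtype.val_injective.comp (s.1.equivFinOfCardEq s.2.2).symm.injective

theorem SimplexOf.order_mem {K : Geometry.SimplicialComplex ℝ E} (s : SimplexOf K q)
    (i : Fin (q + 1)) : s.order i ∈ s.1 := mem_of_range s.range_order i

open scoped Classical in
/-- The sum of the `q`-simplices of `K'` contained in the simplex with vertices `b`, with the
orientation of `b`. -/
def subdivList (K' : Geometry.SimplicialComplex ℝ E) [Finite K'.faces] (q : ℕ)
    (b : Fin (q + 1) → E) : ListChain E :=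
  ∑ s : SimplexOf K' q, if (s.1 : Set E) ⊆ convexHull ℝ (Set.range b) then
    orientSign b s.order • of (List.ofFn s.order) else 0

open scoped Classical in
/-- The facet of a simplex of `K'` opposite to its `i`-th vertex. -/
def SimplexOf.facet (s : SimplexOf K' (q + 1)) (i : Fin (q + 2)) : SimplexOf K' q :=
  ⟨s.1.erase (s.order i), by
    have hc : (s.1.erase (s.order i)).card = q + 1 := by
      rw [Finset.card_erase_of_mem (s.order_mem i), s.2.2]
      rfl
    refine ⟨K'.down_closed s.2.1 (Finset.erase_subset _ _) ?_, hc⟩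
    rw [← Finset.card_pos, hc]
    exact Nat.succ_pos q⟩

omit [Finite K'.faces] in
theorem SimplexOf.insert_facet [DecidableEq E] (s : SimplexOf K' (q + 1)) (i : Fin (q + 2)) :
    insert (s.order i) (s.facet i).1 = s.1 := by
  convert Finset.insert_erase (s.order_mem i)
  simp only [SimplexOf.facet]
  congr
  exact Subsingleton.elim _ _

omit [Finite K'.faces] in
theorem SimplexOf.notMem_facet (s : SimplexOf K' (q + 1)) (i : Fin (q + 2)) :
    s.order i ∉ (s.facet i).1 := by
  simp [SimplexOf.facet]

omit [Finite K'.faces] in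
/-- Up to reordering, the `i`-th term of the boundary of an oriented simplex of `K'` is its facet,
oriented by putting the remaining vertex in front. -/
theorem orientSign_smul_face_sub_mem_alt (b : Fin (q + 2) → E) (s : SimplexOf K' (q + 1))
    (i : Fin (q + 2)) :
    orientSign b s.order • (-1 : ℤ) ^ (i : ℕ) • of (List.ofFn (s.order ∘ i.succAbove))
      - orientSign b (Fin.cons (s.order i) (s.facet i).order : Fin (q + 2) → E) •
        of (List.ofFn (s.facet i).order) ∈ alt E := by
  classical
  have hinj : Function.Injective (s.order ∘ i.succAbove) :=
    s.order_injective.comp i.succAbove_right_injective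
  have hrange : Set.range (s.order ∘ i.succAbove) = Set.range (s.facet i).order := by
    rw [SimplexOf.range_order, SimplexOf.facet, Finset.coe_erase, ← s.range_order, Set.range_comp,
      Fin.range_succAbove, ← Set.image_singleton, ← Set.image_univ, ← Set.image_sdiff
      s.order_injective, Set.compl_eq_univ_sdiff]
  let σ : Equiv.Perm (Fin (q + 1)) := (Equiv.ofInjective _ hinj).trans
    ((Equiv.setCongr hrange).trans (Equiv.ofInjective _ (s.facet i).order_injective).symm)
  have hσ : s.order ∘ i.succAbove = (s.facet i).order ∘ σ := by
    funext k
    exact (Equiv.apply_ofInjective_symm (s.facet i).order_injective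
      (Equiv.setCongr hrange (Equiv.ofInjective _ hinj k))).symm
  -- the vertex `i` is moved to the front by a cycle of length `i + 1`
  have h1 : (Fin.cons (s.order i) (s.order ∘ i.succAbove) : Fin (q + 2) → E)
      = s.order ∘ i.cycleRange.symm := by
    funext k
    refine Fin.cases ?_ (fun k => ?_) k <;> simp
  have h2 : orientSign b (Fin.cons (s.order i) (s.order ∘ i.succAbove) : Fin (q + 2) → E)
      = (-1 : ℤ) ^ (i : ℕ) * orientSign b s.order := by
    rw [h1, orientSign_comp_perm, Equiv.Perm.sign_symm, Fin.sign_cycleRange]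
    simp
  have h3 : (Fin.cons (s.order i) ((s.facet i).order ∘ σ) : Fin (q + 2) → E)
      = (Fin.cons (s.order i) (s.facet i).order : Fin (q + 2) → E) ∘
        Equiv.Perm.decomposeFin.symm (0, σ) := by
    funext k
    refine Fin.cases ?_ (fun k => ?_) k <;> simp
  have h4 : orientSign b (Fin.cons (s.order i) (s.order ∘ i.succAbove) : Fin (q + 2) → E)
      = (Equiv.Perm.sign σ : ℤ) *
        orientSign b (Fin.cons (s.order i) (s.facet i).order : Fin (q + 2) → E) := by
    rw [hσ, h3, orientSign_comp_perm]
    simp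
  rw [smul_smul, mul_comm, ← h2, h4, hσ]
  have h5 := (alt E).smul_mem ((Equiv.Perm.sign σ : ℤ) *
    orientSign b (Fin.cons (s.order i) (s.facet i).order : Fin (q + 2) → E))
    (ofFn_perm_sub_mem_alt (s.facet i).order σ)
  convert h5 using 1
  rw [smul_sub, smul_smul, mul_right_comm]
  rcases Int.units_eq_one_or (Equiv.Perm.sign σ) with h | h <;> simp [h]

theorem sum_sign_eq {ι : Type*} (s : Finset ι) (c : ι → ℝ) :
    ∑ a ∈ s, (SignType.sign (c a) : ℤ)
      = ((s.filter fun a => 0 < 1 * c a).card : ℤ) - (s.filter fun a => 0 < -1 * c a).card := by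
  classical
  rw [Finset.card_filter, Finset.card_filter, Nat.cast_sum, Nat.cast_sum,
    ← Finset.sum_sub_distrib]
  refine Finset.sum_congr rfl fun a _ => ?_
  rcases lt_trichotomy (c a) 0 with h | h | h
  · simp [h, not_lt.mpr h.le]
  · simp [h]
  · simp [h, not_lt.mpr h.le]

/-- On each side of a codimension-one simplex `t` of the subdivision there is exactly one
neighbouring simplex, as long as the subdivided simplex has points on that side. -/
theorem card_side (hK : IsSubdivision K' K) {b : Fin (q + 2) → E} (hb : AffineIndependent ℝ b)
    {s₀ : Finset E} (hs₀ : s₀ ∈ K.faces) (hsb : (s₀ : Set E) = Set.range b) (t : SimplexOf K' q)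
    (htb : (t.1 : Set E) ⊆ convexHull ℝ (Set.range b)) (ε : ℝ)
    (A : Finset (SimplexOf K' (q + 1) × Fin (q + 2)))
    (hA : ∀ a, a ∈ A ↔ a.1.facet a.2 = t ∧ (a.1.1 : Set E) ⊆ convexHull ℝ (Set.range b) ∧
      0 < ε * side b t.order (affineCoord b (a.1.order a.2)))
    [Decidable (∃ j, 0 < ε * sideCoef b t.order j)] :
    A.card = if ∃ j, 0 < ε * sideCoef b t.order j then 1 else 0 := by
  classical
  split_ifs with hj
  · obtain ⟨j, hj⟩ := hj
    obtain ⟨y, hyt, hins, hyb, hy⟩ := exists_vertex_on_side hK hb hs₀ hsb t.2.1 t.order_injective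
      t.range_order htb hj
    let s : SimplexOf K' (q + 1) := ⟨insert y t.1, hins, by
      rw [Finset.card_insert_of_notMem hyt, t.2.2]⟩
    obtain ⟨i, hi⟩ : y ∈ Set.range s.order := by
      rw [s.range_order]
      exact Finset.mem_insert_self y t.1
    refine Finset.card_eq_one.mpr ⟨(s, i), ?_⟩
    ext a
    rw [hA, Finset.mem_singleton]
    constructor
    · rintro ⟨h1, h2, h3⟩
      have ha : insert (a.1.order a.2) t.1 = a.1.1 := by rw [← h1, a.1.insert_facet]
      have hnot : a.1.order a.2 ∉ t.1 := by
        rw [← h1]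
        exact a.1.notMem_facet a.2
      have hy' : a.1.order a.2 = y := vertex_on_side_unique (K' := K') hb t.order_injective
        t.range_order htb hnot (ha ▸ a.1.2.1) hins (h2 (a.1.order_mem a.2))
        (hyb (Finset.mem_insert_self y t.1)) h3 hy
      have hs : a.1 = s := Subtype.ext (by rw [← ha, hy'])
      obtain ⟨a1, a2⟩ := a
      dsimp only at hs hy'
      subst hs
      exact Prod.ext rfl (SimplexOf.order_injective _ (hy'.trans hi.symm))
    · rintro rfl
      refine ⟨Subtype.ext ?_, hyb, by rw [hi]; exact hy⟩
      simp only [SimplexOf.facet, hi, s]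
      exact Finset.erase_insert hyt
  · rw [Finset.card_eq_zero, Finset.eq_empty_iff_forall_notMem]
    rintro a ha
    obtain ⟨h1, h2, h3⟩ := (hA a).mp ha
    refine hj ?_
    by_contra! hcon
    refine absurd h3 (not_lt.mpr ?_)
    rw [side, Finset.mul_sum]
    refine Finset.sum_nonpos fun j _ => ?_
    rw [mul_left_comm]
    exact mul_nonpos_of_nonneg_of_nonpos (affineCoord_nonneg hb (h2 (a.1.order_mem a.2)) j)
      (hcon j)

omit [Finite K'.faces] in
open scoped Classical in
/-- The sides of `t` on which the simplex has vertices, counted with sign. If `t` lies in a facet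
of the simplex there is one such side only, which gives the orientation of `t` in the boundary;
otherwise both sides occur and cancel. -/
theorem sides_eq {b : Fin (q + 2) → E} (hb : AffineIndependent ℝ b) (t : SimplexOf K' q)
    (htb : (t.1 : Set E) ⊆ convexHull ℝ (Set.range b)) :
    ((if ∃ j, 0 < 1 * sideCoef b t.order j then 1 else 0 : ℤ)
      - if ∃ j, 0 < -1 * sideCoef b t.order j then 1 else 0)
      = ∑ i : Fin (q + 2), if (t.1 : Set E) ⊆ convexHull ℝ (Set.range (b ∘ i.succAbove)) then
        (-1 : ℤ) ^ (i : ℕ) * orientSign (b ∘ i.succAbove) t.order else 0 := by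
  have hmemb : ∀ k, t.order k ∈ convexHull ℝ (Set.range b) := fun k => htb (t.order_mem k)
  have hfacet : ∀ i : Fin (q + 2), (t.1 : Set E) ⊆ convexHull ℝ (Set.range (b ∘ i.succAbove)) ↔
      ∀ k, affineCoord b (t.order k) i = 0 := by
    intro i
    rw [← t.range_order, Set.range_subset_iff]
    exact forall_congr' fun k => mem_facet_iff hb (hmemb k) i
  have hterm : ∀ i : Fin (q + 2),
      (if (t.1 : Set E) ⊆ convexHull ℝ (Set.range (b ∘ i.succAbove)) then
        (-1 : ℤ) ^ (i : ℕ) * orientSign (b ∘ i.succAbove) t.order else 0)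
      = if ∀ k, affineCoord b (t.order k) i = 0 then
        (SignType.sign (sideCoef b t.order i) : ℤ) else 0 := by
    intro i
    simp only [hfacet i]
    split_ifs with h
    · exact sideCoef_facet hb hmemb h
    · rfl
  simp only [hterm]
  by_cases hi : ∃ i, ∀ k, affineCoord b (t.order k) i = 0
  · obtain ⟨i, hi⟩ := hi
    have hz : ∀ j, j ≠ i → sideCoef b t.order j = 0 := fun j hj => sideCoef_eq_zero hj hi
    have hex : ∀ ε : ℝ, (∃ j, 0 < ε * sideCoef b t.order j) ↔ 0 < ε * sideCoef b t.order i := by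
      intro ε
      refine ⟨fun ⟨j, hj⟩ => ?_, fun h => ⟨i, h⟩⟩
      by_cases hji : j = i
      · rwa [← hji]
      · rw [hz j hji, mul_zero] at hj
        exact absurd hj (lt_irrefl _)
    rw [Finset.sum_eq_single i (fun j _ hj => by simp [hz j hj]) (by simp), if_pos hi]
    simp only [hex]
    rcases lt_trichotomy (sideCoef b t.order i) 0 with h | h | h
    · simp [h, not_lt.mpr h.le]
    · simp [h]
    · simp [h, not_lt.mpr h.le]
  · push Not at hi
    rw [Finset.sum_eq_zero fun i _ => if_neg (by simpa using hi i)]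
    -- a positive combination of the values at the vertices vanishes
    let c : Fin (q + 2) → ℝ := fun i => ∑ k, affineCoord b (t.order k) i
    have hc : ∀ i, 0 < c i := by
      intro i
      obtain ⟨k, hk⟩ := hi i
      exact Finset.sum_pos' (fun k _ => affineCoord_nonneg hb (hmemb k) i)
        ⟨k, Finset.mem_univ k, (affineCoord_nonneg hb (hmemb k) i).lt_of_ne hk.symm⟩
    have hsum : ∑ i, c i * sideCoef b t.order i = 0 := by
      simp only [c, Finset.sum_mul]
      rw [Finset.sum_comm]
      exact Finset.sum_eq_zero fun k _ => side_self b t.order k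
    have hiff : (∃ j, 0 < 1 * sideCoef b t.order j) ↔ ∃ j, 0 < -1 * sideCoef b t.order j := by
      have aux : ∀ f : Fin (q + 2) → ℝ, ∑ i, c i * f i = 0 → (∃ j, 0 < f j) → ∃ j, f j < 0 := by
        rintro f hf ⟨j, hj⟩
        by_contra! hcon
        have := Finset.sum_pos' (fun i _ => mul_nonneg (hc i).le (hcon i))
          ⟨j, Finset.mem_univ j, mul_pos (hc j) hj⟩
        rw [hf] at this
        exact lt_irrefl _ this
      constructor
      · rintro ⟨j, hj⟩
        obtain ⟨i, hi⟩ := aux _ hsum ⟨j, by simpa using hj⟩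
        exact ⟨i, by simpa using hi⟩
      · rintro ⟨j, hj⟩
        obtain ⟨i, hi⟩ := aux (fun i => -sideCoef b t.order i)
          (by simpa [Finset.sum_neg_distrib] using hsum) ⟨j, by simpa using hj⟩
        exact ⟨i, by simpa using hi⟩
    simp only [hiff, sub_self]

/-- Subdivision commutes with the boundary, up to reordering vertices. -/
theorem bd_subdivList (hK : IsSubdivision K' K) {b : Fin (q + 2) → E} (hb : AffineIndependent ℝ b)
    {s₀ : Finset E} (hs₀ : s₀ ∈ K.faces) (hsb : (s₀ : Set E) = Set.range b) :
    bd (subdivList K' (q + 1) b)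
      - ∑ i : Fin (q + 2), (-1 : ℤ) ^ (i : ℕ) • subdivList K' q (b ∘ i.succAbove) ∈ alt E := by
  classical
  let g : SimplexOf K' (q + 1) → Fin (q + 2) → ℤ := fun s i =>
    if (s.1 : Set E) ⊆ convexHull ℝ (Set.range b) then
      orientSign b (Fin.cons (s.order i) (s.facet i).order : Fin (q + 2) → E) else 0
  have h1 : bd (subdivList K' (q + 1) b)
      - ∑ s : SimplexOf K' (q + 1), ∑ i, g s i • of (List.ofFn (s.facet i).order) ∈ alt E := by
    rw [subdivList, map_sum, ← Finset.sum_sub_distrib]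
    refine Submodule.sum_mem _ fun s _ => ?_
    by_cases hs : (s.1 : Set E) ⊆ convexHull ℝ (Set.range b)
    · simp only [g, if_pos hs]
      rw [map_smul, bd_of, bdList_ofFn, Finset.smul_sum, ← Finset.sum_sub_distrib]
      exact Submodule.sum_mem _ fun i _ => orientSign_smul_face_sub_mem_alt b s i
    · simp [g, if_neg hs]
  have h2 : ∑ s : SimplexOf K' (q + 1), ∑ i, g s i • of (List.ofFn (s.facet i).order)
      = ∑ i : Fin (q + 2), (-1 : ℤ) ^ (i : ℕ) • subdivList K' q (b ∘ i.succAbove) := by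
    have hl : ∑ s : SimplexOf K' (q + 1), ∑ i, g s i • of (List.ofFn (s.facet i).order)
        = ∑ t : SimplexOf K' q, (∑ a : SimplexOf K' (q + 1) × Fin (q + 2) with a.1.facet a.2 = t,
          g a.1 a.2) • of (List.ofFn t.order) := by
      rw [← Finset.sum_product', Finset.univ_product_univ,
        ← Finset.sum_fiberwise (g := fun a => a.1.facet a.2)]
      refine Finset.sum_congr rfl fun t _ => ?_
      rw [Finset.sum_smul]
      refine Finset.sum_congr rfl fun a ha => ?_
      rw [(Finset.mem_filter.mp ha).2]
    have hr : ∑ i : Fin (q + 2), (-1 : ℤ) ^ (i : ℕ) • subdivList K' q (b ∘ i.succAbove)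
        = ∑ t : SimplexOf K' q, (∑ i : Fin (q + 2),
          if (t.1 : Set E) ⊆ convexHull ℝ (Set.range (b ∘ i.succAbove)) then
          (-1 : ℤ) ^ (i : ℕ) * orientSign (b ∘ i.succAbove) t.order else 0) •
          of (List.ofFn t.order) := by
      simp only [subdivList, Finset.smul_sum, Finset.sum_smul]
      rw [Finset.sum_comm]
      refine Finset.sum_congr rfl fun t _ => Finset.sum_congr rfl fun i _ => ?_
      split_ifs
      · rw [smul_smul]
      · simp
    rw [hl, hr]
    refine Finset.sum_congr rfl fun t _ => ?_
    congr 1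
    by_cases htb : (t.1 : Set E) ⊆ convexHull ℝ (Set.range b)
    · rw [← sides_eq hb t htb]
      have hg : ∑ a : SimplexOf K' (q + 1) × Fin (q + 2) with a.1.facet a.2 = t, g a.1 a.2
          = ∑ a : SimplexOf K' (q + 1) × Fin (q + 2) with (a.1.facet a.2 = t ∧
            (a.1.1 : Set E) ⊆ convexHull ℝ (Set.range b)),
            (SignType.sign (side b t.order (affineCoord b (a.1.order a.2))) : ℤ) := by
        rw [← Finset.filter_filter, Finset.sum_filter (s := Finset.filter _ _)]
        refine Finset.sum_congr rfl fun a ha => ?_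
        simp only [g]
        rw [(Finset.mem_filter.mp ha).2, orientSign_cons]
      rw [hg, sum_sign_eq]
      rw [card_side hK hb hs₀ hsb t htb 1 _ (fun a => by simp [and_assoc]),
        card_side hK hb hs₀ hsb t htb (-1) _ (fun a => by simp [and_assoc])]
      push_cast
      rfl
    · rw [Finset.sum_eq_zero, Finset.sum_eq_zero]
      · intro i _
        refine if_neg fun h => htb (h.trans (convexHull_mono ?_))
        exact Set.range_comp_subset_range _ _
      · intro a ha
        refine if_neg fun h => htb ?_
        rw [← (Finset.mem_filter.mp ha).2]
        exact (Finset.coe_subset.mpr (Finset.erase_subset _ _)).trans h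
  rwa [h2] at h1

end Subdivide

/-! ### Open stars and their lifts -/

section Star

open unitInterval

variable {E : Type*} [NormedAddCommGroup E] [NormedSpace ℝ E]
  {K K' : Geometry.SimplicialComplex ℝ E} {Xt : Type*} [TopologicalSpace Xt] {p : Xt → K.space}

/-- The open star of a vertex: the points all of whose closed simplices contain the vertex. -/
def openStar (K : Geometry.SimplicialComplex ℝ E) (w : E) : Set K.space :=
  {y | ∀ s ∈ K.faces, (y : E) ∈ convexHull ℝ (s : Set E) → w ∈ s}

theorem isOpen_openStar [Finite K.faces] (w : E) : IsOpen (openStar K w) := by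
  have h : (openStar K w)ᶜ = ⋃ s ∈ {s ∈ K.faces | w ∉ s},
      (Subtype.val ⁻¹' convexHull ℝ (s : Set E) : Set K.space) := by
    ext y
    simp only [openStar, Set.mem_compl_iff, Set.mem_ofPred_eq, not_forall, Set.mem_iUnion,
      Set.mem_preimage, exists_prop]
    exact ⟨fun ⟨s, hs, hy, hw⟩ => ⟨s, ⟨hs, hw⟩, hy⟩, fun ⟨s, ⟨hs, hw⟩, hy⟩ => ⟨s, hs, hy, hw⟩⟩
  rw [← isClosed_compl_iff, h]
  refine Set.Finite.isClosed_biUnion ((Set.toFinite K.faces).subset (Set.sep_subset _ _)) ?_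
  intro s _
  exact (s.finite_toSet.isCompact_convexHull ℝ).isClosed.preimage continuous_subtype_val

theorem exists_mem_openStar (y : K.space) : ∃ w, y ∈ openStar K w := by
  obtain ⟨s, hs, -, hmin⟩ := exists_carrier y.2
  obtain ⟨w, hw⟩ := K.nonempty_of_mem_faces hs
  exact ⟨w, fun s' hs' hy => hmin s' hs' hy hw⟩

theorem isCompact_space [Finite K.faces] : IsCompact K.space := by
  rw [Geometry.SimplicialComplex.space]
  exact (Set.toFinite K.faces).isCompact_biUnion fun s _ => s.finite_toSet.isCompact_convexHull ℝ

/-- A choice, for each point of a polyhedron, of a vertex whose open star contains all points at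
distance less than `ε`. -/
structure StarChoice (K : Geometry.SimplicialComplex ℝ E) (ε : ℝ) where
  vertex : K.space → E
  pos : 0 < ε
  mem : ∀ y y' : K.space, dist y y' < ε → y' ∈ openStar K (vertex y)

/-- The open stars of the vertices cover the compact space `|K|`; `ε` is a Lebesgue number. -/
theorem exists_starChoice [Finite K.faces] : ∃ ε, Nonempty (StarChoice K ε) := by
  have : CompactSpace K.space := isCompact_iff_compactSpace.mp isCompact_space
  obtain ⟨ε, hε, h⟩ := lebesgue_number_lemma_of_metric (s := (Set.univ : Set K.space))
    (c := openStar K) isCompact_univ isOpen_openStar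
    (fun y _ => Set.mem_iUnion.mpr (exists_mem_openStar y))
  choose! W hW using h
  exact ⟨ε, ⟨W, hε, fun y y' hy => hW y trivial (by rwa [Metric.mem_ball, dist_comm])⟩⟩

theorem segment_mem_space {y : K.space} {w : E} (hy : y ∈ openStar K w) (t : I) :
    (1 - (t : ℝ)) • (y : E) + (t : ℝ) • w ∈ K.space := by
  obtain ⟨s, hs, hys⟩ := Geometry.SimplicialComplex.mem_space_iff.mp y.2
  exact K.convexHull_subset_space hs ((convex_convexHull ℝ _) hys
    (subset_convexHull ℝ _ (hy s hs hys)) (by linarith [t.2.2]) t.2.1 (by ring))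

/-- The contraction of an open star along straight segments, lifted to the covering. -/
def starHomotopy (p : C(Xt, K.space)) (w : E) :
    C(I × {z : Xt // p z ∈ openStar K w}, K.space) where
  toFun a := ⟨(1 - (a.1 : ℝ)) • (p a.2 : E) + (a.1 : ℝ) • w, segment_mem_space a.2.2 a.1⟩
  continuous_toFun := by
    refine Continuous.subtype_mk ?_ _
    fun_prop

open scoped Classical in
/-- For `z` over the open star of `w`, the end of the lift starting at `z` of the straight segment
from `p z` to `w`. -/
def starLift (hp : IsUniversalCover p) (w : E) (z : Xt) : Xt :=
  if h : p z ∈ openStar K w then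
    hp.isCoveringMap.liftHomotopy (starHomotopy ⟨p, hp.isCoveringMap.continuous⟩ w)
      ⟨Subtype.val, continuous_subtype_val⟩ (fun a => by ext; simp [starHomotopy]) (1, ⟨z, h⟩)
  else z

variable (hp : IsUniversalCover p)

theorem starLift_eq {w : E} {z : Xt} (hz : p z ∈ openStar K w) {Γ : I → Xt} (hΓ : Continuous Γ)
    (hΓ₀ : Γ 0 = z)
    (hΓp : ∀ t, toAmbient p (Γ t) = (1 - (t : ℝ)) • toAmbient p z + (t : ℝ) • w) :
    starLift hp w z = Γ 1 := by
  rw [starLift, dif_pos hz]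
  set f : C({z : Xt // p z ∈ openStar K w}, Xt) := ⟨Subtype.val, continuous_subtype_val⟩
  set H := starHomotopy ⟨p, hp.isCoveringMap.continuous⟩ w
  have H0 : ∀ a, H (0, a) = p (f a) := fun a => by ext; simp [H, starHomotopy, f]
  change hp.isCoveringMap.liftHomotopy H f H0 (1, ⟨z, hz⟩) = Γ 1
  refine congrFun (hp.isCoveringMap.eq_of_comp_eq
    (g₁ := fun t => hp.isCoveringMap.liftHomotopy H f H0 (t, ⟨z, hz⟩)) (by fun_prop) hΓ ?_ 0 ?_) 1
  · funext t
    have h1 := congrFun (hp.isCoveringMap.liftHomotopy_lifts H f H0) (t, ⟨z, hz⟩)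
    refine h1.trans (Subtype.ext ?_)
    exact (hΓp t).symm
  · rw [hΓ₀]
    exact hp.isCoveringMap.liftHomotopy_zero H f H0 ⟨z, hz⟩

theorem starLift_eq_of_isLiftOn {w : E} {z : Xt} (hz : p z ∈ openStar K w) {C : Set E}
    (hC : Convex ℝ C) {τ : E → Xt} (hτ : IsLiftOn (toAmbient p) C τ) (hzC : toAmbient p z ∈ C)
    (hw : w ∈ C) (hτz : τ (toAmbient p z) = z) : starLift hp w z = τ w := by
  have hmem : ∀ t : I, (1 - (t : ℝ)) • toAmbient p z + (t : ℝ) • w ∈ C := fun t =>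
    hC hzC hw (by linarith [t.2.2]) t.2.1 (by ring)
  rw [starLift_eq hp hz (Γ := fun t => τ ((1 - (t : ℝ)) • toAmbient p z + (t : ℝ) • w)) ?_
    (by simpa using hτz) (fun t => hτ.apply_eq _ (hmem t))]
  · simp
  · exact hτ.continuousOn.comp_continuous (by fun_prop) hmem

theorem starLift_smul {w : E} {z : Xt} (hz : p z ∈ openStar K w) (γ : Deck p) :
    starLift hp w (γ • z) = γ • starLift hp w z := by
  have hz' : p (γ • z) ∈ openStar K w := by rwa [Deck.map_smul γ]
  set f : C({z : Xt // p z ∈ openStar K w}, Xt) := ⟨Subtype.val, continuous_subtype_val⟩ with hf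
  set H := starHomotopy ⟨p, hp.isCoveringMap.continuous⟩ w with hH
  have H0 : ∀ a, H (0, a) = p (f a) := fun a => by ext; simp [H, starHomotopy, f]
  have e : starLift hp w z = hp.isCoveringMap.liftHomotopy H f H0 (1, ⟨z, hz⟩) := by
    rw [starLift, dif_pos hz]
    rfl
  rw [e]
  refine starLift_eq hp hz'
    (Γ := fun t => γ • hp.isCoveringMap.liftHomotopy H f H0 (t, ⟨z, hz⟩)) ?_ ?_ ?_
  · exact (Deck.continuous_smul γ).comp (by fun_prop)
  · exact congrArg (γ • ·) (hp.isCoveringMap.liftHomotopy_zero H f H0 ⟨z, hz⟩)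
  · intro t
    rw [toAmbient, toAmbient, Deck.map_smul γ, Deck.map_smul γ]
    exact congrArg Subtype.val
      (congrFun (hp.isCoveringMap.liftHomotopy_lifts H f H0) (t, ⟨z, hz⟩))

/-- Over an open star, the lifts of the vertex form a discrete set, so `starLift` is constant on
connected sets. -/
theorem starLift_const {w : E} {S : Set Xt} (hS : IsPreconnected S)
    (hSw : ∀ z ∈ S, p z ∈ openStar K w) {z z' : Xt} (hz : z ∈ S) (hz' : z' ∈ S) :
    starLift hp w z = starLift hp w z' := by
  set f : C({z : Xt // p z ∈ openStar K w}, Xt) := ⟨Subtype.val, continuous_subtype_val⟩ with hf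
  set H := starHomotopy ⟨p, hp.isCoveringMap.continuous⟩ w with hH
  have H0 : ∀ a, H (0, a) = p (f a) := fun a => by ext; simp [H, starHomotopy, f]
  have : PreconnectedSpace S := isPreconnected_iff_preconnectedSpace.mp hS
  have e : ∀ a : S, starLift hp w a
      = hp.isCoveringMap.liftHomotopy H f H0 (1, ⟨a, hSw a a.2⟩) := fun a => by
    rw [starLift, dif_pos (hSw a a.2)]
    rfl
  have hcont : Continuous fun a : S => starLift hp w a := by
    simp only [e]
    exact (map_continuous _).comp (by fun_prop)
  refine hp.isCoveringMap.const_of_comp hcont (fun a a' => ?_) ⟨z, hz⟩ ⟨z', hz'⟩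
  have hend : ∀ a : S, (p (starLift hp w a) : E) = w := by
    intro a
    rw [e]
    have h1 := congrArg Subtype.val
      (congrFun (hp.isCoveringMap.liftHomotopy_lifts H f H0) (1, ⟨a, hSw a a.2⟩))
    refine h1.trans ?_
    simp [H, starHomotopy]
  exact Subtype.ext ((hend a).trans (hend a').symm)

include hp in
/-- A convex subset of a polyhedron lifts to the covering, through any prescribed point. -/
theorem exists_isLiftOn {C : Set E} (hC : Convex ℝ C) (hCK : C ⊆ K.space) {z : Xt}
    (hz : toAmbient p z ∈ C) : ∃ τ, IsLiftOn (toAmbient p) C τ ∧ τ (toAmbient p z) = z := by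
  let H : C(I × C, K.space) :=
    ⟨fun a => ⟨(1 - (a.1 : ℝ)) • toAmbient p z + (a.1 : ℝ) • (a.2 : E), hCK (hC hz a.2.2
      (by linarith [a.1.2.2]) a.1.2.1 (by ring))⟩, by
      refine Continuous.subtype_mk ?_ _
      fun_prop⟩
  let f : C(C, Xt) := ContinuousMap.const _ z
  have H0 : ∀ a, H (0, a) = p (f a) := fun a => by ext; simp [H, f, toAmbient]
  set L := hp.isCoveringMap.liftHomotopy H f H0 with hL
  have hLp : ∀ a, p (L a) = H a := congrFun (hp.isCoveringMap.liftHomotopy_lifts H f H0)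
  classical
  refine ⟨fun x => if h : x ∈ C then L (1, ⟨x, h⟩) else z, ⟨?_, ?_⟩, ?_⟩
  · rw [continuousOn_iff_continuous_domRestrict]
    have : (C.domRestrict fun x => if h : x ∈ C then L (1, ⟨x, h⟩) else z)
        = fun x : C => L (1, x) := by
      funext x
      simp [Set.domRestrict]
    rw [this]
    fun_prop
  · intro x hx
    rw [dif_pos hx, toAmbient, hLp]
    simp [H]
  · refine (dif_pos hz).trans ?_
    have h1 := hp.isCoveringMap.const_of_comp (g := fun t : I => L (t, ⟨toAmbient p z, hz⟩))
      (by fun_prop) (fun t t' => by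
        rw [hLp, hLp]
        ext
        simp [H, ← add_smul]) 1 0
    refine h1.trans ?_
    exact hp.isCoveringMap.liftHomotopy_zero H f H0 _

variable {ε : ℝ} (W : StarChoice K ε)

/-- The vertex of the lifted triangulation which the star choice assigns to a point of the
covering. -/
def nearVertex (z : Xt) : Xt := starLift hp (W.vertex (p z)) z

theorem nearVertex_smul (γ : Deck p) (z : Xt) :
    nearVertex hp W (γ • z) = γ • nearVertex hp W z := by
  rw [nearVertex, Deck.map_smul γ, starLift_smul hp (W.mem _ _ (by simpa using W.pos))]
  rfl

/-- The vertices assigned to the points of a connected set of small size span a simplex. -/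
theorem exists_face_nearVertex {S : Set Xt} (hS : IsPreconnected S) (hne : S.Nonempty)
    (hdist : ∀ z ∈ S, ∀ z' ∈ S, dist (p z) (p z') < ε) :
    ∃ U ∈ (liftedComplex K (toAmbient p)).faces, ∀ z ∈ S, nearVertex hp W z ∈ U := by
  classical
  obtain ⟨z₀, hz₀⟩ := hne
  obtain ⟨s, hs, hzs⟩ := Geometry.SimplicialComplex.mem_space_iff.mp (p z₀).2
  obtain ⟨τ, hτ, hτz⟩ := exists_isLiftOn hp (convex_convexHull ℝ (s : Set E))
    (K.convexHull_subset_space hs) hzs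
  refine ⟨s.image τ, ⟨s, hs, τ, hτ, Finset.coe_image⟩, fun z hz => ?_⟩
  have hstar : ∀ z' ∈ S, p z' ∈ openStar K (W.vertex (p z)) := fun z' hz' =>
    W.mem _ _ (hdist z hz z' hz')
  have hw : W.vertex (p z) ∈ s := hstar z₀ hz₀ s hs hzs
  rw [nearVertex, starLift_const hp hS hstar hz hz₀, starLift_eq_of_isLiftOn hp (hstar z₀ hz₀)
    (convex_convexHull ℝ _) hτ hzs (subset_convexHull ℝ _ hw) hτz]
  exact Finset.mem_image_of_mem τ hw

/-- A coordinate of a lifting of a simplicial map sends a lifted closed simplex of `K'` into a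
simplex of `K̃`, so the vertices assigned to its values are values at vertices. -/
theorem exists_nearVertex_eq (hK' : IsSubdivision K' K) {n : ℕ} {f : C(K.space, UConf n K.space)}
    (hf : IsNValuedSimplicial K' K f) (F : Lifting p f) (k : Fin n) {s : Finset E}
    (hs : s ∈ K'.faces) {τ : E → Xt} (hτ : IsLiftOn (toAmbient p) (convexHull ℝ (s : Set E)) τ)
    {x : E} (hx : x ∈ convexHull ℝ (s : Set E)) :
    ∃ v ∈ s, nearVertex hp W (F.coord k (τ x)) = F.coord k (τ v) := by
  have hpc := hp.isCoveringMap.continuous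
  obtain ⟨φ, hφ, hφf⟩ := hf s hs
  set C : Set E := convexHull ℝ (s : Set E) with hC
  have hsC : (s : Set E) ⊆ C := subset_convexHull ℝ _
  have hCs : C ⊆ K.space := hK'.space_eq ▸ K'.convexHull_subset_space hs
  have : Nonempty C := ⟨⟨x, hx⟩⟩
  have : PreconnectedSpace C :=
    isPreconnected_iff_preconnectedSpace.mp (convex_convexHull ℝ _).isPreconnected
  have hτC : Continuous (fun x : C => τ x) :=
    continuousOn_iff_continuous_domRestrict.mp hτ.continuousOn
  have hcont : Continuous (fun x : C => F.coord k (τ x)) := (F.continuous_coord k).comp hτC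
  have hpτ : ∀ x : C, p (τ x) = ⟨x, hCs x.2⟩ := fun x => Subtype.ext (hτ.apply_eq x x.2)
  have hpts : ∀ x : C, Set.range (fun j => (p (F.coord j (τ x)) : E))
      = Set.range (fun i => φ i (x : E)) := by
    intro x
    have h := hφf ⟨x, hCs x.2⟩ x.2
    have e : (p (τ x) : E) = x := congrArg Subtype.val (hpτ x)
    rw [← hpτ x, F.points_eq, ← Set.range_comp, e] at h
    exact h
  -- on the simplex, the coordinate covers exactly one of the affine branches
  obtain ⟨i, hi⟩ : ∃ i, ∀ x : C, (p (F.coord k (τ x)) : E) = φ i (x : E) := by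
    refine select (continuous_subtype_val.comp (hpc.comp hcont))
      (fun i => (φ i).continuous.comp continuous_subtype_val) ?_ ?_
    · intro x
      have h : (p (F.coord k (τ x)) : E) ∈ Set.range (fun i => φ i (x : E)) := by
        rw [← hpts x]
        exact ⟨k, rfl⟩
      obtain ⟨i, hi⟩ := h
      exact ⟨i, hi.symm⟩
    · intro x
      have hinj : Function.Injective (fun j => (p (F.coord j (τ x)) : E)) :=
        Subtype.val_injective.comp (F.toMap (τ x)).2
      have hcard := congrArg Set.ncard (hpts x)
      rw [← Set.image_univ, ← Set.image_univ, Set.ncard_image_of_injective _ hinj,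
        Set.ncard_univ, Nat.card_fin] at hcard
      exact Set.injOn_univ.mp (Set.injOn_of_ncard_image_eq (s := Set.univ)
        (f := fun i => φ i (x : E)) (by rw [← hcard, Set.ncard_univ, Nat.card_fin]))
  obtain ⟨t, ht, htφ⟩ := hφ i
  set z := F.coord k (τ x) with hz
  have hzt : (p z : E) ∈ convexHull ℝ (t : Set E) := by
    rw [hi ⟨x, hx⟩, htφ]
    have := (φ i).toAffineMap.image_convexHull (s : Set E)
    exact this ▸ ⟨x, hx, rfl⟩
  have hstar : p z ∈ openStar K (W.vertex (p z)) := W.mem _ _ (by simpa using W.pos)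
  have hw : W.vertex (p z) ∈ (t : Set E) := hstar t ht hzt
  rw [htφ] at hw
  obtain ⟨v, hv, hvw⟩ := hw
  refine ⟨v, hv, ?_⟩
  -- the straight segment from `x` to `v` is carried to the lift of a straight segment
  have hmem : ∀ r : I, (1 - (r : ℝ)) • x + (r : ℝ) • v ∈ C := fun r =>
    (convex_convexHull ℝ _) hx (hsC hv) (by linarith [r.2.2]) r.2.1 (by ring)
  have h1 := starLift_eq hp hstar
    (Γ := fun r : I => F.coord k (τ ((1 - (r : ℝ)) • x + (r : ℝ) • v)))
    (hcont.comp (f := fun r : I => (⟨_, hmem r⟩ : C)) (by fun_prop)) (by simp [hz])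
    (fun r => by
      rw [toAmbient, hi ⟨_, hmem r⟩, toAmbient, hz, hi ⟨x, hx⟩, ← hvw]
      exact Convex.combo_affine_apply (f := (φ i).toAffineMap) (by ring))
  rw [nearVertex, h1]
  simp

end Star

/-! ### Simplicial approximation on chains -/

section Approx

open ListChain

variable {E : Type*} [NormedAddCommGroup E] [NormedSpace ℝ E]
  {K K' : Geometry.SimplicialComplex ℝ E} {Xt : Type*} [TopologicalSpace Xt] [Nonempty Xt]

theorem simplexLift_apply {P : Xt → E} {q : ℕ} (v : OrderedSimplex (liftedComplex K P) q)
    (i : Fin (q + 1)) : simplexLift P (Set.range v.1) (P (v.1 i)) = v.1 i := by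
  obtain ⟨-, hτ, hτr⟩ := simplexLift_spec v
  have hi : v.1 i ∈ simplexLift P (Set.range v.1) '' (P '' Set.range v.1) := by
    rw [hτr]
    exact ⟨i, rfl⟩
  obtain ⟨x, hx, hxi⟩ := hi
  rw [← hxi, hτ.apply_eq x (subset_convexHull ℝ _ hx)]

theorem affineIndependent_of_injective {P : Xt → E} {q : ℕ}
    {v : OrderedSimplex (liftedComplex K P) q} (hv : Function.Injective v.1) :
    AffineIndependent ℝ (P ∘ v.1) := by
  obtain ⟨⟨t, ht, htv⟩, -⟩ := simplexLift_spec v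
  have hPinj : Function.Injective (P ∘ v.1) := fun i j hij => hv (by
    rw [← simplexLift_apply v i, ← simplexLift_apply v j]
    exact congrArg _ hij)
  have h := (K.indep ht).comp_embedding
    (⟨fun i => ⟨P (v.1 i), by
      rw [← Finset.mem_coe, htv]
      exact ⟨_, ⟨i, rfl⟩, rfl⟩⟩, fun i j h => hPinj (congrArg Subtype.val h)⟩ :
      Fin (q + 1) ↪ t)
  exact h

theorem le_of_injective {P : Xt → E} {d : ℕ} (hd : HasDim K d) {q : ℕ}
    {v : OrderedSimplex (liftedComplex K P) q} (hv : Function.Injective v.1) : q ≤ d := by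
  obtain ⟨⟨t, ht, htv⟩, -⟩ := simplexLift_spec v
  refine hd.2 ⟨t, ht, ?_⟩
  rw [← Set.ncard_coe_finset, htv, ← Set.range_comp, ← Set.image_univ,
    Set.ncard_image_of_injective _ (affineIndependent_of_injective hv).injective, Set.ncard_univ,
    Nat.card_fin]

variable [Finite K'.faces]

theorem subdivList_perm {q : ℕ} {b : Fin (q + 1) → E} (hb : AffineIndependent ℝ b)
    (σ : Equiv.Perm (Fin (q + 1))) :
    subdivList K' q (b ∘ σ) = (Equiv.Perm.sign σ : ℤ) • subdivList K' q b := by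
  classical
  have h : Set.range (b ∘ σ) = Set.range b := σ.surjective.range_comp b
  rw [subdivList, subdivList, Finset.smul_sum]
  refine Finset.sum_congr rfl fun s _ => ?_
  rw [h]
  split_ifs
  · rw [orientSign_perm hb, mul_smul]
  · simp

/-- The `m`-fold barycentric subdivision of the part of `K'` in the simplex with vertices `b`. -/
def subdivChain (K' : Geometry.SimplicialComplex ℝ E) [Finite K'.faces] (m q : ℕ)
    (b : Fin (q + 1) → E) : ListChain E :=
  (sd (q + 1) ^ m : Module.End ℤ (ListChain E)) (subdivList K' q b)

theorem subdivChain_perm {m q : ℕ} {b : Fin (q + 1) → E} (hb : AffineIndependent ℝ b)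
    (σ : Equiv.Perm (Fin (q + 1))) :
    subdivChain K' m q (b ∘ σ) = (Equiv.Perm.sign σ : ℤ) • subdivChain K' m q b := by
  rw [subdivChain, subdivChain, subdivList_perm hb, map_smul]

/-- A list of length `N` which lies in a simplex of `K'` inside `C` and has diameter at most
`δ`. -/
def IsFine (K' : Geometry.SimplicialComplex ℝ E) (C : Set E) (δ : ℝ) (N : ℕ) (l : List E) : Prop :=
  l.length = N ∧ ∃ s ∈ K'.faces, (s : Set E) ⊆ C ∧ Small (convexHull ℝ (s : Set E)) δ l

omit [Finite K'.faces] in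
theorem IsFine.mem {C : Set E} (hC : Convex ℝ C) {δ : ℝ} {N : ℕ} {l : List E}
    (h : IsFine K' C δ N l) {x : E} (hx : x ∈ l) : x ∈ C := by
  obtain ⟨-, s, -, hs, h1, -⟩ := h
  exact convexHull_min hs hC (h1 x hx)

theorem subdivChain_mem_on {D m q : ℕ} (hq : q ≤ D) {r δ : ℝ} (hr : 0 ≤ r)
    (hK : ∀ s ∈ K'.faces, ∀ x ∈ s, ∀ y ∈ s, dist x y ≤ r)
    (hm : (D / (D + 1) : ℝ) ^ m * r ≤ δ) (b : Fin (q + 1) → E) :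
    subdivChain K' m q b ∈ on (IsFine K' (convexHull ℝ (Set.range b)) δ (q + 1)) := by
  classical
  rw [subdivChain, subdivList, map_sum]
  refine Submodule.sum_mem _ fun s _ => ?_
  split_ifs with h
  · rw [map_smul, Module.End.pow_apply]
    refine Submodule.smul_mem _ _ (on_mono ?_ (iterate_sd_mem_small (q + 1) D m (by omega)
      List.length_ofFn hr (convex_convexHull ℝ (s.1 : Set E)) (r := r) ⟨?_, ?_⟩))
    · rintro k ⟨h1, h2, h3⟩
      exact ⟨h1, s.1, s.2.1, h, h2, fun x hx y hy => (h3 x hx y hy).trans hm⟩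
    · intro x hx
      obtain ⟨i, rfl⟩ := (List.mem_ofFn' _ _).mp hx
      exact subset_convexHull ℝ _ (s.order_mem i)
    · intro x hx y hy
      obtain ⟨i, rfl⟩ := (List.mem_ofFn' _ _).mp hx
      obtain ⟨j, rfl⟩ := (List.mem_ofFn' _ _).mp hy
      exact hK _ s.2.1 _ (s.order_mem i) _ (s.order_mem j)
  · rw [map_zero]
    exact Submodule.zero_mem _

theorem subdivList_mem_length (q : ℕ) (b : Fin (q + 1) → E) :
    subdivList K' q b ∈ on fun l => l.length = q + 1 := by
  classical
  rw [subdivList]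
  refine Submodule.sum_mem _ fun s _ => ?_
  split_ifs
  · exact Submodule.smul_mem _ _ (of_mem_on List.length_ofFn)
  · exact Submodule.zero_mem _

/-- The subdivided simplex has the subdivided facets as its boundary. At least one barycentric
subdivision removes the dependence on the orders of vertices. -/
theorem bd_subdivChain (hK : IsSubdivision K' K) {m q : ℕ} (hm : m ≠ 0) {b : Fin (q + 2) → E}
    (hb : AffineIndependent ℝ b) {s₀ : Finset E} (hs₀ : s₀ ∈ K.faces)
    (hsb : (s₀ : Set E) = Set.range b) :
    bd (subdivChain K' m (q + 1) b)
      = ∑ i : Fin (q + 2), (-1 : ℤ) ^ (i : ℕ) • subdivChain K' m q (b ∘ i.succAbove) := by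
  obtain ⟨m, rfl⟩ := Nat.exists_eq_succ_of_ne_zero hm
  have h := sd_eq_zero_of_mem_alt (q + 1) (bd_subdivList hK hb hs₀ hsb)
  rw [map_sub, sub_eq_zero] at h
  rw [subdivChain, Module.End.pow_apply, bd_iterate_sd _ _ (subdivList_mem_length _ _),
    ← Module.End.pow_apply, pow_succ, Module.End.mul_apply, h]
  simp only [map_sum, map_smul, subdivChain, pow_succ, Module.End.mul_apply]

/-- The homomorphism on `C_q(K̃)` given on a simplex by applying `T`, which depends on the lift of
the closed simplex, to the subdivided simplex. -/
def localChain (K K' : Geometry.SimplicialComplex ℝ E) [Finite K'.faces] (P : Xt → E)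
    {M : Type*} [AddCommGroup M] (T : (E → Xt) → ListChain E →ₗ[ℤ] M) (m q : ℕ) :
    Chain (liftedComplex K P) q →ₗ[ℤ] M :=
  open scoped Classical in
  Chain.lift
    (fun v => if Function.Injective v.1 then
      T (simplexLift P (Set.range v.1)) (subdivChain K' m q (P ∘ v.1)) else 0)
    (fun v hv => if_neg hv)
    (fun v σ => by
      have hrange : Set.range (v.perm σ).1 = Set.range v.1 := σ.surjective.range_comp v.1
      have hinj : Function.Injective (v.perm σ).1 ↔ Function.Injective v.1 :=
        σ.injective_comp v.1
      by_cases hv : Function.Injective v.1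
      · have e : P ∘ (v.perm σ).1 = (P ∘ v.1) ∘ σ := rfl
        rw [if_pos hv, if_pos (hinj.mpr hv), hrange, e,
          subdivChain_perm (affineIndependent_of_injective hv), map_smul]
      · rw [if_neg hv, if_neg fun h => hv (hinj.mp h), smul_zero])

theorem localChain_of {P : Xt → E} {M : Type*} [AddCommGroup M]
    (T : (E → Xt) → ListChain E →ₗ[ℤ] M) (m : ℕ) {q : ℕ}
    {v : OrderedSimplex (liftedComplex K P) q} (hv : Function.Injective v.1) :
    localChain K K' P T m q (Chain.of v)
      = T (simplexLift P (Set.range v.1)) (subdivChain K' m q (P ∘ v.1)) := by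
  rw [localChain, Chain.lift_of, if_pos hv]

/-- The chain map which sends a simplex of `K̃` to the image of its subdivision under the vertex
map `h`. -/
def approx (K K' : Geometry.SimplicialComplex ℝ E) [Finite K'.faces] (P : Xt → E) (h : Xt → Xt)
    (m q : ℕ) : Chain (liftedComplex K P) q →ₗ[ℤ] Chain (liftedComplex K P) q :=
  localChain K K' P (fun τ => toChain _ q ∘ₗ map (h ∘ τ)) m q

/-- The prism operator between the chain maps given by `h` and `h'`. -/
def approxHomotopy (K K' : Geometry.SimplicialComplex ℝ E) [Finite K'.faces] (P : Xt → E)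
    (h h' : Xt → Xt) (m q : ℕ) :
    Chain (liftedComplex K P) q →ₗ[ℤ] Chain (liftedComplex K P) (q + 1) :=
  localChain K K' P (fun τ => toChain _ (q + 1) ∘ₗ prism (h ∘ τ) (h' ∘ τ)) m q

/-- On each lift of a simplex of `K'`, the maps `h` and `h'` send the points over a list of diameter
at most `δ` to vertices of one simplex of `K̃`. -/
def Contiguous (K K' : Geometry.SimplicialComplex ℝ E) (P : Xt → E) (δ : ℝ) (h h' : Xt → Xt) :
    Prop :=
  ∀ s ∈ K'.faces, ∀ τ, IsLiftOn P (convexHull ℝ (s : Set E)) τ → ∀ l ≠ [],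
    Small (convexHull ℝ (s : Set E)) δ l →
    ∃ U ∈ (liftedComplex K P).faces, ∀ x ∈ l, h (τ x) ∈ U ∧ h' (τ x) ∈ U

variable {P : Xt → E} {δ : ℝ} {h h' : Xt → Xt}

omit [NormedSpace ℝ E] [Nonempty Xt] in
theorem IsLiftOn.mono {C C' : Set E} {τ : E → Xt} (hτ : IsLiftOn P C τ) (hC : C' ⊆ C) :
    IsLiftOn P C' τ := ⟨hτ.continuousOn.mono hC, fun x hx => hτ.apply_eq x (hC hx)⟩

omit [Nonempty Xt] [Finite K'.faces] in
theorem IsFine.exists_face (hc : Contiguous K K' P δ h h') {C : Set E} (hC : Convex ℝ C)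
    {τ : E → Xt} (hτ : IsLiftOn P C τ) {N : ℕ} {l : List E} (hl : IsFine K' C δ (N + 1) l) :
    ∃ U ∈ (liftedComplex K P).faces, ∀ x ∈ l, h (τ x) ∈ U ∧ h' (τ x) ∈ U := by
  obtain ⟨hN, s, hs, hsC, hsmall⟩ := hl
  refine hc s hs τ (hτ.mono (convexHull_min hsC hC)) l ?_ hsmall
  rintro rfl
  simp at hN

omit [Nonempty Xt] [Finite K'.faces] in
theorem Contiguous.isSimplexList_prism (hc : Contiguous K K' P δ h h') {C : Set E}
    (hC : Convex ℝ C) {τ : E → Xt} (hτ : IsLiftOn P C τ) {q : ℕ} {x : ListChain E}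
    (hx : x ∈ on (IsFine K' C δ (q + 1))) :
    prism (h ∘ τ) (h' ∘ τ) x ∈ on (IsSimplexList (liftedComplex K P) (q + 1)) := by
  refine map_mem_of_mem_on _ _ (fun l hl => ?_) hx
  obtain ⟨U, hU, h1⟩ := hl.exists_face hc hC hτ
  rw [prism_of]
  refine on_mono ?_ (prismList_mem_on _ _ l)
  rintro m ⟨hm, h2⟩
  refine isSimplexList_of_subset (by rw [hm, hl.1]) hU fun y hy => ?_
  obtain ⟨x, hx, h3 | h3⟩ := h2 y hy
  · exact h3 ▸ (h1 x hx).1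
  · exact h3 ▸ (h1 x hx).2

omit [Nonempty Xt] [Finite K'.faces] in
theorem Contiguous.toChain_map_eq (hc : Contiguous K K' P δ h h') {C : Set E} (hC : Convex ℝ C)
    {τ : E → Xt} (hτ : IsLiftOn P C τ) {q : ℕ} {x : ListChain E}
    (hx : x ∈ on (IsFine K' C δ (q + 1))) :
    toChain (liftedComplex K P) q (map (h' ∘ τ) x) = toChain _ q (map (h ∘ τ) x)
      + bdry _ q (toChain _ (q + 1) (prism (h ∘ τ) (h' ∘ τ) x))
      + toChain _ q (prism (h ∘ τ) (h' ∘ τ) (bd x)) := by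
  rw [bdry_toChain (hc.isSimplexList_prism hC hτ hx), add_assoc, ← map_add, bd_prism, map_sub]
  abel

/-- The bounds under which `m` barycentric subdivisions of the simplices of `K'` of dimension at
most `d`, whose diameters are at most `r`, consist of simplices of diameter at most `δ`. At least
one subdivision is asked for, as needed in `bd_subdivChain`. -/
structure IsMesh (K' : Geometry.SimplicialComplex ℝ E) (d m : ℕ) (r δ : ℝ) : Prop where
  ne_zero : m ≠ 0
  nonneg : 0 ≤ r
  dist_le : ∀ s ∈ K'.faces, ∀ x ∈ s, ∀ y ∈ s, dist x y ≤ r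
  le : (d / (d + 1) : ℝ) ^ m * r ≤ δ

theorem exists_isMesh (K' : Geometry.SimplicialComplex ℝ E) [Finite K'.faces] (d : ℕ)
    (hδ : 0 < δ) : ∃ m r, IsMesh K' d m r δ := by
  have hb : Bornology.IsBounded (⋃ s ∈ K'.faces, (s : Set E)) :=
    ((Set.toFinite K'.faces).biUnion fun s _ => s.finite_toSet).isBounded
  have hmem : ∀ s ∈ K'.faces, ∀ x ∈ s, x ∈ ⋃ s ∈ K'.faces, (s : Set E) := fun s hs x hx =>
    Set.mem_biUnion hs hx
  have hlim : Filter.Tendsto (fun m : ℕ => (d / (d + 1) : ℝ) ^ m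
      * Metric.diam (⋃ s ∈ K'.faces, (s : Set E))) Filter.atTop (nhds 0) := by
    rw [← zero_mul (Metric.diam (⋃ s ∈ K'.faces, (s : Set E)))]
    refine (tendsto_pow_atTop_nhds_zero_of_lt_one (by positivity) ?_).mul_const _
    rw [div_lt_one (by positivity)]
    linarith
  obtain ⟨m, hm, hm0⟩ := ((hlim.eventually (gt_mem_nhds hδ)).and
    (Filter.eventually_ne_atTop 0)).exists
  exact ⟨m, _, hm0, Metric.diam_nonneg, fun s hs x hx y hy =>
    Metric.dist_le_diam_of_mem hb (hmem s hs x hx) (hmem s hs y hy), hm.le⟩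

variable {d m : ℕ} {r : ℝ}

/-- In degree `0` there is no prism over the boundary, as the augmentation term is killed by
`prism`. -/
theorem approx_homotopy_zero (hd : HasDim K d) (hmesh : IsMesh K' d m r δ)
    (hc : Contiguous K K' P δ h h') :
    approx K K' P h' m 0 = approx K K' P h m 0 + bdry _ 0 ∘ₗ approxHomotopy K K' P h h' m 0 := by
  refine Chain.hom_ext fun v hv => ?_
  obtain ⟨-, hτ, -⟩ := simplexLift_spec v
  rw [← Set.range_comp] at hτ
  have hfine := subdivChain_mem_on (K' := K') (le_of_injective hd hv) hmesh.nonneg hmesh.dist_le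
    hmesh.le (P ∘ v.1)
  have h0 : prism (h ∘ simplexLift P (Set.range v.1)) (h' ∘ simplexLift P (Set.range v.1))
      (bd (subdivChain K' m 0 (P ∘ v.1))) = 0 := by
    refine (Submodule.mem_bot ℤ).mp (map_mem_of_mem_on ⊥ (prism _ _ ∘ₗ bd) (fun l hl => ?_) hfine)
    rw [LinearMap.comp_apply, bd_of, Submodule.mem_bot]
    obtain ⟨a, rfl⟩ := List.length_eq_one_iff.mp hl.1
    simp [bdList, prismList]
  rw [LinearMap.add_apply, LinearMap.comp_apply, approx, approx, approxHomotopy,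
    localChain_of _ _ hv, localChain_of _ _ hv, localChain_of _ _ hv, LinearMap.comp_apply,
    LinearMap.comp_apply, LinearMap.comp_apply,
    hc.toChain_map_eq (convex_convexHull ℝ _) hτ hfine, h0, map_zero, add_zero]

/-- The prism over the boundary of a subdivided simplex is the prism operator applied to the facets,
since subdivision commutes with boundaries and the lift of a simplex restricts to its facets. -/
theorem approx_homotopy_succ {p : Xt → K.space} (hp : IsUniversalCover p) (hK : IsSubdivision K' K)
    (hd : HasDim K d) (hmesh : IsMesh K' d m r δ)
    (hc : Contiguous K K' (toAmbient p) δ h h') (q : ℕ) :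
    approx K K' (toAmbient p) h' m (q + 1) = approx K K' (toAmbient p) h m (q + 1)
      + bdry _ (q + 1) ∘ₗ approxHomotopy K K' (toAmbient p) h h' m (q + 1)
      + approxHomotopy K K' (toAmbient p) h h' m q ∘ₗ bdry _ q := by
  refine Chain.hom_ext fun v hv => ?_
  obtain ⟨⟨s₀, hs₀, hsb⟩, hτ, -⟩ := simplexLift_spec v
  rw [← Set.range_comp] at hτ hsb
  have hq := le_of_injective hd hv
  have hfine := subdivChain_mem_on (K' := K') hq hmesh.nonneg hmesh.dist_le
    hmesh.le (toAmbient p ∘ v.1)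
  have hface : ∀ i : Fin (q + 2), approxHomotopy K K' (toAmbient p) h h' m q (Chain.of (v.face i))
      = toChain _ (q + 1) (prism (h ∘ simplexLift (toAmbient p) (Set.range v.1))
        (h' ∘ simplexLift (toAmbient p) (Set.range v.1))
        (subdivChain K' m q ((toAmbient p ∘ v.1) ∘ i.succAbove))) := by
    intro i
    have hvi : Function.Injective (v.face i).1 := hv.comp Fin.succAbove_right_injective
    obtain ⟨-, hτi, -⟩ := simplexLift_spec (v.face i)
    rw [← Set.range_comp] at hτi
    have hsub : convexHull ℝ (Set.range (toAmbient p ∘ (v.face i).1))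
        ⊆ convexHull ℝ (Set.range (toAmbient p ∘ v.1)) :=
      convexHull_mono (Set.range_comp_subset_range i.succAbove (toAmbient p ∘ v.1))
    have hmem : toAmbient p ((v.face i).1 0)
        ∈ convexHull ℝ (Set.range (toAmbient p ∘ (v.face i).1)) :=
      subset_convexHull ℝ _ ⟨0, rfl⟩
    -- the lift of a facet is the restriction of the lift of the simplex
    have heq := hτi.eqOn hp (convex_convexHull ℝ _) (hτ.mono hsub) hmem
      ((simplexLift_apply (v.face i) 0).trans (simplexLift_apply v (i.succAbove 0)).symm)
    rw [approxHomotopy, localChain_of _ _ hvi, LinearMap.comp_apply]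
    congr 1
    refine prism_congr (on_mono (fun l hl a ha => ?_) (subdivChain_mem_on (K' := K')
      ((Nat.le_succ q).trans hq) hmesh.nonneg hmesh.dist_le hmesh.le _))
    have := heq (hl.mem (convex_convexHull ℝ _) ha)
    simp only [Function.comp_apply, this, and_self]
  rw [LinearMap.add_apply, LinearMap.add_apply, LinearMap.comp_apply, LinearMap.comp_apply,
    bdry_of_eq_sum, map_sum]
  simp only [map_smul, hface]
  rw [approx, approx, approxHomotopy, localChain_of _ _ hv, localChain_of _ _ hv,
    localChain_of _ _ hv, LinearMap.comp_apply, LinearMap.comp_apply, LinearMap.comp_apply,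
    hc.toChain_map_eq (convex_convexHull ℝ _) hτ hfine,
    bd_subdivChain hK hmesh.ne_zero (affineIndependent_of_injective hv) hs₀ hsb]
  simp only [map_sum, map_smul]

/-- The lift of a translated simplex is the translate of the lift. -/
theorem simplexLift_deckSmul {p : Xt → K.space} (hp : IsUniversalCover p) (γ : Deck p) {q : ℕ}
    (v : OrderedSimplex (liftedComplex K (toAmbient p)) q) :
    (convexHull ℝ (Set.range (toAmbient p ∘ v.1))).EqOn
      (simplexLift (toAmbient p) (Set.range (deckSmul γ v).1))
      (fun x => γ • simplexLift (toAmbient p) (Set.range v.1) x) := by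
  obtain ⟨-, hτ, -⟩ := simplexLift_spec v
  obtain ⟨-, hτγ, -⟩ := simplexLift_spec (deckSmul γ v)
  have e : toAmbient p ∘ (deckSmul γ v).1 = toAmbient p ∘ v.1 :=
    funext fun i => toAmbient_deckSmul γ v i
  rw [← Set.range_comp] at hτ hτγ
  rw [e] at hτγ
  refine hτγ.eqOn hp (convex_convexHull ℝ _) (hτ.smul γ)
    (x := toAmbient p (v.1 0)) (subset_convexHull ℝ _ ⟨0, rfl⟩) ?_
  rw [simplexLift_apply v 0, ← toAmbient_deckSmul γ v 0]
  exact simplexLift_apply (deckSmul γ v) 0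

theorem approxHomotopy_deckMap {p : Xt → K.space} (hp : IsUniversalCover p) (hd : HasDim K d)
    (hmesh : IsMesh K' d m r δ) {g g' : Xt → Xt}
    (hc : Contiguous K K' (toAmbient p) δ g g') {γ α : Deck p} (hh : ∀ z, h (γ • z) = α • g z)
    (hh' : ∀ z, h' (γ • z) = α • g' z) (q : ℕ) (c : Chain (liftedComplex K (toAmbient p)) q) :
    approxHomotopy K K' (toAmbient p) h h' m q (deckMap γ q c)
      = deckMap α (q + 1) (approxHomotopy K K' (toAmbient p) g g' m q c) := by
  suffices approxHomotopy K K' (toAmbient p) h h' m q ∘ₗ deckMap γ q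
      = deckMap α (q + 1) ∘ₗ approxHomotopy K K' (toAmbient p) g g' m q from
    LinearMap.congr_fun this c
  refine Chain.hom_ext fun v hv => ?_
  have e : toAmbient p ∘ (deckSmul γ v).1 = toAmbient p ∘ v.1 :=
    funext fun i => toAmbient_deckSmul γ v i
  obtain ⟨-, hτ, -⟩ := simplexLift_spec v
  rw [← Set.range_comp] at hτ
  have hfine := subdivChain_mem_on (K' := K') (le_of_injective hd hv) hmesh.nonneg hmesh.dist_le
    hmesh.le (toAmbient p ∘ v.1)
  rw [LinearMap.comp_apply, LinearMap.comp_apply, deckMap_of, approxHomotopy, approxHomotopy,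
    localChain_of _ _ (deckSmul_injective γ hv), localChain_of _ _ hv, LinearMap.comp_apply,
    LinearMap.comp_apply, e, deckMap,
    chainMap_toChain _ (hc.isSimplexList_prism (convex_convexHull ℝ _) hτ hfine), map_prism]
  congr 1
  refine prism_congr (on_mono (fun l hl a ha => ?_) hfine)
  have := simplexLift_deckSmul hp γ v (hl.mem (convex_convexHull ℝ _) ha)
  simp only [Function.comp_apply, this, hh, hh', and_self]

end Approx

/-! ### Approximations of simplicial maps -/

section Exact

open ListChain

section Carrier

variable {V : Type*} {L : PreAbstractSimplicialComplex V}

theorem exists_smul_toChain {q : ℕ} (g : Fin (q + 1) → V) {x : ListChain V}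
    (hx : x ∈ on fun l => l.length = q + 1 ∧ ∀ y ∈ l, y ∈ Set.range g) :
    ∃ c : ℤ, c • toChain L q (of (List.ofFn g)) = toChain L q x := by
  refine Submodule.mem_span_singleton.mp (map_mem_of_mem_on _ _ (fun l hl => ?_) hx)
  by_cases hnd : l.Nodup
  · -- a list without repetitions is a reordering of `g`
    obtain ⟨hlen, hmem⟩ := hl
    have h1 : ∀ i : Fin (q + 1), ∃ j, g j = l.get (i.cast hlen.symm) := fun i =>
      hmem _ (List.get_mem _ _)
    choose σ hσ using h1
    have hinj : Function.Injective σ := fun i j hij => by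
      have := (hσ i).symm.trans ((congrArg g hij).trans (hσ j))
      simpa using List.nodup_iff_injective_get.mp hnd this
    have hl : l = List.ofFn (g ∘ Equiv.ofBijective σ (Finite.injective_iff_bijective.mp hinj)) := by
      apply List.ext_getElem
      · simp [hlen]
      · intro i h1 h2
        rw [List.getElem_ofFn]
        exact (hσ ⟨i, hlen ▸ h1⟩).symm
    have h2 := toChain_eq_zero_of_mem_alt (L := L) (q := q) (ofFn_perm_sub_mem_alt g
      (Equiv.ofBijective σ (Finite.injective_iff_bijective.mp hinj)))
    rw [map_sub, map_smul, sub_eq_zero, ← hl] at h2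
    rw [h2]
    exact Submodule.smul_mem _ _ (Submodule.mem_span_singleton_self _)
  · rw [toChain_eq_zero_of_not_nodup hnd]
    exact Submodule.zero_mem _

theorem OrderedSimplex.face_injective {q : ℕ} {v : OrderedSimplex L (q + 1)}
    (hv : Function.Injective v.1) (i : Fin (q + 2)) : Function.Injective (v.face i).1 :=
  hv.comp Fin.succAbove_right_injective

theorem coeff_bdry_of {q : ℕ} (v : OrderedSimplex L (q + 1)) (hv : Function.Injective v.1) :
    Chain.coeff (v.face 0) (OrderedSimplex.face_injective hv 0) (bdry L q (Chain.of v)) = 1 := by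
  classical
  rw [bdry_of_eq_sum, map_sum, Finset.sum_eq_single 0]
  · rw [map_smul, Chain.coeff_self]
    simp
  · intro i _ hi
    rw [map_smul, Chain.coeff, Chain.lift_of, Finset.sum_eq_zero, smul_zero]
    intro σ _
    refine if_neg fun h => ?_
    obtain ⟨j, hj⟩ := Fin.exists_succAbove_eq (Ne.symm hi)
    have h1 := congrFun h j
    change v.1 (i.succAbove j) = v.1 (Fin.succAbove 0 (σ j)) at h1
    rw [hj] at h1
    exact Fin.succAbove_ne 0 _ (hv h1).symm
  · simp

theorem sd_one_of {E : Type*} [NormedAddCommGroup E] [NormedSpace ℝ E] (a : E) :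
    sd 1 (of [a]) = of [a] := by
  rw [sd_succ_of, bdList, bdList, map_zero, sub_zero, sd_zero_of, if_pos rfl, cons_of]
  simp [bary]

/-- Let `φ` send each point of a face of a simplex to the value of `ψ` at some vertex of that face.
Then the subdivided simplex is carried by `φ` to the chain of the image under `ψ`: it is a multiple
of this chain, and inductively the boundaries show that the multiple is `1`. -/
theorem toChain_map_sd {E : Type*} [NormedAddCommGroup E] [NormedSpace ℝ E] {s : Finset E}
    {φ ψ : E → V}
    (hφ : ∀ T ⊆ s, T.Nonempty → ∀ x ∈ convexHull ℝ (T : Set E), ∃ v ∈ T, φ x = ψ v)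
    {U : Finset V} (hU : U ∈ L.faces) (hψ : ∀ v ∈ s, ψ v ∈ U) (m q : ℕ) (w : Fin (q + 1) → E)
    (hw : ∀ i, w i ∈ s) :
    toChain L q (map φ ((sd (q + 1))^[m] (of (List.ofFn w))))
      = toChain L q (of (List.ofFn (ψ ∘ w))) := by
  classical
  induction q with
  | zero =>
    have h1 : (sd 1)^[m] (of (List.ofFn w)) = of (List.ofFn w) := by
      rw [List.ofFn_succ, List.ofFn_zero]
      exact Function.iterate_fixed (sd_one_of _) m
    obtain ⟨v, hv, h2⟩ := hφ {w 0} (Finset.singleton_subset_iff.mpr (hw 0))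
      (Finset.singleton_nonempty _) (w 0) (by simp)
    rw [Finset.mem_singleton.mp hv] at h2
    rw [h1, map_of]
    simp [h2]
  | succ q ih =>
    set x := map φ ((sd (q + 1 + 1))^[m] (of (List.ofFn w))) with hx
    have hsmall := iterate_sd_mem_small (q + 1 + 1) (q + 1) m le_rfl (l := List.ofFn w)
      List.length_ofFn (r := Metric.diam (s : Set E)) Metric.diam_nonneg
      (convex_convexHull ℝ (Finset.univ.image w : Finset E)) ⟨fun y hy => by
        obtain ⟨i, rfl⟩ := (List.mem_ofFn' _ _).mp hy
        exact subset_convexHull ℝ _ (by simp), fun y hy z hz => by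
        obtain ⟨i, rfl⟩ := (List.mem_ofFn' _ _).mp hy
        obtain ⟨j, rfl⟩ := (List.mem_ofFn' _ _).mp hz
        exact Metric.dist_le_diam_of_mem s.finite_toSet.isBounded (hw i) (hw j)⟩
    have hws : Finset.univ.image w ⊆ s := by
      intro y hy
      obtain ⟨i, -, rfl⟩ := Finset.mem_image.mp hy
      exact hw i
    have hxon : x ∈ on fun l => l.length = q + 1 + 1 ∧ ∀ y ∈ l, y ∈ Set.range (ψ ∘ w) := by
      refine map_mem_of_mem_on _ _ (fun l hl => ?_) hsmall
      rw [map_of]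
      refine of_mem_on ⟨by rw [List.length_map, hl.1], fun y hy => ?_⟩
      obtain ⟨z, hz, rfl⟩ := List.mem_map.mp hy
      obtain ⟨v, hv, h1⟩ := hφ _ hws (Finset.univ_nonempty.image w) z (hl.2.1 z hz)
      obtain ⟨i, -, rfl⟩ := Finset.mem_image.mp hv
      exact ⟨i, h1.symm⟩
    obtain ⟨v, hv⟩ : IsSimplexList L (q + 1) (List.ofFn (ψ ∘ w)) :=
      isSimplexList_of_subset List.length_ofFn hU (fun y hy => by
        obtain ⟨i, rfl⟩ := (List.mem_ofFn' _ _).mp hy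
        exact hψ _ (hw i))
    have hv' : v.1 = ψ ∘ w := List.ofFn_injective hv
    obtain ⟨c, hc⟩ := exists_smul_toChain (L := L) _ hxon
    rw [← hc, ← hv, toChain_ofFn]
    by_cases hinj : Function.Injective v.1
    · have hb : bdry L q (toChain L (q + 1) x) = bdry L q (Chain.of v) := by
        rw [bdry_toChain, bdry_of, hx, bd_map, bd_iterate_sd _ _ (of_mem_on List.length_ofFn),
          bd_of, bdList_ofFn, hv', bdList_ofFn, ← Module.End.pow_apply]
        · simp only [map_sum, map_smul, Module.End.pow_apply]
          exact Finset.sum_congr rfl fun i _ => congrArg _ (ih _ fun j => hw _)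
        · refine on_mono (fun l hl => isSimplexList_of_subset hl.1 hU fun y hy => ?_) hxon
          obtain ⟨i, rfl⟩ := hl.2 y hy
          exact hψ _ (hw i)
      have h1 := congrArg (Chain.coeff (v.face 0) (OrderedSimplex.face_injective hinj 0)) hb
      rw [← hc, ← hv, toChain_ofFn, map_smul, map_smul, coeff_bdry_of v hinj] at h1
      have h2 : c = 1 := by simpa using h1
      rw [h2, one_smul]
    · rw [Chain.of_eq_zero hinj, smul_zero]

end Carrier

variable {E : Type*} [NormedAddCommGroup E] [NormedSpace ℝ E]
  {K K' : Geometry.SimplicialComplex ℝ E} [Finite K'.faces] {Xt : Type*} [TopologicalSpace Xt]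
  [Nonempty Xt] {p : Xt → K.space}

/-- For a coordinate of a lifting of a simplicial map, the approximation is the chain map of the
coordinate itself. -/
theorem approx_coord (hp : IsUniversalCover p) {ε : ℝ} (W : StarChoice K ε)
    (hK' : IsSubdivision K' K) {n : ℕ} {f : C(K.space, UConf n K.space)}
    (hf : IsNValuedSimplicial K' K f) (F : Lifting p f) (k : Fin n) (m q : ℕ) :
    approx K K' (toAmbient p) (fun z => nearVertex hp W (F.coord k z)) m q
      = chainMap (F.isSimplicialMap_coord hK' hp hf k) q ∘ₗ
        subdivisionMap K K' (toAmbient p) q := by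
  classical
  refine Chain.hom_ext fun v hv => ?_
  obtain ⟨-, hτ, -⟩ := simplexLift_spec v
  rw [approx, localChain_of _ _ hv, LinearMap.comp_apply, LinearMap.comp_apply, subdivisionMap,
    Chain.lift_of, if_pos hv, subdivChain, subdivList]
  simp only [map_sum]
  refine Finset.sum_congr rfl fun s _ => ?_
  by_cases h : (s.1 : Set E) ⊆ convexHull ℝ (toAmbient p '' Set.range v.1)
  · have h' : (s.1 : Set E) ⊆ convexHull ℝ (Set.range (toAmbient p ∘ v.1)) := by
      rwa [Set.range_comp]
    rw [dif_pos h, if_pos h']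
    simp only [map_smul]
    congr 1
    have hs := hτ.mono (convexHull_min h (convex_convexHull ℝ _))
    obtain ⟨U, hU, hUF⟩ := F.isSimplicialMap_coord hK' hp hf k
      (s.1.image (simplexLift (toAmbient p) (Set.range v.1))) ⟨s.1, s.2.1, _, hs, Finset.coe_image⟩
    rw [Module.End.pow_apply, toChain_map_sd (s := s.1) (U := U)
      (ψ := F.coord k ∘ simplexLift (toAmbient p) (Set.range v.1)) ?_ hU ?_ _ _ _
      (fun i => s.order_mem i), chainMap_of, ← toChain_ofFn]
    · rfl
    · intro T hT hTn x hx
      exact exists_nearVertex_eq hp W hK' hf F k (K'.down_closed s.2.1 hT hTn)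
        (hs.mono (convexHull_mono (Finset.coe_subset.mpr hT))) hx
    · intro y hy
      rw [← Finset.mem_coe, hUF]
      exact ⟨_, Finset.mem_image_of_mem _ hy, rfl⟩
  · have h' : ¬ (s.1 : Set E) ⊆ convexHull ℝ (Set.range (toAmbient p ∘ v.1)) := by
      rwa [Set.range_comp]
    rw [dif_neg h, if_neg h']
    simp only [map_zero]

end Exact

/-! ### Lifted homotopies -/

section Homotopy

open unitInterval

/-- The lifting of a homotopy commutes with covering transformations through the homomorphism
induced by its start. -/
theorem homotopyLift_smul {Xt X : Type*} [TopologicalSpace Xt] [TopologicalSpace X]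
    [LocallyPathConnectedSpace X] [T2Space X] {p : Xt → X} (hp : IsUniversalCover p) {n : ℕ}
    {f : C(X, UConf n X)} (F : Lifting p f) {H : I → X → UConf n X}
    {Ht : C(I × Xt, OrbConf p n)} (hHt : ∀ t x, (Ht (t, x)).proj = H t (p x))
    (hHt₀ : ∀ x, Ht (0, x) = F.toMap x) (γ : Deck p) (t : I) (x : Xt) :
    Ht (t, γ • x) = F.induced hp γ • Ht (t, x) := by
  have := hp.simplyConnected
  have hc := hp.isCoveringMap.continuous
  have hk : ∀ k, Continuous fun a : I × Xt => (Ht a).1 k := fun k =>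
    (continuous_apply k).comp (continuous_subtype_val.comp (map_continuous Ht))
  have hγ : Continuous fun a : I × Xt => (a.1, γ • a.2) :=
    continuous_fst.prodMk ((Deck.continuous_smul γ).comp continuous_snd)
  have hstart : ∀ k x, (Ht (0, γ • x)).1 k
      = (F.induced hp γ).left k • (Ht (0, x)).1 ((F.induced hp γ).right⁻¹ k) := fun k x => by
    rw [hHt₀, hHt₀, F.induced_spec hp, OrbConf.smul_apply]
  apply Subtype.ext
  funext k
  rw [OrbConf.smul_apply]
  -- the projections of the coordinates are permuted in a way which does not depend on time
  obtain ⟨j, hj⟩ : ∃ j, ∀ a : I × Xt, p ((Ht (a.1, γ • a.2)).1 k) = p ((Ht a).1 j) := by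
    refine select (hc.comp ((hk k).comp hγ)) (fun j => hc.comp (hk j)) ?_ (fun a => (Ht a).2)
    rintro ⟨t, x⟩
    have h1 : p ((Ht (t, γ • x)).1 k) ∈ (Ht (t, γ • x)).proj.points := ⟨k, rfl⟩
    rw [hHt, Deck.map_smul γ, ← hHt] at h1
    obtain ⟨j, hj⟩ := h1
    exact ⟨j, hj.symm⟩
  have hjk : j = (F.induced hp γ).right⁻¹ k := by
    apply (Ht (0, x)).2
    have h1 := hj (0, x)
    rw [hstart, Deck.map_smul (p := p)] at h1
    exact h1.symm
  subst hjk
  refine congrFun (hp.isCoveringMap.eq_of_comp_eq ((hk k).comp hγ)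
    ((Deck.continuous_smul ((F.induced hp γ).left k)).comp (hk _)) ?_ (0, x) (hstart k x)) (t, x)
  funext a
  exact (hj a).trans (Deck.map_smul _ _).symm

variable {E : Type*} [NormedAddCommGroup E] [NormedSpace ℝ E]
  {K K' : Geometry.SimplicialComplex ℝ E} [Finite K.faces] [Finite K'.faces] {Xt : Type*}
  [TopologicalSpace Xt] {p : Xt → K.space} {n : ℕ}

/-- A lifted homotopy is uniformly continuous on the lifted simplices: equivariance reduces this
to one lift of each simplex. -/
theorem exists_uniform (hp : IsUniversalCover p) {Φ : Deck p → Wreath (Deck p) n}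
    {Ht : C(I × Xt, OrbConf p n)} (hΦ : ∀ γ t x, Ht (t, γ • x) = Φ γ • Ht (t, x)) {ε : ℝ}
    (hε : 0 < ε) : ∃ δ > 0, ∀ s ∈ K'.faces, ∀ τ,
      IsLiftOn (toAmbient p) (convexHull ℝ (s : Set E)) τ → ∀ k,
      ∀ x ∈ convexHull ℝ (s : Set E), ∀ x' ∈ convexHull ℝ (s : Set E), ∀ t t' : I,
      dist t t' ≤ δ → dist x x' ≤ δ →
      dist (p ((Ht (t, τ x)).1 k)) (p ((Ht (t', τ x')).1 k)) < ε := by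
  have hc := hp.isCoveringMap.continuous
  have key : ∀ s : K'.faces, ∀ᶠ δ in nhdsWithin (0 : ℝ) (Set.Ioi 0), ∀ τ,
      IsLiftOn (toAmbient p) (convexHull ℝ (s.1 : Set E)) τ → ∀ k,
      ∀ x ∈ convexHull ℝ (s.1 : Set E), ∀ x' ∈ convexHull ℝ (s.1 : Set E), ∀ t t' : I,
      dist t t' ≤ δ → dist x x' ≤ δ →
      dist (p ((Ht (t, τ x)).1 k)) (p ((Ht (t', τ x')).1 k)) < ε := by
    rintro ⟨s, hs⟩
    by_cases hex : ∃ τ₀, IsLiftOn (toAmbient p) (convexHull ℝ (s : Set E)) τ₀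
    · obtain ⟨τ₀, hτ₀⟩ := hex
      have : CompactSpace (convexHull ℝ (s : Set E)) :=
        isCompact_iff_compactSpace.mp (s.finite_toSet.isCompact_convexHull ℝ)
      have hτ₀c : Continuous fun x : convexHull ℝ (s : Set E) => τ₀ x :=
        continuousOn_iff_continuous_domRestrict.mp hτ₀.continuousOn
      have hcont : Continuous fun (a : I × convexHull ℝ (s : Set E)) (k : Fin n) =>
          p ((Ht (a.1, τ₀ a.2)).1 k) := by
        refine continuous_pi fun k => hc.comp ((continuous_apply k).comp
          (continuous_subtype_val.comp ((map_continuous Ht).comp ?_)))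
        exact continuous_fst.prodMk (hτ₀c.comp continuous_snd)
      obtain ⟨δ, hδ, hu⟩ := Metric.uniformContinuous_iff.mp
        (CompactSpace.uniformContinuous_of_continuous hcont) ε hε
      filter_upwards [Ioo_mem_nhdsGT hδ] with δ' hδ' τ hτ k x hx x' hx' t t' ht hxx
      obtain ⟨v, hv⟩ := K'.nonempty_of_mem_faces hs
      have hvs := subset_convexHull ℝ (s : Set E) hv
      obtain ⟨γ, hγ⟩ := Deck.exists_smul_eq hp (x := τ₀ v) (y := τ v)
        (Subtype.ext ((hτ₀.apply_eq v hvs).trans (hτ.apply_eq v hvs).symm))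
      have heq := hτ.eqOn hp (convex_convexHull ℝ _) (hτ₀.smul γ) hvs hγ.symm
      rw [heq hx, heq hx', hΦ, hΦ, OrbConf.smul_apply, OrbConf.smul_apply,
        Deck.map_smul (p := p), Deck.map_smul (p := p)]
      have h1 := hu (a := (t, ⟨x, hx⟩)) (b := (t', ⟨x', hx'⟩))
        (max_lt (ht.trans_lt hδ'.2) (hxx.trans_lt hδ'.2))
      exact (dist_le_pi_dist _ _ ((Φ γ).right⁻¹ k)).trans_lt h1
    · exact Filter.Eventually.of_forall fun δ τ hτ => absurd ⟨τ, hτ⟩ hex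
  obtain ⟨δ, h1, h2⟩ := ((Filter.eventually_all.mpr key).and self_mem_nhdsWithin).exists
  exact ⟨δ, h2, fun s hs => h1 ⟨s, hs⟩⟩

omit [Finite K.faces] [Finite K'.faces] in
/-- The track of a small simplex during a short time is connected and of small size, so the vertices
assigned to its points span a simplex. -/
theorem contiguous_nearVertex (hp : IsUniversalCover p) {ε δ : ℝ} (W : StarChoice K ε)
    {Ht : C(I × Xt, OrbConf p n)} (hδ : ∀ s ∈ K'.faces, ∀ τ,
      IsLiftOn (toAmbient p) (convexHull ℝ (s : Set E)) τ → ∀ k,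
      ∀ x ∈ convexHull ℝ (s : Set E), ∀ x' ∈ convexHull ℝ (s : Set E), ∀ t t' : I,
      dist t t' ≤ δ → dist x x' ≤ δ →
      dist (p ((Ht (t, τ x)).1 k)) (p ((Ht (t', τ x')).1 k)) < ε) {t t' : I}
    (ht : dist t t' ≤ δ) (k : Fin n) :
    Contiguous K K' (toAmbient p) δ (fun z => nearVertex hp W ((Ht (t, z)).1 k))
      (fun z => nearVertex hp W ((Ht (t', z)).1 k)) := by
  intro s hs τ hτ l hl hls
  set C := convexHull ℝ {x | x ∈ l} with hC
  have hCs : C ⊆ convexHull ℝ (s : Set E) := convexHull_min hls.1 (convex_convexHull ℝ _)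
  have hcont : ContinuousOn (fun a : I × E => (Ht (a.1, τ a.2)).1 k) (Set.uIcc t t' ×ˢ C) := by
    have h1 : ContinuousOn (fun a : I × E => (a.1, τ a.2)) (Set.uIcc t t' ×ˢ C) :=
      continuousOn_fst.prodMk (hτ.continuousOn.comp continuousOn_snd fun a ha => hCs ha.2)
    exact ((continuous_apply k).comp
      (continuous_subtype_val.comp (map_continuous Ht))).comp_continuousOn h1
  have hpre : IsPreconnected (Set.uIcc t t' ×ˢ C) :=
    isPreconnected_uIcc.prod (convex_convexHull ℝ _).isPreconnected
  have hlC : ∀ x ∈ l, x ∈ C := fun x hx => subset_convexHull ℝ _ hx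
  obtain ⟨a, ha⟩ := List.exists_mem_of_ne_nil l hl
  obtain ⟨U, hU, h1⟩ := exists_face_nearVertex hp W (hpre.image _ hcont)
    (Set.Nonempty.image _ ⟨(t, a), Set.left_mem_uIcc, hlC a ha⟩) (by
      rintro _ ⟨⟨r, x⟩, ⟨hr, hx⟩, rfl⟩ _ ⟨⟨r', x'⟩, ⟨hr', hx'⟩, rfl⟩
      refine hδ s hs τ hτ k x (hCs hx) x' (hCs hx') r r' ?_ ?_
      · refine le_trans ?_ ht
        have h2 : ∀ {r : I}, r ∈ Set.uIcc t t' → (r : ℝ) ∈ Set.uIcc (t : ℝ) t' := fun hr => by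
          rw [Set.mem_uIcc] at hr ⊢
          exact_mod_cast hr
        exact Real.dist_le_of_mem_uIcc (h2 hr) (h2 hr')
      · obtain ⟨y, hy, y', hy', h2⟩ := convexHull_exists_dist_ge2 hx hx'
        exact h2.trans (hls.2 y hy y' hy'))
  exact ⟨U, hU, fun x hx => ⟨h1 _ ⟨(t, x), ⟨Set.left_mem_uIcc, hlC x hx⟩, rfl⟩,
    h1 _ ⟨(t', x), ⟨Set.right_mem_uIcc, hlC x hx⟩, rfl⟩⟩⟩

end Homotopy

end NValued

end

theorem mainTheorem8 {E : Type*} [NormedAddCommGroup E] [NormedSpace ℝ E]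
    -- a finite connected polyhedron `X = |K|` of dimension `d` and a finite subdivision `K'`
    (K K' : Geometry.SimplicialComplex ℝ E) [Finite K.faces] [Finite K'.faces]
    [ConnectedSpace K.space] (hK' : NValued.IsSubdivision K' K) (d : ℕ) (hd : NValued.HasDim K d)
    -- its universal covering
    {Xt : Type*} [TopologicalSpace Xt] (p : Xt → K.space) (hp : NValued.IsUniversalCover p)
    -- homotopic simplicial `n`-valued maps `f` and `g`
    (n : ℕ) (f g : C(K.space, NValued.UConf n K.space))
    (hf : NValued.IsNValuedSimplicial K' K f) (hg : NValued.IsNValuedSimplicial K' K g)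
    (H : f.Homotopy g)
    -- liftings `F` of `f` and `G` of `g`, and a lifting `Ht` of the homotopy from `F` to `G`
    (F : NValued.Lifting p f) (G : NValued.Lifting p g)
    (Ht : C(unitInterval × Xt, NValued.OrbConf p n))
    (hHt : ∀ t x, (Ht (t, x)).proj = H (t, p x))
    (hHt₀ : ∀ x, Ht (0, x) = F.toMap x) (hHt₁ : ∀ x, Ht (1, x) = G.toMap x)
    -- the chosen lifts of the simplices of `K`
    (b : ∀ q, NValued.SimplexLifts K p q) :
    G.induced hp = F.induced hp ∧
    ∑ q ∈ Finset.range (d + 1), ∑ k : Fin n,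
        (-1 : ℤ) ^ q • NValued.rho (F.induced hp)
          (NValued.timesLabel (F.trace hK' hp hf (b q) k) k) =
      ∑ q ∈ Finset.range (d + 1), ∑ k : Fin n,
        (-1 : ℤ) ^ q • NValued.rho (F.induced hp)
          (NValued.timesLabel (G.trace hK' hp hg (b q) k) k) := by
  have := hp.simplyConnected
  have hΦ := NValued.homotopyLift_smul hp F (H := fun t x => H (t, x)) hHt hHt₀
  refine ⟨?_, ?_⟩
  · obtain ⟨x₀⟩ : Nonempty Xt := inferInstance
    refine MonoidHom.ext fun γ => NValued.OrbConf.eq_of_smul_eq hp (x := G.toMap x₀) ?_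
    rw [← G.induced_spec hp, ← hHt₁, ← hHt₁, hΦ]
  obtain ⟨ε, ⟨W⟩⟩ := NValued.exists_starChoice (K := K)
  obtain ⟨δ, hδ, hu⟩ := NValued.exists_uniform (K' := K') hp hΦ W.pos
  obtain ⟨m, r, hmesh⟩ := NValued.exists_isMesh K' d hδ
  let A : unitInterval → ∀ q, Fin n →
      NValued.Chain (NValued.liftedComplex K (NValued.toAmbient p)) q →ₗ[ℤ]
        NValued.Chain (NValued.liftedComplex K (NValued.toAmbient p)) q := fun t q k =>
    NValued.approx K K' (NValued.toAmbient p)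
      (fun z => NValued.nearVertex hp W ((Ht (t, z)).1 k)) m q
  let R : unitInterval → NValued.ReidemeisterSet (F.induced hp) →₀ ℤ := fun t =>
    ∑ q ∈ Finset.range (d + 1), ∑ k : Fin n, (-1 : ℤ) ^ q • NValued.rho (F.induced hp)
      (NValued.timesLabel (NValued.trace hp (b q) (A t q k)) k)
  -- nearby times give chain homotopic approximations
  have hR : IsLocallyConstant R := by
    refine (IsLocallyConstant.iff_eventually_eq R).mpr fun t => ?_
    filter_upwards [Metric.closedBall_mem_nhds t hδ] with t' ht'
    have hc := fun k => NValued.contiguous_nearVertex hp W hu ht' k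
    refine NValued.sum_rho_trace_eq_of_homotopy hp (F.induced hp) hd b (A t') (A t)
      (fun q k => NValued.approxHomotopy K K' (NValued.toAmbient p)
        (fun z => NValued.nearVertex hp W ((Ht (t', z)).1 k))
        (fun z => NValued.nearVertex hp W ((Ht (t, z)).1 k)) m q)
      (fun q k γ c => ?_) (fun k => ?_) (fun q k => ?_)
    · refine NValued.approxHomotopy_deckMap hp hd hmesh (hc _) (fun z => ?_) (fun z => ?_) q c
      · rw [hΦ, NValued.OrbConf.smul_apply, NValued.nearVertex_smul]
      · rw [hΦ, NValued.OrbConf.smul_apply, NValued.nearVertex_smul]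
    · exact NValued.approx_homotopy_zero hd hmesh (hc k)
    · exact NValued.approx_homotopy_succ hp hK' hd hmesh (hc k) q
  have h₀ : ∀ q k, A 0 q k = NValued.chainMap (F.isSimplicialMap_coord hK' hp hf k) q ∘ₗ
      NValued.subdivisionMap K K' (NValued.toAmbient p) q := fun q k => by
    simp only [A, hHt₀]
    exact NValued.approx_coord hp W hK' hf F k m q
  have h₁ : ∀ q k, A 1 q k = NValued.chainMap (G.isSimplicialMap_coord hK' hp hg k) q ∘ₗ
      NValued.subdivisionMap K K' (NValued.toAmbient p) q := fun q k => by
    simp only [A, hHt₁]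
    exact NValued.approx_coord hp W hK' hg G k m q
  have h := hR.apply_eq_of_preconnectedSpace 0 1
  simp only [R, h₀, h₁] at h
  exact h
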